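/- Let $R$ be a commutative unital ring, let $\alpha\in R$ with $1-4\alpha$ invertible, put $K=R[t]/(t^2-t+\alpha)$, and let $k\mapsto\bar k$ be the $R$-linear involution of $K$ with $\bar t=1-t$. A *hermitian cubic norm structure* over $K/R$ is a $K$-module $J$ with a $K$-cubic map $N:J\to K$, an $R$-quadratic map $\sharp:J\to J$ with $(kj)^\sharp=\bar k^2j^\sharp$ whose linearisation $(a,b)\mapsto a\times b$ is antilinear in both arguments, and a hermitian map $T:J\times J\to K$ (linear in the first argument, $T(b,a)=\overline{T(a,b)}$), such that $$T(a,b^\sharp)=N^{(1,2)}(a,b),\quad (a^\sharp)^\sharp=N(a)a,\quad (a^\sharp\times b)\times a=\overline{N(a)}\,b+T(b,a)a^\sharp,\quad N(T(a,b)a-a^\sharp\times b)=N(a)^2\overline{N(b)}$$ hold over all scalar extensions $S[t]/(t^2-t+\alpha)$, $S$ a commutative $R$-algebra. Here $N$ and $\sharp$ are polynomial laws, and $N^{(1,2)}(a,b)$ is the coefficient of $\lambda\mu^2$ in $N(\lambda a+\mu b)$. Let $A=K\oplus J$ with product $(k_1,j_1)(k_2,j_2)=(k_1k_2+T(j_1,j_2),\,k_1j_2+\bar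 k_2j_1+j_1\times j_2)$ and involution $\overline{(k,j)}=(\bar k,j)$. Put $V_{a,b}c=-(a\bar b)c-(c\bar b)a+(c\bar a)b$, let $L_0\subseteq\operatorname{End}_R(A)\times\operatorname{End}_R(A)$ be the $R$-span of the pairs $(V_{a,b},-V_{b,a})$, and let $L=L_{-2}\oplus L_{-1}\oplus L_0\oplus L_1\oplus L_2$ be the graded Lie algebra with $L_{\pm1}=A$ and $L_{\pm2}=R(t-\bar t)$, in which $L_0$ has the commutator bracket, $[(f,g),x_1]=(fx)_1$, $[(f,g),y_{-1}]=(gy)_{-1}$, $[x_1,y_{-1}]=(V_{x,y},-V_{y,x})$, $[x_{\pm1},y_{\pm1}]=(x\bar y-y\bar x)_{\pm2}$, $[y_{\mp1},s_{\pm2}]=(sy)_{\pm1}$, $[s_2,s'_{-2}]=(L_sL_{s'},-L_{s'}L_s)$ (with $L_s$ left multiplication by $s$), and $L_0$ acts on $L_{\pm2}=[L_{\pm1},L_{\pm1}]$ by derivations. Let $$G=\{((a,v),(u,av+v^\sharp))\in A^2 : u+\bar u=a\bar a+T(v,v)\},\qquad 1=((0,0),(0,0)).$$ The *quartic norm* $\nu:G\to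 R$ is $$\nu(g)=u\bar u-a\bar a\,T(v,v)+aN(v)+\bar a\,\overline{N(v)}-T(v^\sharp,v^\sharp).$$ For $g=(x,y)\in G$ with $x=(a,v)$, $y=(u,av+v^\sharp)$, let $\exp_+(g)$ be the unique automorphism of $L$ of the form $1+e_1+e_2+e_3+e_4$ with $e_i(L_j)\subseteq L_{i+j}$, $e_1=\operatorname{ad}x_1$, $e_2c_{-1}=((x\bar c)x-yc)_1$ and $e_3c_{-1}=(\theta-\bar\theta)_2$, where for $c=(b,w)$ $$\theta=u\,\overline{(a\bar b+T(v,w))}+a\bar a\,T(v,w)+a\bar b\,T(v,v)+a\,T(w,v^\sharp)+b\,N(v)+T(v\times v^\sharp,w).$$ Let $\exp_-(g)$ be the same automorphism with the grading reversed, i.e. the conjugate of $\exp_+(g)$ by the map of $L$ that exchanges $L_i$ and $L_{-i}$ and sends $(f,g')\in L_0$ to $(g',f)$. An element $g\in G$ is *one-invertible* if there are $g_l,g_r\in G$ such that $\exp_-(g_l)\exp_+(g)\exp_-(g_r)$ reverses the grading, i.e. maps $L_i$ onto $L_{-i}$ for all $i$. The structure is *division* if $\nu(g)$ is invertible for every $g\in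 G\setminus\{1\}$. **Proposition.** A hermitian cubic norm structure over $K/R$ is division if and only if every $g\ne1$ in $G$ is one-invertible. If it is division and $R\neq 0$, then $R$ is a field and $K/R$ is a quadratic field extension. -/

import Mathlib

open scoped TensorProduct

universe u v

noncomputable section

namespace HermitianCubic

/-- `K = R[t]/(t² - t + α)`, the free `R`-module with basis `1, t` in which `t² = -α + t`.
The involution `star` of `QuadraticAlgebra` is the `R`-linear one with `t ↦ 1 - t`. -/
abbrev QuadExt {R : Type u} [CommRing R] (α : R) : Type u := QuadraticAlgebra R (-α) 1

/-- The class of `t` in `K`. -/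
abbrev tEl {R : Type u} [CommRing R] (α : R) : QuadExt α := ⟨0, 1⟩

theorem tEl_sq {R : Type u} [CommRing R] (α : R) :
    tEl α ^ 2 - tEl α + algebraMap R (QuadExt α) α = 0 := by
  ext <;> simp [sq]

theorem star_tEl {R : Type u} [CommRing R] (α : R) : star (tEl α) = 1 - tEl α := by
  ext <;> simp [QuadraticAlgebra.re_one, QuadraticAlgebra.im_one]

/-- The skew elements `k - k̄` of `K` are the multiples of `t - t̄`, the coefficient being
`k.im`. -/
theorem sub_star_eq {R : Type u} [CommRing R] {α : R} (k : QuadExt α) :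
    k - star k = k.im • (tEl α - star (tEl α)) := by
  ext
  · simp
  · simp; ring

/-- The involution of `K` as an `R`-linear map. -/
def starLin {R : Type u} [CommRing R] (α : R) : QuadExt α →ₗ[R] QuadExt α where
  toFun k := star k
  map_add' x y := star_add x y
  map_smul' r x := by ext <;> simp [mul_add]

section BaseChange

variable {R : Type u} [CommRing R] (S : Type u) [CommRing S] [Algebra R S]

/-- The `S`-bilinear extension `S ⊗ A → S ⊗ B → S ⊗ C` of an `R`-bilinear map `A → B → C`. -/
def extend₂ {A B C : Type*} [AddCommGroup A] [Module R A] [AddCommGroup B] [Module R B]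
    [AddCommGroup C] [Module R C] (f : A →ₗ[R] B →ₗ[R] C) :
    S ⊗[R] A →ₗ[R] S ⊗[R] B →ₗ[R] S ⊗[R] C :=
  TensorProduct.map₂ (LinearMap.mul R S) f

theorem extend₂_tmul {A B C : Type*} [AddCommGroup A] [Module R A] [AddCommGroup B] [Module R B]
    [AddCommGroup C] [Module R C] (f : A →ₗ[R] B →ₗ[R] C) (s s' : S) (a : A) (b : B) :
    extend₂ S f (s ⊗ₜ a) (s' ⊗ₜ b) = (s * s') ⊗ₜ f a b := by
  simp [extend₂]

/-- The involution of `K_S = S ⊗ K = S[t]/(t² - t + α)`. -/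
def starExt {α : R} : S ⊗[R] QuadExt α →ₗ[R] S ⊗[R] QuadExt α :=
  LinearMap.lTensor S (starLin α)

/-- The action of `K_S = S ⊗ K` on `J_S = S ⊗ J`. -/
def smulExt {α : R} {J : Type v} [AddCommGroup J] [Module R J] [Module (QuadExt α) J]
    [IsScalarTower R (QuadExt α) J] : S ⊗[R] QuadExt α →ₗ[R] S ⊗[R] J →ₗ[R] S ⊗[R] J :=
  extend₂ S (Algebra.lsmul R R J).toLinearMap

end BaseChange

/-- A hermitian cubic norm structure `(J, N, ♯, T)` over `K/R`, where `K = R[t]/(t² - t + α)`.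

`N` and `♯` are polynomial laws; `f.toFun' S` is the map over the scalar extension `S` of `R` and
`f.ground` is the map over `R`.  The bilinear map `cross` is the linearisation `×` of `♯`. -/
structure HermitianCubicNormStructure {R : Type u} [CommRing R] (α : R) (J : Type v)
    [AddCommGroup J] [Module R J] [Module (QuadExt α) J] [IsScalarTower R (QuadExt α) J] where
  N : J →ₚₗ[R] QuadExt α
  sharp : J →ₚₗ[R] J
  cross : J →ₗ[R] J →ₗ[R] J
  T : J →ₗ[R] J →ₗ[R] QuadExt α
  /-- `N` is `K`-homogeneous of degree `3`. -/
  N_smul : ∀ (S : Type u) [CommRing S] [Algebra R S] (k : S ⊗[R] QuadExt α) (a : S ⊗[R] J),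
    N.toFun' S (smulExt S k a) = k ^ 3 * N.toFun' S a
  /-- `(k a)^♯ = k̄² a^♯`. -/
  sharp_smul : ∀ (S : Type u) [CommRing S] [Algebra R S] (k : S ⊗[R] QuadExt α) (a : S ⊗[R] J),
    sharp.toFun' S (smulExt S k a) = smulExt S (starExt S k ^ 2) (sharp.toFun' S a)
  /-- `×` is the linearisation of `♯`. -/
  sharp_add : ∀ (S : Type u) [CommRing S] [Algebra R S] (r s : S) (a b : S ⊗[R] J),
    sharp.toFun' S (r • a + s • b) =
      r ^ 2 • sharp.toFun' S a + (r * s) • extend₂ S cross a b + s ^ 2 • sharp.toFun' S b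
  /-- `×` is antilinear in both arguments. -/
  cross_smul_left : ∀ (k : QuadExt α) (a b : J), cross (k • a) b = star k • cross a b
  cross_smul_right : ∀ (k : QuadExt α) (a b : J), cross a (k • b) = star k • cross a b
  /-- `T` is hermitian. -/
  T_smul_left : ∀ (k : QuadExt α) (a b : J), T (k • a) b = k * T a b
  T_symm : ∀ a b : J, T b a = star (T a b)
  /-- `N^{(1,2)}(a, b) = T(a, b^♯)`, where `N^{(i,j)}(a, b)` is the coefficient of `r^i s^j` in
  `N(r a + s b)`; by symmetry `N^{(2,1)}(a, b) = N^{(1,2)}(b, a)`. -/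
  N_add : ∀ (S : Type u) [CommRing S] [Algebra R S] (r s : S) (a b : S ⊗[R] J),
    N.toFun' S (r • a + s • b) =
      r ^ 3 • N.toFun' S a + (r ^ 2 * s) • extend₂ S T b (sharp.toFun' S a)
        + (r * s ^ 2) • extend₂ S T a (sharp.toFun' S b) + s ^ 3 • N.toFun' S b
  /-- `(a^♯)^♯ = N(a) a`. -/
  sharp_sharp : ∀ (S : Type u) [CommRing S] [Algebra R S] (a : S ⊗[R] J),
    sharp.toFun' S (sharp.toFun' S a) = smulExt S (N.toFun' S a) a
  /-- `(a^♯ × b) × a = conj (N(a)) b + T(b, a) a^♯`. -/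
  sharp_cross_cross : ∀ (S : Type u) [CommRing S] [Algebra R S] (a b : S ⊗[R] J),
    extend₂ S cross (extend₂ S cross (sharp.toFun' S a) b) a =
      smulExt S (starExt S (N.toFun' S a)) b + smulExt S (extend₂ S T b a) (sharp.toFun' S a)
  /-- `N(T(a, b) a - a^♯ × b) = N(a)² conj (N(b))`. -/
  N_U : ∀ (S : Type u) [CommRing S] [Algebra R S] (a b : S ⊗[R] J),
    N.toFun' S (smulExt S (extend₂ S T a b) a - extend₂ S cross (sharp.toFun' S a) b) =
      N.toFun' S a ^ 2 * starExt S (N.toFun' S b)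

namespace HermitianCubicNormStructure

variable {R : Type u} [CommRing R] {α : R} {J : Type v} [AddCommGroup J] [Module R J]
  [Module (QuadExt α) J] [IsScalarTower R (QuadExt α) J]

/-! ### The structurable algebra `A = K ⊕ J` -/

/-- `(k₁, j₁)(k₂, j₂) = (k₁ k₂ + T(j₁, j₂), k₁ j₂ + k̄₂ j₁ + j₁ × j₂)` on `A = K ⊕ J`. -/
def mul (H : HermitianCubicNormStructure α J) :
    (QuadExt α × J) →ₗ[R] (QuadExt α × J) →ₗ[R] (QuadExt α × J) :=
  LinearMap.mk₂ R
    (fun x y => (x.1 * y.1 + H.T x.2 y.2, x.1 • y.2 + star y.1 • x.2 + H.cross x.2 y.2))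
    (fun x x' y => by
      ext1
      · simp only [Prod.fst_add, Prod.snd_add, map_add, LinearMap.add_apply]; ring
      · simp only [Prod.fst_add, Prod.snd_add, map_add, LinearMap.add_apply, add_smul, smul_add]
        abel)
    (fun r x y => by
      ext1
      · simp only [Prod.smul_fst, Prod.smul_snd, map_smul, LinearMap.smul_apply, smul_add,
          smul_mul_assoc]
      · simp only [Prod.smul_fst, Prod.smul_snd, map_smul, LinearMap.smul_apply, smul_add,
          smul_assoc, smul_comm r])
    (fun x y y' => by
      ext1
      · simp only [Prod.fst_add, Prod.snd_add, map_add]; ring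
      · simp only [Prod.fst_add, Prod.snd_add, map_add, add_smul, smul_add, star_add]
        abel)
    (fun r x y => by
      have h : star (r • y.1) = r • star y.1 := (starLin α).map_smul r y.1
      ext1
      · simp only [Prod.smul_fst, Prod.smul_snd, map_smul, smul_add, mul_smul_comm]
      · simp only [Prod.smul_fst, Prod.smul_snd, map_smul, smul_add, h,
          smul_assoc, smul_comm r])

/-- The involution `(a, b) ↦ (ā, b)` of `A`. -/
def conj (_H : HermitianCubicNormStructure α J) : (QuadExt α × J) →ₗ[R] (QuadExt α × J) :=
  LinearMap.prodMap (starLin α) LinearMap.id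

/-- `V_{a,b} c = -(a b̄) c - (c b̄) a + (c ā) b`. -/
def V (H : HermitianCubicNormStructure α J) (a b : QuadExt α × J) :
    Module.End R (QuadExt α × J) :=
  -(H.mul (H.mul a (H.conj b))) - (H.mul.flip a ∘ₗ H.mul.flip (H.conj b))
    + (H.mul.flip b ∘ₗ H.mul.flip (H.conj a))

theorem V_apply (H : HermitianCubicNormStructure α J) (a b c : QuadExt α × J) :
    H.V a b c = -(H.mul (H.mul a (H.conj b)) c) - H.mul (H.mul c (H.conj b)) a
      + H.mul (H.mul c (H.conj a)) b := rfl

/-- The inner structure algebra, the `R`-span of the pairs `(V_{a,b}, -V_{b,a})`. -/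
def instr (H : HermitianCubicNormStructure α J) :
    Submodule R (Module.End R (QuadExt α × J) × Module.End R (QuadExt α × J)) :=
  Submodule.span R {p | ∃ a b : QuadExt α × J, p = (H.V a b, -H.V b a)}

/-! ### The Lie algebra `L` -/

/-- The module `L_{-2} ⊕ L_{-1} ⊕ (End A × End A) ⊕ L_1 ⊕ L_2`, which contains the Lie algebra
`L` as the submodule of elements whose middle component lies in the inner structure algebra.
Here `L_{±1} = A`, and `r : R` stands for the element `r (t - t̄)` of `L_{±2} = R (t - t̄)`. -/
abbrev Ambient (_H : HermitianCubicNormStructure α J) : Type (max u v) :=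
  R × (QuadExt α × J) × (Module.End R (QuadExt α × J) × Module.End R (QuadExt α × J)) ×
    (QuadExt α × J) × R

/-- The `R`-module underlying the Lie algebra `L`. -/
def lie (H : HermitianCubicNormStructure α J) : Submodule R H.Ambient :=
  H.instr.comap (LinearMap.fst R _ _ ∘ₗ LinearMap.snd R _ _ ∘ₗ LinearMap.snd R _ _)

/-- The element `x ȳ - y x̄` of `R (t - t̄)`, as a multiple of `t - t̄`. -/
def skew (H : HermitianCubicNormStructure α J) (x y : QuadExt α × J) : R :=
  (H.mul x (H.conj y)).1.im

theorem cross_comm (H : HermitianCubicNormStructure α J) (a b : J) :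
    H.cross a b = H.cross b a := by
  have h1 := H.sharp_add R 1 1 (1 ⊗ₜ a) (1 ⊗ₜ b)
  have h2 := H.sharp_add R 1 1 (1 ⊗ₜ b) (1 ⊗ₜ a)
  rw [add_comm ((1 : R) • _) ((1 : R) • _), h1, extend₂_tmul, extend₂_tmul] at h2
  have h3 : ((1 : R) ⊗ₜ[R] H.cross a b) = (1 : R) ⊗ₜ[R] H.cross b a := by
    simp only [one_pow, mul_one, one_smul] at h2
    rw [add_right_comm, add_right_comm (H.sharp.toFun' R (1 ⊗ₜ b)),
      add_comm (H.sharp.toFun' R (1 ⊗ₜ b))] at h2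
    exact add_left_cancel h2
  simpa using congrArg (TensorProduct.lid R J) h3

theorem skew_eq (H : HermitianCubicNormStructure α J) (x y : QuadExt α × J) :
    H.mul x (H.conj y) - H.mul y (H.conj x) = (H.skew x y • (tEl α - star (tEl α)), 0) := by
  rw [skew, ← sub_star_eq]
  ext1
  · simp [mul, conj, starLin, H.T_symm x.2 y.2, mul_comm]
  · simp [mul, conj, starLin, H.cross_comm y.2 x.2]; abel

/-- Left multiplication by the element `r (t - t̄)` on `A`. -/
def skewMul (H : HermitianCubicNormStructure α J) (r : R) : Module.End R (QuadExt α × J) :=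
  H.mul (r • (tEl α - star (tEl α)), 0)

/-- The action of an endomorphism `f` on `t - t̄ = t 1̄ - 1 t̄` by the derivation rule
`f(t) 1̄ - 1 conj(f(t)) + t conj(f(1)) - f(1) t̄`, as a multiple of `t - t̄`. -/
def skewAct (H : HermitianCubicNormStructure α J) (f : Module.End R (QuadExt α × J)) : R :=
  H.skew (f (tEl α, 0)) (1, 0) + H.skew (tEl α, 0) (f (1, 0))

/-- The Lie bracket.  On `L_0` it is the commutator; `L_0` acts on `L_{±1}` by its two components
and on `L_{±2} = [L_{±1}, L_{±1}]` by derivations; moreover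
`[x_1, y_{-1}] = (V_{x,y}, -V_{y,x})`, `[x_{±1}, y_{±1}] = (x ȳ - y x̄)_{±2}`,
`[y_{∓1}, s_{±2}] = (s y)_{±1}` and `[s_2, s'_{-2}] = (L_s L_{s'}, -L_{s'} L_s)`. -/
def bracket (H : HermitianCubicNormStructure α J) : H.Ambient → H.Ambient → H.Ambient :=
  fun ⟨r, y, (f, g), x, s⟩ ⟨r', y', (f', g'), x', s'⟩ =>
    ( H.skew y y' + r' * H.skewAct g - r * H.skewAct g',
      g y' - g' y + H.skewMul r' x - H.skewMul r x',
      ( f * f' - f' * f + H.V x y' - H.V x' y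
          + H.skewMul s * H.skewMul r' - H.skewMul s' * H.skewMul r,
        g * g' - g' * g - H.V y' x + H.V y x'
          - H.skewMul r' * H.skewMul s + H.skewMul r * H.skewMul s' ),
      f x' - f' x + H.skewMul s' y - H.skewMul s y',
      H.skew x x' + s' * H.skewAct f - s * H.skewAct f' )

/-- The component `L_i` of the grading of `L`; it is zero for `|i| > 2`. -/
def grade (H : HermitianCubicNormStructure α J) (i : ℤ) : Submodule R H.lie where
  carrier := {z | (i ≠ -2 → z.1.1 = 0) ∧ (i ≠ -1 → z.1.2.1 = 0) ∧ (i ≠ 0 → z.1.2.2.1 = 0) ∧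
    (i ≠ 1 → z.1.2.2.2.1 = 0) ∧ (i ≠ 2 → z.1.2.2.2.2 = 0)}
  zero_mem' := ⟨fun _ => rfl, fun _ => rfl, fun _ => rfl, fun _ => rfl, fun _ => rfl⟩
  add_mem' := by
    rintro a b ⟨a1, a2, a3, a4, a5⟩ ⟨b1, b2, b3, b4, b5⟩
    refine ⟨fun h => ?_, fun h => ?_, fun h => ?_, fun h => ?_, fun h => ?_⟩
    · simp [a1 h, b1 h]
    · simp [a2 h, b2 h]
    · simp [a3 h, b3 h]
    · simp [a4 h, b4 h]
    · simp [a5 h, b5 h]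
  smul_mem' := by
    rintro r a ⟨a1, a2, a3, a4, a5⟩
    refine ⟨fun h => ?_, fun h => ?_, fun h => ?_, fun h => ?_, fun h => ?_⟩
    · simp [a1 h]
    · simp [a2 h]
    · simp [a3 h]
    · simp [a4 h]
    · simp [a5 h]

/-- The copy `x_1` of `x ∈ A` in `L_1`. -/
def pos1 (H : HermitianCubicNormStructure α J) (x : QuadExt α × J) : H.lie :=
  ⟨(0, 0, 0, x, 0), H.instr.zero_mem⟩

/-- The copy `x_{-1}` of `x ∈ A` in `L_{-1}`. -/
def neg1 (H : HermitianCubicNormStructure α J) (x : QuadExt α × J) : H.lie :=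
  ⟨(0, x, 0, 0, 0), H.instr.zero_mem⟩

/-- The element `r (t - t̄)` of `L_2`. -/
def pos2 (H : HermitianCubicNormStructure α J) (r : R) : H.lie :=
  ⟨(0, 0, 0, 0, r), H.instr.zero_mem⟩

theorem swap_mem_instr (H : HermitianCubicNormStructure α J)
    {p : Module.End R (QuadExt α × J) × Module.End R (QuadExt α × J)} (hp : p ∈ H.instr) :
    p.swap ∈ H.instr := by
  induction hp using Submodule.span_induction with
  | mem p h =>
    obtain ⟨a, b, rfl⟩ := h
    have : ((H.V a b, -H.V b a) : _ × _).swap = -(H.V b a, -H.V a b) := by simp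
    rw [this]
    exact H.instr.neg_mem (Submodule.subset_span ⟨b, a, rfl⟩)
  | zero => exact H.instr.zero_mem
  | add p q _ _ hp hq => exact H.instr.add_mem hp hq
  | smul r p _ hp => exact H.instr.smul_mem r hp

/-- The reversal of `L`, which exchanges `L_i` and `L_{-i}` and maps `(f, g) ∈ L_0` to `(g, f)`. -/
def reversal (H : HermitianCubicNormStructure α J) : H.lie ≃ₗ[R] H.lie where
  toFun z := ⟨(z.1.2.2.2.2, z.1.2.2.2.1, z.1.2.2.1.swap, z.1.2.1, z.1.1), H.swap_mem_instr z.2⟩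
  invFun z := ⟨(z.1.2.2.2.2, z.1.2.2.2.1, z.1.2.2.1.swap, z.1.2.1, z.1.1), H.swap_mem_instr z.2⟩
  map_add' _ _ := rfl
  map_smul' _ _ := rfl
  left_inv _ := rfl
  right_inv _ := rfl

/-- The automorphisms of `L`: the `R`-linear bijections `φ` of `L` such that `[x, y] = z`
implies `[φ x, φ y] = φ z`. -/
def IsLieAut (H : HermitianCubicNormStructure α J) (φ : H.lie ≃ₗ[R] H.lie) : Prop :=
  ∀ x y z : H.lie, H.bracket x y = z → H.bracket (φ x) (φ y) = φ z

/-! ### The group `G`, its quartic norm, and its action on `L` -/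

/-- The set `G` of the pairs `((a, v), (u, a v + v^♯))` in `A × A` with
`u + ū = a ā + T(v, v)`; such a pair is recorded by `a`, `v` and `u`. -/
@[ext]
structure G (H : HermitianCubicNormStructure α J) where
  a : QuadExt α
  v : J
  u : QuadExt α
  rel : u + star u = a * star a + H.T v v

/-- The unit `((0, 0), (0, 0))` of `G`. -/
instance (H : HermitianCubicNormStructure α J) : One H.G := ⟨⟨0, 0, 0, by simp⟩⟩

/-- The first entry `(a, v)`. -/
def G.x {H : HermitianCubicNormStructure α J} (g : H.G) : QuadExt α × J := (g.a, g.v)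

/-- The second entry `(u, a v + v^♯)`. -/
def G.y {H : HermitianCubicNormStructure α J} (g : H.G) : QuadExt α × J :=
  (g.u, g.a • g.v + H.sharp.ground g.v)

/-- `u ū - a ā T(v, v) + a N(v) + ā conj (N(v)) - T(v^♯, v^♯)`, as an element of `K`. -/
def G.nuK {H : HermitianCubicNormStructure α J} (g : H.G) : QuadExt α :=
  g.u * star g.u - g.a * star g.a * H.T g.v g.v + g.a * H.N.ground g.v
    + star g.a * star (H.N.ground g.v) - H.T (H.sharp.ground g.v) (H.sharp.ground g.v)

/-- The quartic norm `ν`, with values in `R`. -/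
def G.nu {H : HermitianCubicNormStructure α J} (g : H.G) : R := g.nuK.re

theorem G.algebraMap_nu {H : HermitianCubicNormStructure α J} (g : H.G) :
    algebraMap R (QuadExt α) g.nu = g.nuK := by
  have key : ∀ z : QuadExt α, star z = z → algebraMap R (QuadExt α) z.re = z := by
    intro z hz
    have h := congrArg QuadraticAlgebra.re hz
    simp only [QuadraticAlgebra.re_star, one_mul, add_eq_left] at h
    ext
    · simp
    · simp [h]
  apply key
  simp only [nuK, star_add, star_sub, star_mul', star_star, ← H.T_symm]
  ring

/-- `Q_{(x,y)} c = (x c̄) x - y c`. -/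
def G.Q {H : HermitianCubicNormStructure α J} (g : H.G) (c : QuadExt α × J) : QuadExt α × J :=
  H.mul (H.mul g.x (H.conj c)) g.x - H.mul g.y c

/-- The operator `T_{(x,y)} : A → R (t - t̄)`: for `c = (b, w)` and `h = a b̄ + T(v, w)` it is
`T_{(x,y)} c = θ - θ̄` with
`θ = u h̄ + a ā T(v, w) + a b̄ T(v, v) + a T(w, v^♯) + b N(v) + T(v × v^♯, w)`,
here as a multiple of `t - t̄`. It is the formula for `x_3 c_{-1}` that results from
`3 x_3 = 3 x_2 x_1 - x_1³`, after division by `3`. -/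
def G.cubicT {H : HermitianCubicNormStructure α J} (g : H.G) (c : QuadExt α × J) : R :=
  (g.u * star (g.a * star c.1 + H.T g.v c.2) + g.a * star g.a * H.T g.v c.2
    + g.a * star c.1 * H.T g.v g.v + g.a * H.T c.2 (H.sharp.ground g.v)
    + c.1 * H.N.ground g.v + H.T (H.cross g.v (H.sharp.ground g.v)) c.2).im

/-- `φ = exp_+(g)` for `g = (x, y)`: the automorphism `φ = 1 + e₁ + e₂ + e₃ + e₄` of `L` with
`e_i` acting as `+i` on the grading, `e₁ = ad x_1`, `e₂ c_{-1} = (Q_{(x,y)} c)_1` and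
`e₃ c_{-1} = (T_{(x,y)} c)_2`.  There is only one such automorphism, since `L` is generated by
`L_1` and `L_{-1}`. -/
def IsExpPos (H : HermitianCubicNormStructure α J) (g : H.G) (φ : H.lie ≃ₗ[R] H.lie) : Prop :=
  H.IsLieAut φ ∧ ∃ e₁ e₂ e₃ e₄ : Module.End R H.lie,
    (∀ z, φ z = z + e₁ z + e₂ z + e₃ z + e₄ z) ∧
    (∀ i, ∀ z ∈ H.grade i, e₁ z ∈ H.grade (i + 1) ∧ e₂ z ∈ H.grade (i + 2) ∧
      e₃ z ∈ H.grade (i + 3) ∧ e₄ z ∈ H.grade (i + 4)) ∧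
    (∀ z, (e₁ z : H.Ambient) = H.bracket (H.pos1 g.x) z) ∧
    (∀ c, e₂ (H.neg1 c) = H.pos1 (g.Q c)) ∧
    (∀ c, e₃ (H.neg1 c) = H.pos2 (g.cubicT c))

/-- `φ = exp_-(g)`: the same action with the grading reversed. -/
def IsExpNeg (H : HermitianCubicNormStructure α J) (g : H.G) (φ : H.lie ≃ₗ[R] H.lie) : Prop :=
  H.IsExpPos g ((H.reversal.trans φ).trans H.reversal)

/-- `g` is one-invertible: there are `g_l, g_r ∈ G` such that `exp_-(g_l) exp_+(g) exp_-(g_r)`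
reverses the grading of `L`. -/
def OneInvertible (H : HermitianCubicNormStructure α J) (g : H.G) : Prop :=
  ∃ (gl gr : H.G) (El E Er : H.lie ≃ₗ[R] H.lie),
    H.IsExpNeg gl El ∧ H.IsExpPos g E ∧ H.IsExpNeg gr Er ∧
    ∀ i : ℤ, (H.grade i).map
      (El.toLinearMap ∘ₗ E.toLinearMap ∘ₗ Er.toLinearMap) = H.grade (-i)

/-- The structure is division: the quartic norm is invertible on `G \ {1}`. -/
def IsDivision (H : HermitianCubicNormStructure α J) : Prop :=
  ∀ g : H.G, g ≠ 1 → IsUnit g.nu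

end HermitianCubicNormStructure

end HermitianCubic

end

/-! The modules L_{-2} and L_2 are free of rank one. Write σ_{-2} and σ_2 for their generators t -
t̄, and δ for t - t̄ as an element of K. The proof follows these two generators only.

From one-invertible to ν invertible: exp_-(h) fixes σ_{-2}, and it never changes the σ_2-coefficient
of an element (`G.expNeg_neg2`, `G.expNeg_pos2_component`), whereas exp_+(g) σ_{-2} has
σ_2-coefficient ν(g) (`G.equiv_neg2`). So if exp_-(g_l) exp_+(g) exp_-(g_r) maps L_{-2} onto L_2,
then r ν(g) = 1 for some r; this is `OneInvertible.isUnit_nu`.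

Conversely, for ν(g) invertible one wants h in G with exp_+(g) σ_{-2} = exp_-(h)(ν(g) σ_2). Degree 1
of this equation prescribes the first entry of h and degree 0 suggests the rest; the remaining
degrees are then identities (`G.opp`, `G.equiv_neg2_eq_expNeg`). They need N(v^♯) = conj(N(v))²,
which follows from the axioms when K is a field (`ground_N_sharp`). With h' obtained in the same way
from g⁻¹, the automorphism exp_-(h⁻¹) exp_+(g) exp_-(h') exchanges the lines of σ_{-2} and σ_2
(`oneInvertible_of_equiv_neg2`). An automorphism that does this reverses the whole grading, because
degrees can be recognised by means of ad σ_2 and ad [σ_2, σ_{-2}] (`IsLieAut.map_grade`).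

R and K are fields because the elements of G with (a, v, u) = (0, 0, rδ), and with (a, 0, 0) where a
ā = 0, have quartic norms -(1 - 4α)r² and 0.

Most of the work lies in the existence of exp_+(g). Since 2 and 3 may fail to be invertible, no
exponential series is available. The algebra L_0 is described by diagonal operators, left
multiplications by J and commutators of the latter (`V_eq`), which yields the Jacobi identity
(`bracket_leibniz`). The candidate for exp_+(g) is written down explicitly (`ExpData`, `G.expData`).
The elements whose brackets it respects form a subalgebra, so a short list of conditions,
`ExpData.IsExp`, suffices (`ExpData.compatSet_eq_top`). These conditions are identities in K and J
that follow from the axioms by polarisation over R[X]. Identities between elements of R are first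
multiplied by δ and checked in K; nothing is lost, as δ² = 1 - 4α is a unit. -/

noncomputable section

namespace HermitianCubic

namespace HermitianCubicNormStructure

/-! ### The axioms over R itself and their polarisations -/

section GroundIdentities

variable {R : Type u} [CommRing R] {α : R} {J : Type v} [AddCommGroup J] [Module R J]
  [Module (QuadExt α) J] [IsScalarTower R (QuadExt α) J]

/-! ### Scalar extension of the structure maps on pure tensors -/

section Tmul

variable (H : HermitianCubicNormStructure α J) (S : Type u) [CommRing S] [Algebra R S]

theorem smulExt_tmul (s s' : S) (k : QuadExt α) (a : J) :
    smulExt S (s ⊗ₜ[R] k) (s' ⊗ₜ[R] a) = (s * s') ⊗ₜ (k • a) := by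
  simp [smulExt, extend₂_tmul]

theorem starExt_tmul (s : S) (k : QuadExt α) :
    starExt S (s ⊗ₜ[R] k) = s ⊗ₜ star k := rfl

theorem sharp_one_tmul (a : J) : H.sharp.toFun' S (1 ⊗ₜ a) = 1 ⊗ₜ H.sharp.ground a :=
  (H.sharp.one_tmul_ground_apply' a).symm

theorem N_one_tmul (a : J) : H.N.toFun' S (1 ⊗ₜ a) = 1 ⊗ₜ H.N.ground a :=
  (H.N.one_tmul_ground_apply' a).symm

theorem sharp_tmul (s : S) (a : J) :
    H.sharp.toFun' S (s ⊗ₜ a) = (s ^ 2) ⊗ₜ H.sharp.ground a := by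
  have h := H.sharp_smul S (s ⊗ₜ 1) (1 ⊗ₜ a)
  rwa [smulExt_tmul, sharp_one_tmul, starExt_tmul, star_one, Algebra.TensorProduct.tmul_pow,
    smulExt_tmul, one_pow, one_smul, one_smul, mul_one, mul_one] at h

theorem N_tmul (s : S) (a : J) : H.N.toFun' S (s ⊗ₜ a) = (s ^ 3) ⊗ₜ H.N.ground a := by
  have h := H.N_smul S (s ⊗ₜ 1) (1 ⊗ₜ a)
  rwa [smulExt_tmul, N_one_tmul, Algebra.TensorProduct.tmul_pow,
    Algebra.TensorProduct.tmul_mul_tmul, one_pow, one_smul, mul_one, mul_one, one_mul] at h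

theorem sharp_add' (a b : S ⊗[R] J) : H.sharp.toFun' S (a + b) =
    H.sharp.toFun' S a + extend₂ S H.cross a b + H.sharp.toFun' S b := by
  simpa using H.sharp_add S 1 1 a b

theorem N_add' (a b : S ⊗[R] J) : H.N.toFun' S (a + b) =
    H.N.toFun' S a + extend₂ S H.T b (H.sharp.toFun' S a)
      + extend₂ S H.T a (H.sharp.toFun' S b) + H.N.toFun' S b := by
  simpa using H.N_add S 1 1 a b

end Tmul

/-- The coefficient of `X ^ n` of an element of `R[X] ⊗ M`. -/
def coeffTensor (M : Type*) [AddCommGroup M] [Module R M] (n : ℕ) :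
    Polynomial R ⊗[R] M →ₗ[R] M :=
  TensorProduct.lid R M ∘ₗ (Polynomial.lcoeff R n).rTensor M

theorem coeffTensor_tmul (M : Type*) [AddCommGroup M] [Module R M] (n : ℕ) (p : Polynomial R)
    (m : M) : coeffTensor M n (p ⊗ₜ[R] m) = p.coeff n • m := by
  simp [coeffTensor]

variable (H : HermitianCubicNormStructure α J)

theorem ground_eq_of_tmul {M : Type*} [AddCommGroup M] [Module R M] {a b : M}
    (h : (1 : R) ⊗ₜ[R] a = 1 ⊗ₜ[R] b) : a = b := by
  simpa using congrArg (TensorProduct.lid R M) h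

theorem ground_sharp_add (a b : J) :
    H.sharp.ground (a + b) = H.sharp.ground a + H.cross a b + H.sharp.ground b := by
  apply ground_eq_of_tmul (R := R)
  rw [← sharp_one_tmul, TensorProduct.tmul_add, sharp_add']
  simp [sharp_one_tmul, extend₂_tmul, TensorProduct.tmul_add]

theorem ground_sharp_smul (k : QuadExt α) (a : J) :
    H.sharp.ground (k • a) = star k ^ 2 • H.sharp.ground a := by
  apply ground_eq_of_tmul (R := R)
  have h := H.sharp_smul R (1 ⊗ₜ k) (1 ⊗ₜ a)
  simpa [smulExt_tmul, sharp_one_tmul, starExt_tmul, Algebra.TensorProduct.tmul_pow] using h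

theorem ground_N_smul (k : QuadExt α) (a : J) :
    H.N.ground (k • a) = k ^ 3 * H.N.ground a := by
  apply ground_eq_of_tmul (R := R)
  have h := H.N_smul R (1 ⊗ₜ k) (1 ⊗ₜ a)
  simpa [smulExt_tmul, N_one_tmul, Algebra.TensorProduct.tmul_pow] using h

theorem ground_sharp_zero : H.sharp.ground 0 = 0 := by
  simpa using H.ground_sharp_smul 0 0

theorem ground_N_zero : H.N.ground 0 = 0 := by
  simpa using H.ground_N_smul 0 0

theorem ground_N_add (a b : J) :
    H.N.ground (a + b) = H.N.ground a + H.T b (H.sharp.ground a) + H.T a (H.sharp.ground b)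
      + H.N.ground b := by
  apply ground_eq_of_tmul (R := R)
  rw [← N_one_tmul, TensorProduct.tmul_add, N_add']
  simp [sharp_one_tmul, N_one_tmul, extend₂_tmul, TensorProduct.tmul_add]

theorem ground_sharp_sharp (a : J) :
    H.sharp.ground (H.sharp.ground a) = H.N.ground a • a := by
  apply ground_eq_of_tmul (R := R)
  have h := H.sharp_sharp R (1 ⊗ₜ a)
  simpa [smulExt_tmul, sharp_one_tmul, N_one_tmul] using h

theorem cross_cross_sharp (a b : J) :
    H.cross (H.cross (H.sharp.ground a) b) a =
      star (H.N.ground a) • b + H.T b a • H.sharp.ground a := by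
  apply ground_eq_of_tmul (R := R)
  have h := H.sharp_cross_cross R (1 ⊗ₜ a) (1 ⊗ₜ b)
  simpa [smulExt_tmul, sharp_one_tmul, N_one_tmul, extend₂_tmul, starExt_tmul,
    TensorProduct.tmul_add] using h

theorem ground_N_U (a b : J) :
    H.N.ground (H.T a b • a - H.cross (H.sharp.ground a) b) =
      H.N.ground a ^ 2 * star (H.N.ground b) := by
  apply ground_eq_of_tmul (R := R)
  have h := H.N_U R (1 ⊗ₜ a) (1 ⊗ₜ b)
  simpa [smulExt_tmul, sharp_one_tmul, N_one_tmul, extend₂_tmul, starExt_tmul,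
    Algebra.TensorProduct.tmul_pow, ← TensorProduct.tmul_sub] using h

@[simp]
theorem cross_self (a : J) : H.cross a a = (2 : QuadExt α) • H.sharp.ground a := by
  have h1 := H.ground_sharp_smul 2 a
  rw [two_smul, ground_sharp_add] at h1
  have h2 : star (2 : QuadExt α) = 2 := star_ofNat 2
  rw [h2] at h1
  linear_combination (norm := module) h1

theorem star_T (a b : J) : star (H.T a b) = H.T b a := (H.T_symm a b).symm

theorem T_smul_right (k : QuadExt α) (a b : J) : H.T a (k • b) = star k * H.T a b := by
  rw [H.T_symm, H.T_smul_left, star_mul', ← H.T_symm]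

/-- The trilinear form `T(a, b × c)` is symmetric. -/
theorem T_cross_rotate (a b c : J) : H.T a (H.cross b c) = H.T c (H.cross a b) := by
  -- Expand N((a + b) + c) = N(a + (b + c)) in both ways; everything but the two trilinear terms
  -- cancels.
  have h1 := H.ground_N_add (a + b) c
  have h2 := H.ground_N_add a (b + c)
  rw [add_assoc] at h1
  rw [h1, ground_N_add, ground_N_add H b c, ground_sharp_add, ground_sharp_add] at h2
  simp only [map_add, LinearMap.add_apply] at h2
  linear_combination -h2

theorem T_cross_left_comm (a b c : J) : H.T a (H.cross b c) = H.T b (H.cross a c) := by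
  rw [T_cross_rotate, T_cross_rotate, H.cross_comm c a]

/-- Euler's relation for a cubic form: the coefficient of X in N((1 + X)a) = (1 + X)³ N(a). Working
over R[X] makes the comparison of coefficients legitimate whatever the size of R. -/
theorem T_self_sharp (a : J) : H.T a (H.sharp.ground a) = 3 * H.N.ground a := by
  have h : H.N.toFun' (Polynomial R) ((1 + Polynomial.X) ⊗ₜ a) = _ := H.N_tmul _ _ a
  rw [TensorProduct.add_tmul, N_add'] at h
  have h2 := congrArg (coeffTensor (QuadExt α) 1) h
  have e : ((1 + Polynomial.X : Polynomial R) ^ 3) = 1 + 3 * Polynomial.X + 3 * Polynomial.X ^ 2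
    + Polynomial.X ^ 3 := by ring
  rw [e] at h2
  simp [sharp_tmul, N_tmul, extend₂_tmul, coeffTensor_tmul, Polynomial.coeff_X,
    Polynomial.coeff_one, Polynomial.coeff_X_pow] at h2
  have h3 : (3 : R) • H.N.ground a = 3 * H.N.ground a := by
    rw [Algebra.smul_def, map_ofNat]
  rw [← h3, ← h2]

/-- Derivative of the third axiom: put a + Xc for a over R[X] and take the coefficient of X. -/
theorem cross_cross_sharp_linear (a b c : J) :
    H.cross (H.cross (H.sharp.ground a) b) c + H.cross (H.cross (H.cross a c) b) a =
      H.T (H.sharp.ground a) c • b + H.T b c • H.sharp.ground a + H.T b a • H.cross a c := by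
  have h := H.sharp_cross_cross (Polynomial R) (1 ⊗ₜ a + Polynomial.X ⊗ₜ c) (1 ⊗ₜ b)
  have h2 := congrArg (coeffTensor J 1) h
  simp [sharp_tmul, N_tmul, extend₂_tmul, coeffTensor_tmul, Polynomial.coeff_X, sharp_add',
    N_add', smulExt_tmul, starExt_tmul,
    Polynomial.coeff_one, Polynomial.coeff_X_pow, ← pow_succ, ← pow_succ'] at h2
  rw [star_T] at h2
  linear_combination (norm := module) h2

/-- Coefficient of X² in the axiom for ((a + Xb)^♯)^♯. The coefficient of X is `sharp_cross_cross'`.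
-/
theorem sharp_cross (a b : J) :
    H.cross (H.sharp.ground a) (H.sharp.ground b) + H.sharp.ground (H.cross a b) =
      H.T a (H.sharp.ground b) • a + H.T b (H.sharp.ground a) • b := by
  have h := H.sharp_sharp (Polynomial R) (1 ⊗ₜ a + Polynomial.X ⊗ₜ b)
  have h2 := congrArg (coeffTensor J 2) h
  simp [sharp_tmul, N_tmul, extend₂_tmul, coeffTensor_tmul, Polynomial.coeff_X, sharp_add',
    N_add', smulExt_tmul,
    Polynomial.coeff_one, Polynomial.coeff_X_pow, ← pow_succ, ← pow_succ', ← pow_mul] at h2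
  linear_combination (norm := module) h2

/-- The polarisation of `(a^♯ × b) × a = conj (N a) b + T(b, a) a^♯`. -/
theorem cross_cross_cross_cyclic (a b c d : J) :
    H.cross (H.cross (H.cross a d) b) c + H.cross (H.cross (H.cross a c) b) d
      + H.cross (H.cross (H.cross d c) b) a =
    H.T (H.cross a d) c • b + H.T b c • H.cross a d + H.T b d • H.cross a c
      + H.T b a • H.cross d c := by
  have h1 := H.cross_cross_sharp_linear (a + d) b c
  have h2 := H.cross_cross_sharp_linear a b c
  have h3 := H.cross_cross_sharp_linear d b c
  simp only [ground_sharp_add, map_add, LinearMap.add_apply, add_smul] at h1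
  linear_combination (norm := module) h1 - h2 - h3

/-- The polarisation of `a^♯ × b^♯ + (a × b)^♯ = T(a, b^♯) a + T(b, a^♯) b`. -/
theorem cross_cross_pairings (a b c d : J) :
    H.cross (H.cross a b) (H.cross c d) + H.cross (H.cross a c) (H.cross b d)
      + H.cross (H.cross a d) (H.cross b c) =
    H.T a (H.cross b c) • d + H.T b (H.cross c d) • a + H.T c (H.cross d a) • b
      + H.T d (H.cross a b) • c := by
  have e (x y z : J) : H.cross (H.sharp.ground x) (H.cross y z) +
      H.cross (H.cross x y) (H.cross x z) = H.T x (H.cross y z) • x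
        + H.T y (H.sharp.ground x) • z + H.T z (H.sharp.ground x) • y := by
    have h1 := H.sharp_cross x (y + z)
    have h2 := H.sharp_cross x y
    have h3 := H.sharp_cross x z
    simp only [ground_sharp_add, map_add, LinearMap.add_apply, add_smul, smul_add] at h1
    linear_combination (norm := module) h1 - h2 - h3
  have h1 := e (a + b) c d
  have h2 := e a c d
  have h3 := e b c d
  simp only [ground_sharp_add, map_add, LinearMap.add_apply, add_smul, smul_add] at h1
  rw [H.T_cross_rotate a b c, H.T_cross_rotate c d a, H.cross_comm (H.cross a d)]
  linear_combination (norm := module) h1 - h2 - h3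

theorem T_cross_cross (a b c d : J) :
    H.T (H.cross a b) (H.cross c d) = H.T c (H.cross d (H.cross a b)) :=
  (H.T_cross_rotate _ _ _).trans (by rw [H.T_cross_left_comm, H.T_cross_rotate, H.cross_comm d])

theorem T_cross_left_rotate (a b c : J) : H.T (H.cross a b) c = H.T (H.cross b c) a := by
  rw [← star_T, T_cross_rotate, H.T_cross_rotate b, star_T, H.cross_comm]

end GroundIdentities

/-! ### Generators of L_0 and their action by derivations -/

section Operators

/-- The skew generator `t - t̄` of `K`. -/
def delta {R : Type u} [CommRing R] (α : R) : QuadExt α := tEl α - star (tEl α)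

section Delta

variable {R : Type u} [CommRing R] {α : R}

@[simp]
theorem star_delta : star (delta α) = -delta α := by
  simp [delta]

@[simp]
theorem delta_re : (delta α).re = -1 := by simp [delta]

@[simp]
theorem delta_im : (delta α).im = 2 := by simp [delta]; norm_num

theorem delta_sq : delta α * delta α = algebraMap R (QuadExt α) (1 - 4 * α) := by
  ext
  · simp [QuadraticAlgebra.re_mul, QuadraticAlgebra.re_one]; ring
  · simp [QuadraticAlgebra.im_mul, QuadraticAlgebra.im_one]; ring

@[simp]
theorem star_algebraMap (r : R) :
    star (algebraMap R (QuadExt α) r) = algebraMap R (QuadExt α) r := by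
  ext <;> simp

/-- The bridge from R to K. The bracket into L_{±2} and the operator T_{(x,y)} are imaginary parts;
multiplied by δ they become k - k̄, so that identities between them can be checked by commutative
algebra in K. -/
theorem algebraMap_im_mul_delta (k : QuadExt α) :
    algebraMap R (QuadExt α) k.im * delta α = k - star k := by
  rw [sub_star_eq, Algebra.smul_def, delta]

theorem im_eq_zero_of_star_eq {k : QuadExt α} (h : star k = k) : k.im = 0 := by
  have h := congrArg QuadraticAlgebra.re h
  simpa using h

theorem im_eq_im_of_star {k l : QuadExt α} (h : star (k - l) = k - l) : k.im = l.im := by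
  have := im_eq_zero_of_star_eq h
  simpa [sub_eq_zero] using this

/-- The trace form `k ↦ k + k̄`, read off from the imaginary part. -/
theorem algebraMap_im_delta_mul (k : QuadExt α) :
    algebraMap R (QuadExt α) (delta α * k).im = k + star k := by
  ext
  · simp [QuadraticAlgebra.im_mul]; ring
  · simp

end Delta

variable {R : Type u} [CommRing R] {α : R} {J : Type v} [AddCommGroup J] [Module R J]
  [Module (QuadExt α) J] [IsScalarTower R (QuadExt α) J]

variable (H : HermitianCubicNormStructure α J)

theorem mul_mk (k l : QuadExt α) (i j : J) :
    H.mul (k, i) (l, j) = (k * l + H.T i j, k • j + star l • i + H.cross i j) := rfl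

theorem conj_mk (k : QuadExt α) (j : J) : H.conj (k, j) = (star k, j) := rfl

theorem skew_mk (k l : QuadExt α) (i j : J) :
    H.skew (k, i) (l, j) = (k * star l + H.T i j).im := rfl

theorem skewMul_mk (r : R) (x : QuadExt α × J) :
    H.skewMul r x = (algebraMap R (QuadExt α) r * delta α) • x := by
  obtain ⟨k, j⟩ := x
  rw [← Algebra.smul_def]
  simp [skewMul, mul_mk, delta]

/-- The endomorphism of `A` acting as `-2c + c̄` on `K` and as `-c̄` on `J`. -/
def diag (_H : HermitianCubicNormStructure α J) (c : QuadExt α) : Module.End R (QuadExt α × J) :=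
  LinearMap.prodMap (Algebra.lsmul R R (QuadExt α) (-2 * c + star c))
    (Algebra.lsmul R R J (-star c))

theorem diag_mk (c m : QuadExt α) (w : J) :
    H.diag c (m, w) = ((-2 * c + star c) * m, -(star c • w)) := by
  simp [diag]
  ring

/-- Left multiplication by an element of `J`. -/
def lmul (j : J) : Module.End R (QuadExt α × J) := H.mul (0, j)

theorem lmul_mk (j : J) (m : QuadExt α) (w : J) :
    H.lmul j (m, w) = (H.T j w, star m • j + H.cross j w) := by
  simp [lmul, mul_mk]

/-- The commutator of two left multiplications by elements of `J`. -/
def inn (i j : J) : Module.End R (QuadExt α × J) := H.lmul i * H.lmul j - H.lmul j * H.lmul i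

/-- The operator `w ↦ T(w, j) i - (w × i) × j`. -/
def D (i j w : J) : J := H.T w j • i - H.cross (H.cross w i) j

theorem inn_mk (i j w : J) (m : QuadExt α) :
    H.inn i j (m, w) = ((H.T i j - H.T j i) * m, H.D i j w - H.D j i w) := by
  refine Prod.ext ?_ ?_
  · simp [inn, lmul_mk, T_smul_right]
    rw [H.T_cross_left_comm]
    ring
  · simp [inn, lmul_mk, H.cross_smul_right, star_T, D]
    rw [H.cross_comm j i, H.cross_comm i w, H.cross_comm j w, H.cross_comm i (H.cross w j),
      H.cross_comm j (H.cross w i)]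
    module

theorem end_neg_mul {M : Type*} [AddCommGroup M] [Module R M] (f g : Module.End R M) :
    -f * g = -(f * g) := neg_mul f g

theorem end_mul_neg {M : Type*} [AddCommGroup M] [Module R M] (f g : Module.End R M) :
    f * -g = -(f * g) := mul_neg f g

/-- The normal form of the elements of L_0. Since `inn` is a commutator of left multiplications,
statements that survive sums and commutators need to be checked on `diag` and `lmul` only. -/
theorem V_eq (k l : QuadExt α) (i j : J) : H.V (k, i) (l, j) =
    H.diag (k * star l + H.T j i) - H.lmul (k • j + l • i + H.cross i j)
      - H.inn i j := by
  rw [inn]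
  refine LinearMap.ext fun ⟨m, w⟩ => Prod.ext ?_ ?_
  · simp [V_apply, mul_mk, conj_mk, T_smul_right, H.T_smul_left, diag_mk, lmul_mk, star_T]
    rw [H.T_cross_left_rotate w j i, H.T_cross_left_rotate w i j, H.T_cross_left_comm j i,
      H.cross_comm j i]
    ring
  · simp [V_apply, mul_mk, conj_mk, T_smul_right, H.T_smul_left, diag_mk, lmul_mk, star_T,
      H.cross_smul_left, H.cross_smul_right]
    rw [H.cross_comm j w, H.cross_comm i w, H.cross_comm j i, H.cross_comm i (H.cross w j),
      H.cross_comm j (H.cross w i)]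
    module

theorem diag_add (c d : QuadExt α) :
    H.diag (c + d) = H.diag c + H.diag d := by
  refine LinearMap.ext fun ⟨m, w⟩ => Prod.ext ?_ ?_
  · simp [diag_mk]; ring
  · simp [diag_mk]; module

theorem lmul_add (i j : J) : H.lmul (i + j) = H.lmul i + H.lmul j := by
  refine LinearMap.ext fun ⟨m, w⟩ => Prod.ext ?_ ?_
  · simp [lmul_mk]
  · simp [lmul_mk]; abel

/-- The pair `(V_{x,y}, -V_{y,x})`. -/
def vPair (x y : QuadExt α × J) :
    Module.End R (QuadExt α × J) × Module.End R (QuadExt α × J) := (H.V x y, -H.V y x)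

/-- The element of `L_0` acting diagonally. -/
def diagPair (H : HermitianCubicNormStructure α J) (c : QuadExt α) :
    Module.End R (QuadExt α × J) × Module.End R (QuadExt α × J) := (H.diag c, -H.diag (star c))

/-- The element of `L_0` acting by left multiplications. -/
def lmulPair (j : J) :
    Module.End R (QuadExt α × J) × Module.End R (QuadExt α × J) := (H.lmul j, -H.lmul j)

/-- The commutator of two elements of `L_0` acting by left multiplications. -/
def innPair (i j : J) :
    Module.End R (QuadExt α × J) × Module.End R (QuadExt α × J) := (H.inn i j, H.inn i j)

theorem innPair_eq (i j : J) : H.innPair i j =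
    H.lmulPair i * H.lmulPair j - H.lmulPair j * H.lmulPair i := by
  simp [innPair, lmulPair, inn, end_neg_mul, end_mul_neg]

theorem inn_comm (i j : J) : H.inn i j = -H.inn j i := by
  simp [inn]

theorem inn_add_left (i i' j : J) : H.inn (i + i') j = H.inn i j + H.inn i' j := by
  simp only [inn, lmul_add, add_mul, mul_add]; abel

theorem inn_add_right (i j j' : J) : H.inn i (j + j') = H.inn i j + H.inn i j' := by
  simp only [inn, lmul_add, add_mul, mul_add]; abel

theorem inn_smul_left (k : QuadExt α) (i j : J) : H.inn (k • i) j = H.inn i (star k • j) := by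
  refine LinearMap.ext fun ⟨m, w⟩ => Prod.ext ?_ ?_
  · simp [inn_mk, H.T_smul_left, T_smul_right]
  · simp [inn_mk, D, H.T_smul_left, T_smul_right, H.cross_smul_left, H.cross_smul_right]
    module

theorem vPair_eq (k l : QuadExt α) (i j : J) : H.vPair (k, i) (l, j) =
    H.diagPair (k * star l + H.T j i) - H.lmulPair (k • j + l • i + H.cross i j)
      - H.innPair i j := by
  ext1
  · simp [vPair, V_eq, diagPair, lmulPair, innPair]
  · simp only [vPair, V_eq, diagPair, lmulPair, innPair, Prod.snd_sub, star_add, star_mul',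
      star_star, star_T]
    rw [H.cross_comm j i, add_comm (l • i), mul_comm l, H.inn_comm j i]
    abel

@[simp]
theorem lmul_zero : H.lmul 0 = 0 := by
  refine LinearMap.ext fun ⟨m, w⟩ => ?_
  simp [lmul_mk]

@[simp]
theorem diag_zero : H.diag 0 = 0 := by
  refine LinearMap.ext fun ⟨m, w⟩ => ?_
  simp [diag_mk]

@[simp]
theorem inn_zero_right (j : J) : H.inn j 0 = 0 := by simp [inn]

theorem lmul_neg (j : J) : H.lmul (-j) = -H.lmul j := by
  have h := H.lmul_add j (-j)
  rw [add_neg_cancel, lmul_zero] at h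
  exact (neg_eq_of_add_eq_zero_right h.symm).symm

theorem diag_mul_lmul (c : QuadExt α) (j : J) :
    H.diag c * H.lmul j = H.lmul j * H.diag c + H.lmul ((star c - c) • j) := by
  refine LinearMap.ext fun ⟨m, w⟩ => Prod.ext ?_ ?_
  · simp [diag_mk, lmul_mk, H.T_smul_left, T_smul_right]; ring
  · simp [diag_mk, lmul_mk, H.cross_smul_left, H.cross_smul_right]; module

theorem D_add (i j k w : J) : H.D i j (k + w) = H.D i j k + H.D i j w := by
  simp [D, add_smul]; abel

theorem D_smul (c : QuadExt α) (i j w : J) : H.D i j (c • w) = c • H.D i j w := by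
  simp [D, H.T_smul_left, H.cross_smul_left, mul_smul, smul_sub]

theorem D_smul_left (c : QuadExt α) (i j w : J) : H.D (c • i) j w = c • H.D i j w := by
  simp [D, H.cross_smul_left, H.cross_smul_right, smul_sub, smul_comm c]

theorem D_smul_right (c : QuadExt α) (i j w : J) : H.D i (c • j) w = star c • H.D i j w := by
  simp [D, H.T_smul_right, H.cross_smul_right, mul_smul, smul_sub]

theorem diag_sub (c d : QuadExt α) : H.diag (c - d) = H.diag c - H.diag d := by
  rw [eq_sub_iff_add_eq, ← diag_add, sub_add_cancel]

theorem lmul_sub (i j : J) : H.lmul (i - j) = H.lmul i - H.lmul j := by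
  rw [eq_sub_iff_add_eq, ← lmul_add, sub_add_cancel]

theorem T_D_left (i j k w : J) : H.T (H.D i j k) w = H.T k (H.D j i w) := by
  simp [D, H.T_smul_left, T_smul_right, star_T]
  rw [H.T_cross_left_rotate, H.T_cross_cross, H.cross_comm j w, H.cross_comm i]
  ring

theorem D_cross (i j k w : J) : H.D i j (H.cross k w) =
    -(H.T i j • H.cross k w) - H.cross (H.D j i k) w - H.cross k (H.D j i w) := by
  have h := H.cross_cross_cross_cyclic k i j w
  simp [D, H.cross_smul_left, H.cross_smul_right, star_T]
  rw [H.cross_comm k (H.cross (H.cross w j) i), H.cross_comm j w]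
  linear_combination (norm := module) -h

theorem inn_mul_lmul (i j p : J) : H.inn i j * H.lmul p = H.lmul p * H.inn i j +
    H.lmul (H.D i j p - H.D j i p + (H.T i j - H.T j i) • p) := by
  refine LinearMap.ext fun ⟨m, w⟩ => Prod.ext ?_ ?_
  · simp [inn_mk, lmul_mk, H.T_smul_left, T_D_left]; ring
  · simp [inn_mk, lmul_mk, H.cross_smul_left, star_T, D_cross, D_add, D_smul]
    module

/-- A linear relation between the generators of L_0, the full polarisation of the fact that inn(v,
v^♯) is diagonal (`inn_sharp`). Because of it normal forms are not unique, and `isInner_lmulPair`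
cannot compare the three types of terms separately. -/
theorem diag_add_inn_cross (i j p : J) :
    H.diag (H.T j (H.cross p i) - H.T (H.cross p i) j) + H.inn p (H.cross i j)
      + H.inn i (H.cross j p) + H.inn j (H.cross p i) = 0 := by
  refine LinearMap.ext fun ⟨m, w⟩ => Prod.ext ?_ ?_
  · simp [inn_mk, diag_mk, star_T]
    rw [H.T_cross_rotate i j p, H.T_cross_rotate p i j, H.T_cross_left_rotate p i j,
      H.T_cross_left_rotate i j p]
    ring
  · simp [inn_mk, diag_mk, star_T, D]
    have h1 := H.cross_cross_pairings w p i j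
    have h2 := H.cross_cross_cross_cyclic i w j p
    rw [H.T_cross_left_rotate p i j, H.cross_comm j p, H.cross_comm p i]
    simp only [H.cross_comm w] at *
    rw [H.T_cross_rotate i j w, H.T_cross_rotate j p w, H.T_cross_rotate p i j,
      H.cross_comm p i, H.cross_comm j p] at h1
    rw [H.T_cross_left_rotate i p j, H.T_cross_left_rotate p j i, H.cross_comm j i] at h2
    linear_combination (norm := module) h2 - h1

@[simp]
theorem innPair_zero_right (j : J) : H.innPair j 0 = 0 := by simp [innPair]

@[simp]
theorem diagPair_zero : H.diagPair 0 = 0 := by simp [diagPair]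

@[simp]
theorem lmulPair_zero : H.lmulPair 0 = 0 := by simp [lmulPair]

theorem vPair_diag (c : QuadExt α) : H.vPair (c, 0) (1, 0) = H.diagPair c := by
  simp [vPair_eq]
  
theorem vPair_lmul (j : J) : H.vPair (0, j) (1, 0) = -H.lmulPair j := by
  simp [vPair_eq]

theorem vPair_mem (x y : QuadExt α × J) : H.vPair x y ∈ H.instr :=
  Submodule.subset_span ⟨x, y, rfl⟩

theorem skew_add_left (x y z : QuadExt α × J) : H.skew (x + y) z = H.skew x z + H.skew y z := by
  simp [skew]

theorem skew_add_right (x y z : QuadExt α × J) : H.skew x (y + z) = H.skew x y + H.skew x z := by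
  simp [skew]

theorem skew_smul_left (r : R) (x y : QuadExt α × J) : H.skew (r • x) y = r * H.skew x y := by
  simp [skew]

theorem skew_smul_right (r : R) (x y : QuadExt α × J) : H.skew x (r • y) = r * H.skew x y := by
  simp [skew]

theorem skew_neg_left (x y : QuadExt α × J) : H.skew (-x) y = -H.skew x y := by
  simp [skew]

theorem skew_neg_right (x y : QuadExt α × J) : H.skew x (-y) = -H.skew x y := by
  simp [skew]

theorem skew_sub_left (x y z : QuadExt α × J) : H.skew (x - y) z = H.skew x z - H.skew y z := by
  simp [skew]

theorem skew_sub_right (x y z : QuadExt α × J) : H.skew x (y - z) = H.skew x y - H.skew x z := by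
  simp [skew]

theorem skew_comm (x y : QuadExt α × J) : H.skew x y = -H.skew y x := by
  obtain ⟨k, i⟩ := x
  obtain ⟨l, j⟩ := y
  rw [skew_mk, skew_mk, ← QuadraticAlgebra.im_neg]
  apply im_eq_im_of_star
  simp [star_T]; ring

@[simp]
theorem skew_zero_left (x : QuadExt α × J) : H.skew 0 x = 0 := by simp [skew]

@[simp]
theorem skew_zero_right (x : QuadExt α × J) : H.skew x 0 = 0 := by simp [skew]

/-- `skewAct` as a linear map. -/
def skewActLin : Module.End R (QuadExt α × J) →ₗ[R] R where
  toFun := H.skewAct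
  map_add' f g := by simp [skewAct, skew_add_left, skew_add_right]; ring
  map_smul' r f := by simp [skewAct, skew_smul_left, skew_smul_right]; ring

theorem skewAct_add (f g : Module.End R (QuadExt α × J)) :
    H.skewAct (f + g) = H.skewAct f + H.skewAct g := H.skewActLin.map_add f g

theorem skewAct_sub (f g : Module.End R (QuadExt α × J)) :
    H.skewAct (f - g) = H.skewAct f - H.skewAct g := H.skewActLin.map_sub f g

theorem skewAct_neg (f : Module.End R (QuadExt α × J)) :
    H.skewAct (-f) = -H.skewAct f := H.skewActLin.map_neg f

theorem skewAct_smul (r : R) (f : Module.End R (QuadExt α × J)) :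
    H.skewAct (r • f) = r * H.skewAct f := H.skewActLin.map_smul r f


theorem V_add_left (x y z : QuadExt α × J) : H.V (x + y) z = H.V x z + H.V y z := by
  refine LinearMap.ext fun w => ?_
  simp [V_apply]; abel

theorem V_add_right (x y z : QuadExt α × J) : H.V x (y + z) = H.V x y + H.V x z := by
  refine LinearMap.ext fun w => ?_
  simp [V_apply]; abel

theorem V_smul_left (r : R) (x y : QuadExt α × J) : H.V (r • x) y = r • H.V x y := by
  refine LinearMap.ext fun w => ?_
  simp [V_apply, smul_sub, smul_add]

theorem V_smul_right (r : R) (x y : QuadExt α × J) : H.V x (r • y) = r • H.V x y := by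
  refine LinearMap.ext fun w => ?_
  simp [V_apply, smul_sub, smul_add]

/-- `V` as a bilinear map. -/
def VLin : (QuadExt α × J) →ₗ[R] (QuadExt α × J) →ₗ[R] Module.End R (QuadExt α × J) :=
  LinearMap.mk₂ R H.V H.V_add_left H.V_smul_left H.V_add_right H.V_smul_right

theorem VLin_apply (x y : QuadExt α × J) : H.VLin x y = H.V x y := rfl

theorem V_neg_left (x y : QuadExt α × J) : H.V (-x) y = -H.V x y := by
  simp [← VLin_apply]

theorem V_neg_right (x y : QuadExt α × J) : H.V x (-y) = -H.V x y := by
  simp [← VLin_apply]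

theorem V_sub_left (x y z : QuadExt α × J) : H.V (x - y) z = H.V x z - H.V y z := by
  simp [← VLin_apply]

theorem V_sub_right (x y z : QuadExt α × J) : H.V x (y - z) = H.V x y - H.V x z := by
  simp [← VLin_apply]

@[simp]
theorem V_zero_left (y : QuadExt α × J) : H.V 0 y = 0 := by
  simp [← VLin_apply]

@[simp]
theorem V_zero_right (y : QuadExt α × J) : H.V y 0 = 0 := by
  simp [← VLin_apply]

theorem skewAct_diag (c : QuadExt α) :
    algebraMap R (QuadExt α) (H.skewAct (H.diag c)) = -(c + star c) := by
  ext
  · simp [skewAct, skew_mk, diag_mk, show (2 : QuadExt α).re = 2 from rfl,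
      show (2 : QuadExt α).im = 0 from rfl]; ring
  · simp [skewAct, skew_mk, diag_mk]

@[simp]
theorem skewAct_lmul (j : J) : H.skewAct (H.lmul j) = 0 := by
  simp [skewAct, skew_mk, lmul_mk]

theorem im_algebraMap_mul (r : R) (k : QuadExt α) :
    (algebraMap R (QuadExt α) r * k).im = r * k.im := by
  simp

/-- A pair of endomorphisms of `A` that acts on `L` by derivations. -/
structure IsInner (D : Module.End R (QuadExt α × J) × Module.End R (QuadExt α × J)) : Prop where
  skew_fst : ∀ x y, H.skew (D.1 x) y + H.skew x (D.1 y) = H.skewAct D.1 * H.skew x y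
  skew_snd : ∀ x y, H.skew (D.2 x) y + H.skew x (D.2 y) = H.skewAct D.2 * H.skew x y
  skewAct_snd : H.skewAct D.2 = -H.skewAct D.1
  fst_delta : ∀ x, D.1 (delta α • x) = delta α • D.2 x +
    (algebraMap R (QuadExt α) (H.skewAct D.1) * delta α) • x
  snd_delta : ∀ x, D.2 (delta α • x) =
    delta α • D.1 x - (algebraMap R (QuadExt α) (H.skewAct D.1) * delta α) • x
  V_fst : ∀ x y, D.1 * H.V x y - H.V x y * D.1 = H.V (D.1 x) y + H.V x (D.2 y)
  V_snd : ∀ x y, D.2 * H.V x y - H.V x y * D.2 = H.V (D.2 x) y + H.V x (D.1 y)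


variable {H}

theorem isInner_diagPair (c : QuadExt α) : H.IsInner (H.diagPair c) := by
  have e := H.skewAct_diag c
  have e2 := H.skewAct_diag (star c)
  have e3 : H.skewAct (H.diag (star c)) = H.skewAct (H.diag c) := by
    apply QuadraticAlgebra.algebraMap_injective (a := -α) (b := 1)
    rw [e, e2, star_star, add_comm]
  have skew (c : QuadExt α) (x y : QuadExt α × J) : H.skew (H.diag c x) y + H.skew x (H.diag c y) =
      H.skewAct (H.diag c) * H.skew x y := by
    obtain ⟨k, i⟩ := x
    obtain ⟨l, j⟩ := y
    rw [diag_mk, diag_mk, skew_mk, skew_mk, skew_mk, ← im_algebraMap_mul, skewAct_diag,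
      ← QuadraticAlgebra.im_add]
    congr 1
    simp [H.T_smul_left, T_smul_right]
    ring
  have hV (c : QuadExt α) (x y : QuadExt α × J) : H.diag c * H.V x y - H.V x y * H.diag c =
      H.V (H.diag c x) y - H.V x (H.diag (star c) y) := by
    obtain ⟨k, i⟩ := x
    obtain ⟨l, j⟩ := y
    refine LinearMap.ext fun ⟨m, w⟩ => Prod.ext ?_ ?_
    · simp [V_eq, diag_mk, lmul_mk, H.T_smul_left, T_smul_right, star_T, H.cross_smul_left,
        H.cross_smul_right, inn_mk]
      ring
    · simp [V_eq, diag_mk, lmul_mk, H.T_smul_left, T_smul_right, star_T, H.cross_smul_left,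
        H.cross_smul_right, inn_mk, D]
      module
  refine ⟨skew c, fun x y => ?_, ?_, fun ⟨m, w⟩ => Prod.ext ?_ ?_, fun ⟨m, w⟩ => Prod.ext ?_ ?_,
    fun x y => ?_, fun x y => ?_⟩
  · have := skew (star c) x y
    simp only [diagPair, LinearMap.neg_apply, skew_neg_left, skew_neg_right, skewAct_neg]
    linear_combination -this
  · simp [diagPair, skewAct_neg, e3]
  · simp [diagPair, diag_mk, e]; ring
  · simp [diagPair, diag_mk, e]; module
  · simp [diagPair, diag_mk, e]; ring
  · simp [diagPair, diag_mk, e]; module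
  · simp only [diagPair, LinearMap.neg_apply, V_neg_right]
    rw [hV]; abel
  · have := hV (star c) x y
    simp only [diagPair, LinearMap.neg_apply, V_neg_left, end_neg_mul, end_mul_neg]
    rw [star_star] at this
    rw [← sub_eq_zero] at this ⊢
    rw [← neg_eq_zero, ← this]; abel

/-- The heart of the Jacobi identity. Skew-adjointness of left multiplication is the symmetry of
T(a, b × c); the rule for the commutator with V is a comparison of normal forms. -/
theorem isInner_lmulPair (p : J) : H.IsInner (H.lmulPair p) := by
  have skew (x y : QuadExt α × J) : H.skew (H.lmul p x) y + H.skew x (H.lmul p y) = 0 := by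
    obtain ⟨k, i⟩ := x
    obtain ⟨l, j⟩ := y
    rw [lmul_mk, lmul_mk, skew_mk, skew_mk, ← QuadraticAlgebra.im_add]
    apply im_eq_zero_of_star_eq
    simp [H.T_smul_left, T_smul_right, star_T]
    have e (i j : J) : H.T j (H.cross p i) = H.T i (H.cross p j) := by
      rw [T_cross_rotate, H.cross_comm j p]
    have e' : H.T (H.cross p j) i = H.T (H.cross p i) j := by
      rw [← star_T, e, star_T]
    rw [e i j, e']
    ring
  have hV (x y : QuadExt α × J) : H.lmul p * H.V x y - H.V x y * H.lmul p =
      H.V (H.lmul p x) y - H.V x (H.lmul p y) := by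
    obtain ⟨k, i⟩ := x
    obtain ⟨l, j⟩ := y
    -- `h1`, `h2` and `h4` move `lmul p` past the three parts of V. Then `hd`, `hl` and `hi` compare
    -- diagonal, left multiplication and commutator parts, up to the relation `h3`.
    have h1 := H.diag_mul_lmul (k * star l + H.T j i) p
    have h2 := H.inn_mul_lmul i j p
    have h3 := H.diag_add_inn_cross i j p
    have h4 : H.lmul p * H.lmul (k • j + l • i + H.cross i j) =
      H.lmul (k • j + l • i + H.cross i j) * H.lmul p +
      H.inn p (k • j + l • i + H.cross i j) := by rw [inn]; abel
    have hd : H.diag (H.T p i * star l + H.T j (star k • p + H.cross p i)) -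
        H.diag (k * star (H.T p j) + H.T (star l • p + H.cross p j) i) =
        H.diag (H.T j (H.cross p i) - H.T (H.cross p i) j) := by
      rw [← diag_sub]
      congr 1
      rw [H.T_cross_left_rotate p i j, H.cross_comm p j, H.T_cross_left_rotate i j p]
      simp [H.T_smul_left, T_smul_right, star_T]
      ring
    have hl : H.lmul (H.T p i • j + l • (star k • p + H.cross p i)
          + H.cross (star k • p + H.cross p i) j) -
        H.lmul (k • (star l • p + H.cross p j) + H.T p j • i
          + H.cross i (star l • p + H.cross p j)) =
        H.lmul ((star (k * star l + H.T j i) - (k * star l + H.T j i)) • p) -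
        H.lmul (H.D i j p - H.D j i p + (H.T i j - H.T j i) • p) := by
      rw [← lmul_sub, ← lmul_sub]
      congr 1
      simp [H.cross_smul_left, H.cross_smul_right, star_T, D]
      rw [H.cross_comm i (H.cross p j), H.cross_comm i p]
      module
    have hi : H.inn (star k • p + H.cross p i) j - H.inn i (star l • p + H.cross p j) =
        H.inn p (k • j + l • i + H.cross i j) - H.inn p (H.cross i j) - H.inn i (H.cross j p)
          - H.inn j (H.cross p i) := by
      rw [inn_add_left, inn_add_right, inn_add_right, inn_add_right, inn_smul_left, star_star,
        H.inn_comm j, H.cross_comm j p, H.inn_comm p (l • i), inn_smul_left]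
      abel
    rw [lmul_mk, lmul_mk, V_eq, V_eq, V_eq, mul_sub, mul_sub, sub_mul, sub_mul, h1, h2, h4]
    linear_combination (norm := module) hl + hi - hd - h3
  refine ⟨fun x y => ?_, fun x y => ?_, ?_, fun ⟨m, w⟩ => Prod.ext ?_ ?_,
    fun ⟨m, w⟩ => Prod.ext ?_ ?_, fun x y => ?_, fun x y => ?_⟩
  · simp [lmulPair, skew]
  · have := skew x y
    simp only [lmulPair, LinearMap.neg_apply, skew_neg_left, skew_neg_right, skewAct_neg,
      skewAct_lmul]
    linear_combination -this
  · simp [lmulPair, skewAct_neg]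
  · simp [lmulPair, lmul_mk, T_smul_right]
  · simp [lmulPair, lmul_mk, H.cross_smul_right]; module
  · simp [lmulPair, lmul_mk, T_smul_right]
  · simp [lmulPair, lmul_mk, H.cross_smul_right]; module
  · simp only [lmulPair, LinearMap.neg_apply, V_neg_right]
    rw [hV]; abel
  · have := hV x y
    simp only [lmulPair, LinearMap.neg_apply, V_neg_left, end_neg_mul, end_mul_neg]
    rw [← sub_eq_zero] at this ⊢
    rw [← neg_eq_zero, ← this]; abel

end Operators

/-! ### L_0 is a Lie algebra of derivations; the Jacobi relations with L_{±2} -/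

section LieStructure

variable {R : Type u} [CommRing R] {α : R} {J : Type v} [AddCommGroup J] [Module R J]
  [Module (QuadExt α) J] [IsScalarTower R (QuadExt α) J]

variable {H : HermitianCubicNormStructure α J}

theorem commutator_jacobi {A : Type*} [Ring A] (D E V : A) :
    (D * E - E * D) * V - V * (D * E - E * D) =
      (D * (E * V - V * E) - (E * V - V * E) * D) -
        (E * (D * V - V * D) - (D * V - V * D) * E) := by noncomm_ring

namespace IsInner

variable {D E : Module.End R (QuadExt α × J) × Module.End R (QuadExt α × J)}

theorem zero : H.IsInner 0 := by
  have e : H.skewAct 0 = 0 := H.skewActLin.map_zero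
  constructor <;> simp [e]

theorem add (hD : H.IsInner D) (hE : H.IsInner E) : H.IsInner (D + E) where
  skew_fst x y := by
    simp only [Prod.fst_add, LinearMap.add_apply, skew_add_left, skew_add_right, skewAct_add]
    linear_combination hD.skew_fst x y + hE.skew_fst x y
  skew_snd x y := by
    simp only [Prod.snd_add, LinearMap.add_apply, skew_add_left, skew_add_right, skewAct_add]
    linear_combination hD.skew_snd x y + hE.skew_snd x y
  skewAct_snd := by
    simp only [Prod.fst_add, Prod.snd_add, skewAct_add]
    linear_combination hD.skewAct_snd + hE.skewAct_snd
  fst_delta x := by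
    simp only [Prod.fst_add, Prod.snd_add, LinearMap.add_apply, skewAct_add, map_add]
    linear_combination (norm := module) hD.fst_delta x + hE.fst_delta x
  snd_delta x := by
    simp only [Prod.fst_add, Prod.snd_add, LinearMap.add_apply, skewAct_add, map_add]
    linear_combination (norm := module) hD.snd_delta x + hE.snd_delta x
  V_fst x y := by
    simp only [Prod.fst_add, Prod.snd_add, LinearMap.add_apply, V_add_left, V_add_right,
      add_mul, mul_add]
    linear_combination (norm := module) hD.V_fst x y + hE.V_fst x y
  V_snd x y := by
    simp only [Prod.fst_add, Prod.snd_add, LinearMap.add_apply, V_add_left, V_add_right,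
      add_mul, mul_add]
    linear_combination (norm := module) hD.V_snd x y + hE.V_snd x y

theorem smul (r : R) (hD : H.IsInner D) : H.IsInner (r • D) where
  skew_fst x y := by
    simp only [Prod.smul_fst, LinearMap.smul_apply, skew_smul_left, skew_smul_right, skewAct_smul]
    linear_combination r * hD.skew_fst x y
  skew_snd x y := by
    simp only [Prod.smul_snd, LinearMap.smul_apply, skew_smul_left, skew_smul_right, skewAct_smul]
    linear_combination r * hD.skew_snd x y
  skewAct_snd := by
    simp only [Prod.smul_fst, Prod.smul_snd, skewAct_smul]
    linear_combination r * hD.skewAct_snd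
  fst_delta x := by
    simp only [Prod.smul_fst, Prod.smul_snd, LinearMap.smul_apply, skewAct_smul, hD.fst_delta x,
      map_mul, smul_add, mul_smul, algebraMap_smul, smul_comm r]
  snd_delta x := by
    simp only [Prod.smul_fst, Prod.smul_snd, LinearMap.smul_apply, skewAct_smul, hD.snd_delta x,
      map_mul, smul_sub, mul_smul, algebraMap_smul, smul_comm r]
  V_fst x y := by
    simp only [Prod.smul_fst, Prod.smul_snd, LinearMap.smul_apply, V_smul_left, V_smul_right,
      ← smul_add, ← hD.V_fst x y, smul_sub, smul_mul_assoc, mul_smul_comm]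
  V_snd x y := by
    simp only [Prod.smul_fst, Prod.smul_snd, LinearMap.smul_apply, V_smul_left, V_smul_right,
      ← smul_add, ← hD.V_snd x y, smul_sub, smul_mul_assoc, mul_smul_comm]

theorem neg (hD : H.IsInner D) : H.IsInner (-D) := by
  have e : (-1 : R) • D = -D :=
    Prod.ext (LinearMap.ext fun x => by simp) (LinearMap.ext fun x => by simp)
  exact e ▸ hD.smul (-1)

theorem sub (hD : H.IsInner D) (hE : H.IsInner E) : H.IsInner (D - E) := by
  simpa [sub_eq_add_neg] using hD.add hE.neg

/-- `skewAct` is the scalar by which a derivation acts on the rank-one module L_2, and scalars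
commute. The same computation in the second component gives the action on L_{-2}. -/
theorem skewAct_commutator_fst (hD : H.IsInner D) (hE : H.IsInner E) :
    H.skewAct (D.1 * E.1 - E.1 * D.1) = 0 := by
  have h1 := hD.skew_fst (E.1 (tEl α, 0)) (1, 0)
  have h2 := hE.skew_fst (D.1 (tEl α, 0)) (1, 0)
  have h3 := hD.skew_fst (tEl α, 0) (E.1 (1, 0))
  have h4 := hE.skew_fst (tEl α, 0) (D.1 (1, 0))
  have h5 := hD.skew_fst (tEl α, 0) (1, 0)
  have h6 := hE.skew_fst (tEl α, 0) (1, 0)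
  simp only [skewAct, LinearMap.sub_apply, Module.End.mul_apply, skew_sub_left, skew_sub_right] at *
  linear_combination h1 - h2 + h3 - h4 + (H.skew (D.1 (tEl α, 0)) (1, 0) +
    H.skew (tEl α, 0) (D.1 (1, 0))) * h6 - (H.skew (E.1 (tEl α, 0)) (1, 0) +
    H.skew (tEl α, 0) (E.1 (1, 0))) * h5

theorem skewAct_commutator_snd (hD : H.IsInner D) (hE : H.IsInner E) :
    H.skewAct (D.2 * E.2 - E.2 * D.2) = 0 := by
  have h1 := hD.skew_snd (E.2 (tEl α, 0)) (1, 0)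
  have h2 := hE.skew_snd (D.2 (tEl α, 0)) (1, 0)
  have h3 := hD.skew_snd (tEl α, 0) (E.2 (1, 0))
  have h4 := hE.skew_snd (tEl α, 0) (D.2 (1, 0))
  have h5 := hD.skew_snd (tEl α, 0) (1, 0)
  have h6 := hE.skew_snd (tEl α, 0) (1, 0)
  simp only [skewAct, LinearMap.sub_apply, Module.End.mul_apply, skew_sub_left, skew_sub_right] at *
  linear_combination h1 - h2 + h3 - h4 + (H.skew (D.2 (tEl α, 0)) (1, 0) +
    H.skew (tEl α, 0) (D.2 (1, 0))) * h6 - (H.skew (E.2 (tEl α, 0)) (1, 0) +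
    H.skew (tEl α, 0) (E.2 (1, 0))) * h5

theorem commutator (hD : H.IsInner D) (hE : H.IsInner E) : H.IsInner (D * E - E * D) where
  skew_fst x y := by
    have h1 := hD.skew_fst (E.1 x) y
    have h2 := hE.skew_fst (D.1 x) y
    have h3 := hD.skew_fst x (E.1 y)
    have h4 := hE.skew_fst x (D.1 y)
    have h5 := hD.skew_fst x y
    have h6 := hE.skew_fst x y
    simp only [Prod.fst_sub, Prod.fst_mul, hD.skewAct_commutator_fst hE, zero_mul,
      LinearMap.sub_apply, Module.End.mul_apply, skew_sub_left, skew_sub_right]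
    linear_combination h1 - h2 + h3 - h4 + H.skewAct D.1 * h6 - H.skewAct E.1 * h5
  skew_snd x y := by
    have h1 := hD.skew_snd (E.2 x) y
    have h2 := hE.skew_snd (D.2 x) y
    have h3 := hD.skew_snd x (E.2 y)
    have h4 := hE.skew_snd x (D.2 y)
    have h5 := hD.skew_snd x y
    have h6 := hE.skew_snd x y
    simp only [Prod.snd_sub, Prod.snd_mul, hD.skewAct_commutator_snd hE, zero_mul,
      LinearMap.sub_apply, Module.End.mul_apply, skew_sub_left, skew_sub_right]
    linear_combination h1 - h2 + h3 - h4 + H.skewAct D.2 * h6 - H.skewAct E.2 * h5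
  skewAct_snd := by
    simp only [Prod.fst_sub, Prod.fst_mul, Prod.snd_sub, Prod.snd_mul,
      hD.skewAct_commutator_fst hE, hD.skewAct_commutator_snd hE, neg_zero]
  fst_delta x := by
    simp only [Prod.fst_sub, Prod.fst_mul, Prod.snd_sub, Prod.snd_mul,
      hD.skewAct_commutator_fst hE, map_zero, zero_mul, zero_smul, add_zero,
      LinearMap.sub_apply, Module.End.mul_apply, hD.fst_delta, hE.fst_delta, map_add, mul_smul,
      algebraMap_smul, map_smul, smul_sub, smul_add]
    module
  snd_delta x := by
    simp only [Prod.fst_sub, Prod.fst_mul, Prod.snd_sub, Prod.snd_mul,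
      hD.skewAct_commutator_fst hE, map_zero, zero_mul, zero_smul, sub_zero, LinearMap.sub_apply,
      Module.End.mul_apply, hD.snd_delta, hE.snd_delta, map_sub, mul_smul, algebraMap_smul,
      map_smul, smul_sub]
    module
  V_fst x y := by
    simp only [Prod.fst_sub, Prod.fst_mul, Prod.snd_sub, Prod.snd_mul]
    rw [commutator_jacobi, hD.V_fst, hE.V_fst]
    simp only [mul_add, add_mul, add_sub_add_comm, hD.V_fst, hE.V_fst, LinearMap.sub_apply,
      Module.End.mul_apply, V_sub_left, V_sub_right]
    abel
  V_snd x y := by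
    simp only [Prod.fst_sub, Prod.fst_mul, Prod.snd_sub, Prod.snd_mul]
    rw [commutator_jacobi, hD.V_snd, hE.V_snd]
    simp only [mul_add, add_mul, add_sub_add_comm, hD.V_snd, hE.V_snd, LinearMap.sub_apply,
      Module.End.mul_apply, V_sub_left, V_sub_right]
    abel

theorem innPair (i j : J) : H.IsInner (H.innPair i j) := by
  rw [innPair_eq]
  exact (isInner_lmulPair i).commutator (isInner_lmulPair j)

theorem vPair (x y : QuadExt α × J) : H.IsInner (H.vPair x y) := by
  obtain ⟨k, i⟩ := x
  obtain ⟨l, j⟩ := y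
  rw [vPair_eq]
  exact ((isInner_diagPair _).sub (isInner_lmulPair _)).sub (innPair i j)

theorem of_mem (h : D ∈ H.instr) : H.IsInner D := by
  induction h using Submodule.span_induction with
  | mem p h =>
    obtain ⟨a, b, rfl⟩ := h
    exact vPair a b
  | zero => exact zero
  | add p q _ _ hp hq => exact hp.add hq
  | smul r p _ hp => exact hp.smul r

theorem commutator_vPair (hD : H.IsInner D) (x y : QuadExt α × J) :
    D * H.vPair x y - H.vPair x y * D = H.vPair (D.1 x) y + H.vPair x (D.2 y) := by
  refine Prod.ext (hD.V_fst x y) ?_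
  have h := hD.V_snd y x
  simp only [HermitianCubicNormStructure.vPair, Prod.snd_sub, Prod.snd_mul, Prod.snd_add,
    end_mul_neg, end_neg_mul]
  linear_combination (norm := module) -h

end IsInner

/-- By the derivation rule, [D, V_{a,b}] is the sum of V_{Da,b} and V_{a,Db}, taken in pairs, so the
span is closed. -/
theorem commutator_mem {D E : Module.End R (QuadExt α × J) × Module.End R (QuadExt α × J)}
    (hD : D ∈ H.instr) (hE : E ∈ H.instr) : D * E - E * D ∈ H.instr := by
  induction hE using Submodule.span_induction with
  | mem p h =>
    obtain ⟨a, b, rfl⟩ := h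
    change D * H.vPair a b - H.vPair a b * D ∈ _
    rw [(IsInner.of_mem hD).commutator_vPair]
    exact H.instr.add_mem (H.vPair_mem _ _) (H.vPair_mem _ _)
  | zero => simp
  | add p q _ _ hp hq =>
    rw [mul_add, add_mul, add_sub_add_comm]
    exact H.instr.add_mem hp hq
  | smul r p _ hp =>
    rw [mul_smul_comm, smul_mul_assoc, ← smul_sub]
    exact H.instr.smul_mem r hp

variable (H)

theorem skewAct_inn (i j : J) : H.skewAct (H.inn i j) = 0 := by
  have h := (isInner_lmulPair (H := H) i).skewAct_commutator_fst (isInner_lmulPair j)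
  rw [inn]
  simpa only [lmulPair] using h

theorem skewAct_V (x y : QuadExt α × J) : H.skewAct (H.V x y) = H.skew x (delta α • y) := by
  obtain ⟨k, i⟩ := x
  obtain ⟨l, j⟩ := y
  apply QuadraticAlgebra.algebraMap_injective (a := -α) (b := 1)
  rw [V_eq, skewAct_sub, skewAct_sub, skewAct_inn, skewAct_lmul, sub_zero, sub_zero, skewAct_diag]
  have e : (H.skew (k, i) (delta α • (l, j))) = (delta α * (-(k * star l + H.T i j))).im := by
    simp only [Prod.smul_mk, skew_mk, T_smul_right, smul_eq_mul, star_mul', star_delta]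
    congr 1
    ring
  rw [e, algebraMap_im_delta_mul]
  simp [star_T]
  ring

theorem skew_delta_left (x y : QuadExt α × J) :
    H.skew (delta α • x) y = -H.skew x (delta α • y) := by
  obtain ⟨k, i⟩ := x
  obtain ⟨l, j⟩ := y
  simp only [Prod.smul_mk, skew_mk, T_smul_right, smul_eq_mul, star_mul', star_delta,
    H.T_smul_left, ← QuadraticAlgebra.im_neg]
  congr 1
  ring

theorem skewAct_vPair_snd (x y : QuadExt α × J) :
    H.skewAct (H.vPair x y).2 = -H.skew x (delta α • y) := by
  rw [(IsInner.vPair x y).skewAct_snd, vPair, skewAct_V]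

/-- `V_{x,p} y - V_{y,p} x = -(x ȳ - y x̄) p`. -/
theorem V_sub_swap (x y p : QuadExt α × J) :
    H.V x p y - H.V y p x = -((algebraMap R (QuadExt α) (H.skew x y) * delta α) • p) := by
  rw [← skewMul_mk, skewMul, ← skew_eq]
  simp [V_apply]
  abel

theorem diag_algebraMap (r : R) : H.diag (algebraMap R (QuadExt α) r) = -(r • 1) := by
  refine LinearMap.ext fun ⟨m, w⟩ => Prod.ext ?_ ?_
  · simp [diag_mk, Algebra.smul_def]; ring
  · simp [diag_mk]

/-- The grading element of `L_0`, acting as `i` on `L_i` for `i = ±1`. -/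
def gradPair (_H : HermitianCubicNormStructure α J) :
    Module.End R (QuadExt α × J) × Module.End R (QuadExt α × J) := (1, -1)

theorem diagPair_algebraMap (r : R) :
    H.diagPair (algebraMap R (QuadExt α) r) = -(r • H.gradPair) := by
  simp [diagPair, gradPair, diag_algebraMap]

theorem gradPair_eq : H.gradPair = -H.diagPair 1 := by
  have h := H.diagPair_algebraMap 1
  rw [map_one, one_smul] at h
  rw [h, neg_neg]

theorem gradPair_mem : H.gradPair ∈ H.instr := by
  rw [gradPair_eq, ← vPair_diag]
  exact H.instr.neg_mem (H.vPair_mem _ _)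

theorem inn_smul_delta (i j : J) : H.inn i (delta α • j) = H.inn j (delta α • i) := by
  refine LinearMap.ext fun ⟨m, w⟩ => Prod.ext ?_ ?_
  · simp [inn_mk, H.T_smul_left, T_smul_right]; ring
  · simp [inn_mk, D, H.T_smul_left, T_smul_right, H.cross_smul_left, H.cross_smul_right]
    module

theorem diag_skew (x y : QuadExt α × J) :
    H.diag ((x.1 * star y.1 + H.T x.2 y.2 - (star x.1 * y.1 + H.T y.2 x.2)) * delta α) =
      -((H.skew x y * (1 - 4 * α)) • 1) := by
  have e : x.1 * star y.1 + H.T x.2 y.2 - (star x.1 * y.1 + H.T y.2 x.2) =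
      algebraMap R (QuadExt α) (H.skew x y) * delta α := by
    rw [show H.skew x y = (x.1 * star y.1 + H.T x.2 y.2).im from rfl, algebraMap_im_mul_delta]
    simp [star_T]
  rw [← diag_algebraMap, map_mul, ← delta_sq, e]
  congr 1
  ring

/-- The Jacobi identity for x_1, y_1 and σ_{-2}. In normal form the left multiplications and the
commutators are symmetric in x and y, so only a diagonal term is left; it is a multiple of the
grading element, with the factor δ² = 1 - 4α. -/
theorem V_delta_sub (x y : QuadExt α × J) :
    H.V x (delta α • y) - H.V y (delta α • x) = (H.skew x y * (1 - 4 * α)) • 1 := by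
  have h := H.diag_skew x y
  obtain ⟨k, i⟩ := x
  obtain ⟨l, j⟩ := y
  have hd := H.diag_sub (k * star (delta α * l) + H.T (delta α • j) i)
    (l * star (delta α * k) + H.T (delta α • i) j)
  have hd' := H.diag_add ((k * star l + H.T i j - (star k * l + H.T j i)) * delta α)
    (k * star (delta α * l) + H.T (delta α • j) i - (l * star (delta α * k) + H.T (delta α • i) j))
  have e1 : (k * star l + H.T i j - (star k * l + H.T j i)) * delta α +
      (k * star (delta α * l) + H.T (delta α • j) i -
      (l * star (delta α * k) + H.T (delta α • i) j)) = 0 := by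
    simp [H.T_smul_left]; ring
  have e2 : k • delta α • j + (delta α * l) • i + H.cross i (delta α • j) =
      l • delta α • i + (delta α * k) • j + H.cross j (delta α • i) := by
    rw [H.cross_smul_right, H.cross_smul_right, H.cross_comm j i]; module
  rw [e1, diag_zero] at hd'
  simp only [Prod.smul_mk, V_eq, smul_eq_mul]
  rw [e2, H.inn_smul_delta i j]
  linear_combination (norm := module) -h - hd - hd'

theorem V_delta_sub' (x y : QuadExt α × J) :
    H.V (delta α • x) y - H.V (delta α • y) x = -((H.skew x y * (1 - 4 * α)) • 1) := by
  have h := H.diag_skew x y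
  obtain ⟨k, i⟩ := x
  obtain ⟨l, j⟩ := y
  have hd := H.diag_sub ((delta α * k) * star l + H.T j (delta α • i))
    ((delta α * l) * star k + H.T i (delta α • j))
  have e1 : (k * star l + H.T i j - (star k * l + H.T j i)) * delta α =
      (delta α * k) * star l + H.T j (delta α • i) -
      ((delta α * l) * star k + H.T i (delta α • j)) := by
    simp [H.T_smul_right]; ring
  have e2 : (delta α * k) • j + l • delta α • i + H.cross (delta α • i) j =
      (delta α * l) • i + k • delta α • j + H.cross (delta α • j) i := by
    rw [H.cross_smul_left, H.cross_smul_left, H.cross_comm j i]; module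
  dsimp only at h
  rw [e1] at h
  simp only [Prod.smul_mk, V_eq, smul_eq_mul]
  rw [e2, H.inn_comm, H.inn_comm (delta α • j), H.inn_smul_delta i j]
  linear_combination (norm := module) h - hd

theorem vPair_delta_sub (x y : QuadExt α × J) :
    H.vPair x (delta α • y) - H.vPair y (delta α • x) =
      (H.skew x y * (1 - 4 * α)) • H.gradPair := by
  refine Prod.ext (H.V_delta_sub x y) ?_
  have h := H.V_delta_sub' x y
  simp only [vPair, gradPair, Prod.snd_sub, Prod.smul_snd]
  rw [LinearMap.ext_iff] at *
  intro z
  have := h z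
  simp at *
  linear_combination (norm := module) this

theorem vPair_delta_sub' (x y : QuadExt α × J) :
    H.vPair (delta α • x) y - H.vPair (delta α • y) x =
      -((H.skew x y * (1 - 4 * α)) • H.gradPair) := by
  refine Prod.ext (H.V_delta_sub' x y) ?_
  have h := H.V_delta_sub x y
  simp only [vPair, gradPair, Prod.snd_sub, Prod.smul_snd, Prod.snd_neg]
  rw [LinearMap.ext_iff] at *
  intro z
  have := h z
  simp at *
  linear_combination (norm := module) this

end LieStructure

/-! ### The Jacobi identity -/

section LieRing

variable {R : Type u} [CommRing R] {α : R} {J : Type v} [AddCommGroup J] [Module R J]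
  [Module (QuadExt α) J] [IsScalarTower R (QuadExt α) J]

variable (H : HermitianCubicNormStructure α J)

/-- Multiplication by `t - t̄` on `A`. -/
def dl : Module.End R (QuadExt α × J) := H.skewMul 1

theorem dl_apply (x : QuadExt α × J) : H.dl x = delta α • x := by
  rw [dl, skewMul_mk, map_one, one_mul]

theorem dl_mk (k : QuadExt α) (j : J) : H.dl (k, j) = (delta α * k, delta α • j) := by
  rw [dl_apply]; rfl

theorem skewMul_eq (r : R) : H.skewMul r = r • H.dl := by
  refine LinearMap.ext fun x => ?_
  rw [skewMul_mk, LinearMap.smul_apply, dl_apply, mul_smul, algebraMap_smul]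

theorem dl_dl (x : QuadExt α × J) : H.dl (H.dl x) = (1 - 4 * α) • x := by
  rw [dl_apply, dl_apply, smul_smul, delta_sq, algebraMap_smul]

theorem dl_mul_dl : H.dl * H.dl = (1 - 4 * α) • 1 :=
  LinearMap.ext fun x => H.dl_dl x

/-- The bracket with L_0 treated as pairs in a product ring. The products of left multiplications by
skew elements combine to a multiple of the grading element because δ² is a scalar. -/
theorem bracket_mk (r r' s s' : R) (y y' x x' : QuadExt α × J)
    (D D' : Module.End R (QuadExt α × J) × Module.End R (QuadExt α × J)) :
    H.bracket (r, y, D, x, s) (r', y', D', x', s') =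
      (H.skew y y' + r' * H.skewAct D.2 - r * H.skewAct D'.2,
        D.2 y' - D'.2 y + r' • H.dl x - r • H.dl x',
        D * D' - D' * D + H.vPair x y' - H.vPair x' y +
          ((s * r' - s' * r) * (1 - 4 * α)) • H.gradPair,
        D.1 x' - D'.1 x + s' • H.dl y - s • H.dl y',
        H.skew x x' + s' * H.skewAct D.1 - s * H.skewAct D'.1) := by
  obtain ⟨f, g⟩ := D
  obtain ⟨f', g'⟩ := D'
  simp only [bracket, skewMul_eq, LinearMap.smul_apply, smul_mul_smul_comm, dl_mul_dl, smul_smul,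
    vPair, gradPair, Prod.mk_mul_mk, Prod.mk_sub_mk, Prod.mk_add_mk, Prod.smul_mk]
  refine Prod.ext rfl (Prod.ext rfl (Prod.ext (Prod.ext ?_ ?_) rfl))
  · dsimp only
    module
  · dsimp only
    refine LinearMap.ext fun z => ?_
    simp
    module

theorem skew_self (x : QuadExt α × J) : H.skew x x = 0 := by
  obtain ⟨k, i⟩ := x
  rw [skew_mk]
  apply im_eq_zero_of_star_eq
  simp [star_T, mul_comm]

variable {H}

theorem bracket_mem {a b : H.Ambient} (ha : a ∈ H.lie) (hb : b ∈ H.lie) :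
    H.bracket a b ∈ H.lie := by
  obtain ⟨r, y, D, x, s⟩ := a
  obtain ⟨r', y', D', x', s'⟩ := b
  rw [bracket_mk]
  exact H.instr.add_mem (H.instr.sub_mem (H.instr.add_mem (commutator_mem ha hb)
    (H.vPair_mem _ _)) (H.vPair_mem _ _)) (H.instr.smul_mem _ H.gradPair_mem)

theorem vPair_add_left (x y z : QuadExt α × J) :
    H.vPair (x + y) z = H.vPair x z + H.vPair y z := by
  simp [vPair, V_add_left, V_add_right]; abel

theorem vPair_add_right (x y z : QuadExt α × J) :
    H.vPair x (y + z) = H.vPair x y + H.vPair x z := by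
  simp [vPair, V_add_left, V_add_right]; abel

theorem vPair_smul_left (r : R) (x y : QuadExt α × J) : H.vPair (r • x) y = r • H.vPair x y := by
  simp [vPair, V_smul_left, V_smul_right]

theorem vPair_smul_right (r : R) (x y : QuadExt α × J) : H.vPair x (r • y) = r • H.vPair x y := by
  simp [vPair, V_smul_left, V_smul_right]

theorem vPair_neg_left (x y : QuadExt α × J) : H.vPair (-x) y = -H.vPair x y := by
  simp [vPair, V_neg_left, V_neg_right]

theorem vPair_neg_right (x y : QuadExt α × J) : H.vPair x (-y) = -H.vPair x y := by
  simp [vPair, V_neg_left, V_neg_right]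

theorem vPair_sub_left (x y z : QuadExt α × J) :
    H.vPair (x - y) z = H.vPair x z - H.vPair y z := by
  rw [sub_eq_add_neg, vPair_add_left, vPair_neg_left, sub_eq_add_neg]

theorem vPair_sub_right (x y z : QuadExt α × J) :
    H.vPair x (y - z) = H.vPair x y - H.vPair x z := by
  rw [sub_eq_add_neg, vPair_add_right, vPair_neg_right, sub_eq_add_neg]

theorem vPair_zero_left (x : QuadExt α × J) : H.vPair 0 x = 0 := by
  simp [vPair, V_zero_left, V_zero_right]

theorem vPair_zero_right (x : QuadExt α × J) : H.vPair x 0 = 0 := by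
  simp [vPair, V_zero_left, V_zero_right]

theorem pair_neg_smul {M : Type*} [AddCommGroup M] [Module R M] (r : R)
    (D : Module.End R M × Module.End R M) : -r • D = -(r • D) :=
  neg_smul r D

theorem pair_smul_neg {M : Type*} [AddCommGroup M] [Module R M] (r : R)
    (D : Module.End R M × Module.End R M) : r • -D = -(r • D) :=
  smul_neg r D

theorem bracket_swap (a b : H.Ambient) : H.bracket a b = -H.bracket b a := by
  obtain ⟨r, y, D, x, s⟩ := a
  obtain ⟨r', y', D', x', s'⟩ := b
  rw [bracket_mk, bracket_mk, H.skew_comm y' y, H.skew_comm x' x]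
  refine Prod.ext ?_ (Prod.ext ?_ (Prod.ext ?_ (Prod.ext ?_ ?_))) <;> dsimp only [Prod.neg_mk]
  · ring
  · module
  · rw [show (s' * r - s * r') * (1 - 4 * α) = -((s * r' - s' * r) * (1 - 4 * α)) by ring,
      pair_neg_smul]
    abel
  · module
  · ring

theorem bracket_self (a : H.Ambient) : H.bracket a a = 0 := by
  obtain ⟨r, y, D, x, s⟩ := a
  rw [bracket_mk]
  refine Prod.ext ?_ (Prod.ext ?_ (Prod.ext ?_ (Prod.ext ?_ ?_))) <;> simp [skew_self]

theorem bracket_add_right (a b c : H.Ambient) :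
    H.bracket a (b + c) = H.bracket a b + H.bracket a c := by
  obtain ⟨r, y, D, x, s⟩ := a
  obtain ⟨r', y', D', x', s'⟩ := b
  obtain ⟨r'', y'', D'', x'', s''⟩ := c
  simp only [Prod.mk_add_mk, bracket_mk, skew_add_right, skewAct_add, map_add, Prod.fst_add,
    Prod.snd_add, mul_add, add_mul, LinearMap.add_apply, vPair_add_right, vPair_add_left]
  refine Prod.ext ?_ (Prod.ext ?_ (Prod.ext ?_ (Prod.ext ?_ ?_))) <;> dsimp only
  · ring
  · module
  · rw [show (s * r' + s * r'' - (s' * r + s'' * r)) * (1 - 4 * α) =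
      (s * r' - s' * r) * (1 - 4 * α) + (s * r'' - s'' * r) * (1 - 4 * α) by ring, add_smul]
    abel
  · module
  · ring

theorem bracket_add_left (a b c : H.Ambient) :
    H.bracket (a + b) c = H.bracket a c + H.bracket b c := by
  rw [bracket_swap, bracket_add_right, bracket_swap c a, bracket_swap c b]
  abel

/-- The reversal on the ambient module. -/
def rev (a : H.Ambient) : H.Ambient := (a.2.2.2.2, a.2.2.2.1, a.2.2.1.swap, a.2.1, a.1)

theorem vPair_swap (x y : QuadExt α × J) : (H.vPair x y).swap = -H.vPair y x := by
  simp [vPair]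

theorem bracket_rev (a b : H.Ambient) :
    H.bracket (rev a) (rev b) = rev (H.bracket a b) := by
  obtain ⟨r, y, D, x, s⟩ := a
  obtain ⟨r', y', D', x', s'⟩ := b
  have hs : (H.gradPair).swap = -H.gradPair := by simp [gradPair]
  simp only [rev, bracket_mk, Prod.snd_swap, Prod.fst_swap]
  refine Prod.ext rfl (Prod.ext rfl (Prod.ext ?_ (Prod.ext rfl rfl)))
  have e : (D * D' - D' * D + H.vPair x y' - H.vPair x' y +
      ((s * r' - s' * r) * (1 - 4 * α)) • H.gradPair).swap = D.swap * D'.swap - D'.swap * D.swap +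
      (H.vPair x y').swap - (H.vPair x' y).swap +
      ((s * r' - s' * r) * (1 - 4 * α)) • H.gradPair.swap := rfl
  rw [e, vPair_swap, vPair_swap, hs]
  have e2 : (r * s' - r' * s) * (1 - 4 * α) = -((s * r' - s' * r) * (1 - 4 * α)) := by ring
  dsimp only
  rw [e2, pair_neg_smul, pair_smul_neg]
  abel

variable (H)

theorem skew_dl_left (x y : QuadExt α × J) : H.skew (H.dl x) y = -H.skew x (H.dl y) := by
  rw [dl_apply, dl_apply, skew_delta_left]

theorem skewAct_vPair (x y : QuadExt α × J) : H.skewAct (H.vPair x y).1 = H.skew x (H.dl y) := by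
  rw [dl_apply]; exact H.skewAct_V x y

theorem skewAct_one : H.skewAct 1 = 2 := by
  simp [skewAct, skew_mk]; norm_num

theorem vPair_fst_swap (x y p : QuadExt α × J) :
    (H.vPair x p).1 y - (H.vPair y p).1 x = -(H.skew x y • H.dl p) := by
  have h := H.V_sub_swap x y p
  rw [← skewMul_mk, skewMul_eq] at h
  exact h

theorem IsInner.fst_dl {H : HermitianCubicNormStructure α J}
    {D : Module.End R (QuadExt α × J) × Module.End R (QuadExt α × J)}
    (hD : H.IsInner D) (x : QuadExt α × J) :
    D.1 (H.dl x) = H.dl (D.2 x) + H.skewAct D.1 • H.dl x := by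
  have h := hD.fst_delta x
  rwa [← skewMul_mk, skewMul_eq, ← dl_apply, ← dl_apply] at h

theorem vPair_dl_sub (x y : QuadExt α × J) :
    H.vPair x (H.dl y) - H.vPair y (H.dl x) = (H.skew x y * (1 - 4 * α)) • H.gradPair := by
  rw [dl_apply, dl_apply, vPair_delta_sub]

theorem vPair_dl_sub' (x y : QuadExt α × J) :
    H.vPair (H.dl x) y - H.vPair (H.dl y) x = -((H.skew x y * (1 - 4 * α)) • H.gradPair) := by
  rw [dl_apply, dl_apply, vPair_delta_sub']

theorem skew_dl_right (x y : QuadExt α × J) : H.skew x (H.dl y) = H.skew y (H.dl x) := by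
  rw [skew_comm, skew_dl_left, neg_neg]

variable {H}

/-- In degree 2 the inputs are the derivation property on [L_1, L_1], the vanishing of `skewAct` on
commutators, and the skew-adjointness of multiplication by δ. -/
theorem bracket_leibniz_top {a b c : H.Ambient} (ha : a ∈ H.lie) (hb : b ∈ H.lie) (hc : c ∈ H.lie) :
    (H.bracket a (H.bracket b c)).2.2.2.2 =
      (H.bracket (H.bracket a b) c).2.2.2.2 + (H.bracket b (H.bracket a c)).2.2.2.2 := by
  obtain ⟨r1, y1, D1, x1, s1⟩ := a
  obtain ⟨r2, y2, D2, x2, s2⟩ := b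
  obtain ⟨r3, y3, D3, x3, s3⟩ := c
  replace ha := IsInner.of_mem ha
  replace hb := IsInner.of_mem hb
  replace hc := IsInner.of_mem hc
  dsimp at ha hb hc
  have h23 := hb.skewAct_commutator_fst hc
  have h13 := ha.skewAct_commutator_fst hc
  have h12 := ha.skewAct_commutator_fst hb
  have e : H.skewAct H.gradPair.1 = 2 := H.skewAct_one
  simp only [bracket_mk, skewAct_add, skewAct_sub, skewAct_smul, Prod.fst_add, Prod.fst_sub,
    Prod.fst_mul, Prod.smul_fst, skew_add_left, skew_add_right, skew_sub_left, skew_sub_right,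
    skew_smul_left, skew_smul_right, skewAct_vPair, skew_dl_left, e] at h12 h13 h23 ⊢
  linear_combination -ha.skew_fst x2 x3 + hb.skew_fst x1 x3 - hc.skew_fst x1 x2 - s1 * h23 +
    s2 * h13 - s3 * h12 + H.skew_comm x2 (D3.1 x1) +
    s2 * H.skew_dl_right y1 x3 - s1 * H.skew_dl_right y2 x3

theorem bracket_leibniz_one {a b c : H.Ambient} (ha : a ∈ H.lie) (hb : b ∈ H.lie) (hc : c ∈ H.lie) :
    (H.bracket a (H.bracket b c)).2.2.2.1 =
      (H.bracket (H.bracket a b) c).2.2.2.1 + (H.bracket b (H.bracket a c)).2.2.2.1 := by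
  obtain ⟨r1, y1, D1, x1, s1⟩ := a
  obtain ⟨r2, y2, D2, x2, s2⟩ := b
  obtain ⟨r3, y3, D3, x3, s3⟩ := c
  replace ha := IsInner.of_mem ha
  replace hb := IsInner.of_mem hb
  replace hc := IsInner.of_mem hc
  dsimp at ha hb hc
  have e : H.gradPair.1 = 1 := rfl
  simp only [bracket_mk, Prod.fst_add, Prod.fst_sub, map_add, map_sub, map_smul,
    Prod.fst_mul, Prod.smul_fst, LinearMap.add_apply, LinearMap.sub_apply, LinearMap.smul_apply,
    Module.End.mul_apply, Module.End.one_apply, e, ha.fst_dl, hb.fst_dl, hc.fst_dl, dl_dl]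
  linear_combination (norm := module) H.vPair_fst_swap x1 x2 y3 - H.vPair_fst_swap x1 x3 y2 +
    H.vPair_fst_swap x2 x3 y1

theorem gradPair_mul_comm
    (D : Module.End R (QuadExt α × J) × Module.End R (QuadExt α × J)) :
    D * H.gradPair = H.gradPair * D := by
  refine Prod.ext ?_ ?_ <;> simp [gradPair, end_neg_mul, end_mul_neg]

theorem IsInner.commutator_add {D E : Module.End R (QuadExt α × J) × Module.End R (QuadExt α × J)}
    (hD : H.IsInner D) (x x' y y' : QuadExt α × J) (r : R) :
    D * (E + H.vPair x y' - H.vPair x' y + r • H.gradPair) -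
      (E + H.vPair x y' - H.vPair x' y + r • H.gradPair) * D =
    D * E - E * D + (H.vPair (D.1 x) y' + H.vPair x (D.2 y')) -
      (H.vPair (D.1 x') y + H.vPair x' (D.2 y)) := by
  rw [← hD.commutator_vPair, ← hD.commutator_vPair]
  simp only [mul_add, mul_sub, add_mul, sub_mul, mul_smul_comm, smul_mul_assoc,
    gradPair_mul_comm D]
  abel

/-- After the derivation rule has been applied to the three elements of L_0, what remains are the
relations `vPair_dl_sub` and `vPair_dl_sub'`, one for each pair among the three arguments. -/
theorem bracket_leibniz_zero {a b c : H.Ambient} (ha : a ∈ H.lie) (hb : b ∈ H.lie)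
    (hc : c ∈ H.lie) :
    (H.bracket a (H.bracket b c)).2.2.1 =
      (H.bracket (H.bracket a b) c).2.2.1 + (H.bracket b (H.bracket a c)).2.2.1 := by
  obtain ⟨r1, y1, D1, x1, s1⟩ := a
  obtain ⟨r2, y2, D2, x2, s2⟩ := b
  obtain ⟨r3, y3, D3, x3, s3⟩ := c
  replace ha := IsInner.of_mem ha
  replace hb := IsInner.of_mem hb
  replace hc := IsInner.of_mem hc
  dsimp at ha hb hc
  have h3 : ∀ X : Module.End R (QuadExt α × J) × Module.End R (QuadExt α × J),
    X * D3 - D3 * X = -(D3 * X - X * D3) := fun X => by abel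
  simp only [bracket_mk]
  rw [h3 (_ + _), ha.commutator_add, hb.commutator_add, hc.commutator_add, ha.skewAct_snd,
    hb.skewAct_snd,
    hc.skewAct_snd]
  simp only [vPair_add_left, vPair_add_right, vPair_sub_left, vPair_sub_right, vPair_smul_left,
    vPair_smul_right, mul_sub, sub_mul, mul_assoc]
  linear_combination (norm := module) s3 • H.vPair_dl_sub' y1 y2 - s2 • H.vPair_dl_sub' y1 y3 +
    s1 • H.vPair_dl_sub' y2 y3 + r3 • H.vPair_dl_sub x1 x2 - r2 • H.vPair_dl_sub x1 x3 +
    r1 • H.vPair_dl_sub x2 x3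

theorem rev_mem {a : H.Ambient} (ha : a ∈ H.lie) : rev a ∈ H.lie := H.swap_mem_instr ha

/-- The reversal preserves the bracket, so degrees -1 and -2 follow from degrees 1 and 2. -/
theorem bracket_leibniz {a b c : H.Ambient} (ha : a ∈ H.lie) (hb : b ∈ H.lie) (hc : c ∈ H.lie) :
    H.bracket a (H.bracket b c) =
      H.bracket (H.bracket a b) c + H.bracket b (H.bracket a c) := by
  have h1 := bracket_leibniz_one (rev_mem ha) (rev_mem hb) (rev_mem hc)
  have h2 := bracket_leibniz_top (rev_mem ha) (rev_mem hb) (rev_mem hc)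
  simp only [bracket_rev] at h1 h2
  exact Prod.ext h2 (Prod.ext h1 (Prod.ext (bracket_leibniz_zero ha hb hc)
    (Prod.ext (bracket_leibniz_one ha hb hc) (bracket_leibniz_top ha hb hc))))

instance instLieRing : LieRing H.lie where
  bracket a b := ⟨H.bracket a b, bracket_mem a.2 b.2⟩
  add_lie _ _ _ := Subtype.ext (bracket_add_left _ _ _)
  lie_add _ _ _ := Subtype.ext (bracket_add_right _ _ _)
  lie_self _ := Subtype.ext (bracket_self _)
  leibniz_lie a b c := Subtype.ext (bracket_leibniz a.2 b.2 c.2)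

theorem coe_lie (a b : H.lie) : ((⁅a, b⁆ : H.lie) : H.Ambient) = H.bracket a b := rfl

theorem isLieAut_iff (φ : H.lie ≃ₗ[R] H.lie) :
    H.IsLieAut φ ↔ ∀ a b : H.lie, φ ⁅a, b⁆ = ⁅φ a, φ b⁆ := by
  refine ⟨fun h a b => (Subtype.ext (h a b ⁅a, b⁆ rfl)).symm, fun h a b c habc => ?_⟩
  rw [← coe_lie, ← h]
  exact congrArg (fun z => (φ z : H.Ambient)) (Subtype.ext habc)

end LieRing

/-! ### A criterion for 1 + e₁ + e₂ + e₃ + e₄ to be an automorphism -/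

section Exponential

variable {R : Type u} [CommRing R] {α : R} {J : Type v} [AddCommGroup J] [Module R J]
  [Module (QuadExt α) J] [IsScalarTower R (QuadExt α) J]

variable {H : HermitianCubicNormStructure α J}

theorem skewAct_zero : H.skewAct 0 = 0 := H.skewActLin.map_zero

theorem bracket_smul_right (r : R) (a b : H.Ambient) :
    H.bracket a (r • b) = r • H.bracket a b := by
  obtain ⟨r', y', D', x', s'⟩ := a
  obtain ⟨r'', y'', D'', x'', s''⟩ := b
  simp only [Prod.smul_mk, bracket_mk, skew_smul_right, skewAct_smul, map_smul, Prod.smul_fst,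
    Prod.smul_snd, LinearMap.smul_apply, vPair_smul_right, vPair_smul_left]
  refine Prod.ext ?_ (Prod.ext ?_ (Prod.ext ?_ (Prod.ext ?_ ?_))) <;> dsimp only
  · rw [smul_eq_mul, smul_eq_mul]; ring
  · module
  · rw [smul_eq_mul, smul_eq_mul, smul_add, smul_sub, smul_add, smul_sub, mul_smul_comm,
      smul_mul_assoc, smul_smul]
    congr 2
    ring
  · module
  · rw [smul_eq_mul, smul_eq_mul]; ring

theorem lie_smul_right (r : R) (a b : H.lie) : ⁅a, r • b⁆ = r • ⁅a, b⁆ := by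
  apply Subtype.ext
  rw [coe_lie, Submodule.coe_smul, bracket_smul_right, Submodule.coe_smul, coe_lie]

variable (H) in
/-- The element `r (t - t̄)` of `L_{-2}`. -/
def neg2 (r : R) : H.lie := ⟨(r, 0, 0, 0, 0), H.instr.zero_mem⟩

/-- The element of `L_0` given by a pair in the inner structure algebra. -/
def zeroPart (D : Module.End R (QuadExt α × J) × Module.End R (QuadExt α × J))
    (hD : D ∈ H.instr) : H.lie := ⟨(0, 0, D, 0, 0), hD⟩

theorem lie_eq_sum (a : H.lie) : a = H.neg2 a.1.1 + H.neg1 a.1.2.1 +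
    zeroPart a.1.2.2.1 a.2 + H.pos1 a.1.2.2.2.1 + H.pos2 a.1.2.2.2.2 := by
  obtain ⟨⟨r, y, D, x, s⟩, h⟩ := a
  refine Subtype.ext ?_
  simp [neg2, neg1, zeroPart, pos1, pos2]

variable (H) in
/-- The data of which an automorphism `1 + e₁ + e₂ + e₃ + e₄` of `L` is made: `e₁ = ad x_1`,
`e₂ c_{-1} = (Q c)_1`, `e₃ c_{-1} = (τ c)_2`, and `e₂`, `e₃`, `e₄` map the generator `t - t̄` of
`L_{-2}` to `w₂`, `w₃`, `w₄`. -/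
structure ExpData where
  x : QuadExt α × J
  Q : Module.End R (QuadExt α × J)
  τ : (QuadExt α × J) →ₗ[R] R
  w₂ : Module.End R (QuadExt α × J) × Module.End R (QuadExt α × J)
  w₃ : QuadExt α × J
  w₄ : R
  w₂_mem : w₂ ∈ H.instr

namespace ExpData

variable (E : H.ExpData)

/-- The action of `e₂` on `L_0`. -/
def q : (Module.End R (QuadExt α × J) × Module.End R (QuadExt α × J)) →ₗ[R] R where
  -- The degree 1 part of the image of [D, 1_{-1}] forces this element of A to be -q(D)δ, and the
  -- real part of δ is -1, so the real part is q(D).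
  toFun D := (E.Q (D.2 (1, 0)) - D.1 (E.Q (1, 0)) - H.V E.x (1, 0) (D.1 E.x)).1.re
  map_add' D D' := by
    simp only [Prod.fst_add, Prod.snd_add, LinearMap.add_apply, map_add, Prod.fst_sub,
      QuadraticAlgebra.re_sub, QuadraticAlgebra.re_add]
    ring
  map_smul' r D := by
    simp only [Prod.smul_fst, Prod.smul_snd, LinearMap.smul_apply, map_smul, ← smul_sub,
      RingHom.id_apply]
    simp

theorem q_apply (D : Module.End R (QuadExt α × J) × Module.End R (QuadExt α × J)) :
    E.q D = (E.Q (D.2 (1, 0)) - D.1 (E.Q (1, 0)) - H.V E.x (1, 0) (D.1 E.x)).1.re := rfl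

def e₁ : Module.End R H.lie where
  toFun a := ⟨(0, a.1.1 • H.dl E.x, H.vPair E.x a.1.2.1, -a.1.2.2.1.1 E.x,
    H.skew E.x a.1.2.2.2.1), H.vPair_mem _ _⟩
  map_add' a b := Subtype.ext (by
    simp only [Submodule.coe_add, Prod.fst_add, Prod.snd_add, add_smul, vPair_add_right,
      LinearMap.add_apply, neg_add, skew_add_right, Prod.mk_add_mk, add_zero])
  map_smul' r a := Subtype.ext (by
    simp only [Submodule.coe_smul, Prod.smul_fst, Prod.smul_snd, smul_eq_mul, mul_smul,
      vPair_smul_right, LinearMap.smul_apply, ← smul_neg, skew_smul_right, Prod.smul_mk,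
      RingHom.id_apply, mul_zero])

def e₂ : Module.End R H.lie where
  toFun a := ⟨(0, 0, a.1.1 • E.w₂, E.Q a.1.2.1, E.q a.1.2.2.1), H.instr.smul_mem _ E.w₂_mem⟩
  map_add' a b := Subtype.ext (by
    simp only [Submodule.coe_add, Prod.fst_add, Prod.snd_add, add_smul, map_add, Prod.mk_add_mk,
      add_zero])
  map_smul' r a := Subtype.ext (by
    simp only [Submodule.coe_smul, Prod.smul_fst, Prod.smul_snd, smul_eq_mul, mul_smul,
      map_smul, Prod.smul_mk, RingHom.id_apply, smul_zero, mul_zero])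

def e₃ : Module.End R H.lie where
  toFun a := ⟨(0, 0, 0, a.1.1 • E.w₃, E.τ a.1.2.1), H.instr.zero_mem⟩
  map_add' a b := Subtype.ext (by
    simp only [Submodule.coe_add, Prod.fst_add, Prod.snd_add, add_smul, map_add, Prod.mk_add_mk,
      add_zero])
  map_smul' r a := Subtype.ext (by
    simp only [Submodule.coe_smul, Prod.smul_fst, Prod.smul_snd, smul_eq_mul, mul_smul,
      map_smul, Prod.smul_mk, RingHom.id_apply, smul_zero, mul_zero])

def e₄ : Module.End R H.lie where
  toFun a := ⟨(0, 0, 0, 0, a.1.1 * E.w₄), H.instr.zero_mem⟩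
  map_add' a b := Subtype.ext (by
    simp only [Submodule.coe_add, Prod.fst_add, add_mul, Prod.mk_add_mk, add_zero])
  map_smul' r a := Subtype.ext (by
    simp only [Submodule.coe_smul, Prod.smul_fst, smul_eq_mul, mul_assoc,
      Prod.smul_mk, RingHom.id_apply, smul_zero, mul_zero])

/-- The map `1 + e₁ + e₂ + e₃ + e₄` on the ambient module. -/
def map : H.Ambient → H.Ambient := fun ⟨r, p, D, z, s⟩ =>
  (r, p + r • H.dl E.x, D + H.vPair E.x p + r • E.w₂, z - D.1 E.x + E.Q p + r • E.w₃,
    s + H.skew E.x z + E.q D + E.τ p + r * E.w₄)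

theorem coe_sum_apply (a : H.lie) :
    ((a + E.e₁ a + E.e₂ a + E.e₃ a + E.e₄ a : H.lie) : H.Ambient) = E.map a := by
  obtain ⟨⟨r, p, D, z, s⟩, h⟩ := a
  simp [e₁, e₂, e₃, e₄, map, sub_eq_add_neg]

/-- The inverse of `map`. -/
def invMap : H.Ambient → H.Ambient := fun ⟨r, p', D', z', s'⟩ =>
  let p := p' - r • H.dl E.x
  let D := D' - H.vPair E.x p - r • E.w₂
  let z := z' + D.1 E.x - E.Q p - r • E.w₃
  (r, p, D, z, s' - H.skew E.x z - E.q D - E.τ p - r * E.w₄)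

theorem invMap_map (a : H.Ambient) : E.invMap (E.map a) = a := by
  obtain ⟨r, p, D, z, s⟩ := a
  have h1 : p + r • H.dl E.x - r • H.dl E.x = p := by abel
  have h2 : D + H.vPair E.x p + r • E.w₂ - H.vPair E.x p - r • E.w₂ = D := by abel
  have h3 : z - D.1 E.x + E.Q p + r • E.w₃ + D.1 E.x - E.Q p - r • E.w₃ = z := by abel
  simp only [map, invMap, h1, h2, h3]
  have h4 : s + H.skew E.x z + E.q D + E.τ p + r * E.w₄ - H.skew E.x z - E.q D - E.τ p - r * E.w₄ =
    s := by ring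
  rw [h4]

theorem map_invMap (a : H.Ambient) : E.map (E.invMap a) = a := by
  obtain ⟨r, p, D, z, s⟩ := a
  simp only [map, invMap]
  refine Prod.ext rfl (Prod.ext ?_ (Prod.ext ?_ (Prod.ext ?_ ?_))) <;> dsimp only <;> abel

/-- The bijection `1 + e₁ + e₂ + e₃ + e₄` of `L`. -/
def equiv : H.lie ≃ₗ[R] H.lie :=
  LinearEquiv.ofBijective (LinearMap.id + E.e₁ + E.e₂ + E.e₃ + E.e₄) <| by
    refine ⟨fun a b hab => Subtype.ext ?_, fun a => ⟨⟨E.invMap a, H.instr.sub_mem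
      (H.instr.sub_mem a.2 (H.vPair_mem _ _)) (H.instr.smul_mem _ E.w₂_mem)⟩, Subtype.ext ?_⟩⟩
    · simp only [LinearMap.add_apply, LinearMap.id_apply] at hab
      rw [← E.invMap_map a, ← E.coe_sum_apply, hab, E.coe_sum_apply, E.invMap_map]
    · simp only [LinearMap.add_apply, LinearMap.id_apply]
      rw [E.coe_sum_apply, E.map_invMap]

theorem equiv_apply (a : H.lie) :
    E.equiv a = a + E.e₁ a + E.e₂ a + E.e₃ a + E.e₄ a := rfl

theorem coe_equiv_apply (a : H.lie) : (E.equiv a : H.Ambient) = E.map a :=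
  E.coe_sum_apply a

/-- The pairs `D` for which the map respects the bracket of `D` and `1_{-1}`. -/
structure CompatOne (D : Module.End R (QuadExt α × J) × Module.End R (QuadExt α × J)) : Prop where
  Q : E.Q (D.2 (1, 0)) = D.1 (E.Q (1, 0)) + H.V E.x (1, 0) (D.1 E.x) - E.q D • H.dl (1, 0)
  τ : E.τ (D.2 (1, 0)) = E.τ (1, 0) * H.skewAct D.1 - H.skew (D.1 E.x) (E.Q (1, 0)) -
    E.q D * H.skew E.x (H.dl (1, 0))

/-- The identities that make `1 + e₁ + e₂ + e₃ + e₄` an automorphism. -/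
structure IsExp : Prop where
  -- The first three conditions are for brackets with elements of L_1.
  q_vPair : ∀ z p, E.q (H.vPair z p) =
    H.skew z (E.Q p) - H.skew E.x z * H.skew E.x (H.dl p)
  Q_dl : ∀ z, E.Q (H.dl z) = -E.w₂.1 z - (H.skew E.x z * (1 - 4 * α)) • E.x
  τ_dl : ∀ z, E.τ (H.dl z) = H.skew z E.w₃ - H.skew E.x z * H.skewAct E.w₂.1
  -- These three are for brackets of L_0 with 1_{-1}; they are linear in D, so generators of L_0
  -- suffice.
  compat_diag : ∀ c, E.CompatOne (H.diagPair c)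
  compat_lmul : ∀ j, E.CompatOne (H.lmulPair j)
  compat_inn : ∀ i j, E.CompatOne (H.innPair i j)
  -- Degrees 0, 1 and 2 of the bracket of 1_{-1} with y_{-1}; the lower degrees hold automatically.
  one_zero : ∀ y, H.vPair E.x (1, 0) * H.vPair E.x y - H.vPair E.x y * H.vPair E.x (1, 0) +
    H.vPair (E.Q (1, 0)) y - H.vPair (E.Q y) (1, 0) = H.skew (1, 0) y • E.w₂
  one_one : ∀ y, H.V E.x (1, 0) (E.Q y) - H.V E.x y (E.Q (1, 0)) + E.τ y • H.dl (1, 0) -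
    E.τ (1, 0) • H.dl y = H.skew (1, 0) y • E.w₃
  one_two : ∀ y, H.skew (E.Q (1, 0)) (E.Q y) + E.τ y * H.skew E.x (H.dl (1, 0)) -
    E.τ (1, 0) * H.skew E.x (H.dl y) = H.skew (1, 0) y * E.w₄
  -- The degrees -1 to 2 of the bracket of σ_{-2} with k_{-1} for k in K. This bracket lies in
  -- L_{-3} = 0, so the bracket of the images must vanish.
  sigma_neg : ∀ k : QuadExt α, E.w₂.2 (k, 0) - (H.vPair E.x (k, 0)).2 (H.dl E.x) -
    H.dl (E.Q (k, 0)) = 0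
  sigma_zero : ∀ k : QuadExt α, E.w₂ * H.vPair E.x (k, 0) - H.vPair E.x (k, 0) * E.w₂ +
    H.vPair E.w₃ (k, 0) - H.vPair (E.Q (k, 0)) (H.dl E.x) -
      (E.τ (k, 0) * (1 - 4 * α)) • H.gradPair = 0
  sigma_one : ∀ k : QuadExt α, E.w₂.1 (E.Q (k, 0)) - H.V E.x (k, 0) E.w₃ +
    (E.τ (k, 0) * (1 - 4 * α)) • E.x - E.w₄ • H.dl (k, 0) = 0
  sigma_two : ∀ k : QuadExt α, H.skew E.w₃ (E.Q (k, 0)) + E.τ (k, 0) * H.skewAct E.w₂.1 -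
    E.w₄ * H.skew E.x (H.dl (k, 0)) = 0

variable {E}

theorem CompatOne.add {D D' : Module.End R (QuadExt α × J) × Module.End R (QuadExt α × J)}
    (h : E.CompatOne D) (h' : E.CompatOne D') : E.CompatOne (D + D') where
  Q := by
    simp only [Prod.fst_add, Prod.snd_add, LinearMap.add_apply, map_add, h.Q, h'.Q, add_smul]
    abel
  τ := by
    simp only [Prod.fst_add, Prod.snd_add, LinearMap.add_apply, map_add, h.τ, h'.τ, skewAct_add,
      skew_add_left]
    ring

theorem CompatOne.smul {D : Module.End R (QuadExt α × J) × Module.End R (QuadExt α × J)}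
    (r : R) (h : E.CompatOne D) : E.CompatOne (r • D) where
  Q := by
    simp only [Prod.smul_fst, Prod.smul_snd, LinearMap.smul_apply, map_smul, h.Q, smul_eq_mul,
      mul_smul, smul_sub, smul_add]
  τ := by
    simp only [Prod.smul_fst, Prod.smul_snd, LinearMap.smul_apply, map_smul, h.τ, skewAct_smul,
      skew_smul_left, smul_eq_mul]
    ring

theorem CompatOne.sub {D D' : Module.End R (QuadExt α × J) × Module.End R (QuadExt α × J)}
    (h : E.CompatOne D) (h' : E.CompatOne D') : E.CompatOne (D - D') := by
  have e : D - D' = D + (-1 : R) • D' := by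
    rw [pair_neg_smul, one_smul, sub_eq_add_neg]
  exact e ▸ h.add (h'.smul _)

theorem compatOne_of_mem (h : E.IsExp)
    {D : Module.End R (QuadExt α × J) × Module.End R (QuadExt α × J)} (hD : D ∈ H.instr) :
    E.CompatOne D := by
  induction hD using Submodule.span_induction with
  | mem p hp =>
    obtain ⟨⟨k, i⟩, ⟨l, j⟩, rfl⟩ := hp
    change E.CompatOne (H.vPair _ _)
    rw [vPair_eq]
    exact ((h.compat_diag _).sub (h.compat_lmul _)).sub (h.compat_inn i j)
  | zero => constructor <;> simp [show H.skewAct 0 = 0 from H.skewActLin.map_zero, skew_zero_left]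
  | add p q _ _ hp hq => exact hp.add hq
  | smul r p _ hp => exact hp.smul r

/-- `a` and `b` are compatible when the map respects their bracket. -/
def Compat (E : H.ExpData) (a b : H.lie) : Prop := E.equiv ⁅a, b⁆ = ⁅E.equiv a, E.equiv b⁆

theorem compat_iff (a b : H.lie) :
    E.Compat a b ↔ E.map (H.bracket a b) = H.bracket (E.map a) (E.map b) := by
  rw [Compat, Subtype.ext_iff, coe_equiv_apply, coe_lie, coe_lie, coe_equiv_apply, coe_equiv_apply]

theorem Compat.symm {a b : H.lie} (h : E.Compat a b) : E.Compat b a := by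
  rw [Compat, ← lie_skew, map_neg, h, lie_skew]

theorem Compat.add_right {a b c : H.lie} (h : E.Compat a b) (h' : E.Compat a c) :
    E.Compat a (b + c) := by
  rw [Compat, lie_add, map_add, map_add, lie_add, h, h']

theorem Compat.smul_right {a b : H.lie} (r : R) (h : E.Compat a b) : E.Compat a (r • b) := by
  rw [Compat, lie_smul_right, map_smul, map_smul, lie_smul_right, h]

variable (E) in
/-- The elements of `L` that are compatible with all others. -/
def compatSet : Submodule R H.lie where
  carrier := {a | ∀ b, Compat E a b}
  zero_mem' b := by rw [Compat, zero_lie, map_zero, zero_lie]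
  add_mem' ha hb c := ((ha c).symm.add_right (hb c).symm).symm
  smul_mem' r _ ha c := ((ha c).symm.smul_right r).symm

/-- By the Jacobi identity [[a, b], c] = [a, [b, c]] - [b, [a, c]]. Hence it is enough to find
generators of L in the set. -/
theorem lie_mem_compatSet {a b : H.lie} (ha : a ∈ compatSet E) (hb : b ∈ compatSet E) :
    ⁅a, b⁆ ∈ compatSet E := fun c => by
  rw [Compat, lie_lie, map_sub, ha, hb, hb, ha, ha, lie_lie]

/-- The three conditions `q_vPair`, `Q_dl` and `τ_dl` determine how e₂ and e₃ interact with L_1;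
what is left over are relations that hold in L itself. -/
theorem pos1_mem (h : E.IsExp) (z : QuadExt α × J) : H.pos1 z ∈ compatSet E := by
  rintro ⟨⟨r, p, D, z', s⟩, hD⟩
  replace hD : H.IsInner D := IsInner.of_mem hD
  have e0 : H.gradPair.1 = 1 := rfl
  rw [compat_iff]
  simp only [pos1, bracket_mk, map, skew_zero_left, skewAct_zero, vPair_zero_right,
    vPair_add_right, vPair_smul_right, Prod.fst_zero, Prod.snd_zero, zero_smul, smul_zero,
    zero_mul, mul_zero, add_zero, zero_add, sub_zero, zero_sub, map_zero, LinearMap.zero_apply,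
    LinearMap.add_apply, LinearMap.smul_apply, map_add, map_smul, Prod.fst_add, Prod.smul_fst,
    skew_add_right, skew_sub_right, skew_smul_right, skewAct_add, skewAct_smul, skewAct_vPair,
    h.q_vPair, h.Q_dl, h.τ_dl, dl_dl, skew_neg_right]
  refine Prod.ext rfl (Prod.ext rfl (Prod.ext ?_ (Prod.ext ?_ ?_))) <;> dsimp only
  · linear_combination (norm := module) r • H.vPair_dl_sub E.x z
  · linear_combination (norm := module) H.vPair_fst_swap E.x z p
  · simp only [smul_eq_mul]
    linear_combination -hD.skew_fst E.x z + H.skew_comm z (D.1 E.x)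

theorem compat_zeroPart_one (h : E.IsExp)
    {D : Module.End R (QuadExt α × J) × Module.End R (QuadExt α × J)} (hD : D ∈ H.instr) :
    Compat E (zeroPart D hD) (H.neg1 (1, 0)) := by
  have h1 := compatOne_of_mem h hD
  have hi := IsInner.of_mem hD
  rw [compat_iff]
  simp only [zeroPart, neg1, bracket_mk, map, skew_zero_left, skewAct_zero, vPair_zero_right,
    vPair_zero_left, Prod.fst_zero, Prod.snd_zero, zero_smul, smul_zero, zero_mul, mul_zero,
    add_zero, zero_add, sub_zero, zero_sub, map_zero, map_neg, LinearMap.zero_apply,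
    skewAct_vPair, skew_neg_left, h1.Q, h1.τ, vPair_neg_left, skew_zero_right]
  refine Prod.ext rfl (Prod.ext rfl (Prod.ext ?_ (Prod.ext ?_ ?_))) <;> dsimp only
  · linear_combination (norm := module) -hi.commutator_vPair E.x (1, 0)
  · simp only [vPair]
    module
  · ring

theorem compat_neg1 (y y' : QuadExt α × J)
    (h0 : H.vPair E.x y * H.vPair E.x y' - H.vPair E.x y' * H.vPair E.x y +
      H.vPair (E.Q y) y' - H.vPair (E.Q y') y = H.skew y y' • E.w₂)
    (h1 : H.V E.x y (E.Q y') - H.V E.x y' (E.Q y) + E.τ y' • H.dl y -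
      E.τ y • H.dl y' = H.skew y y' • E.w₃)
    (h2 : H.skew (E.Q y) (E.Q y') + E.τ y' * H.skew E.x (H.dl y) -
      E.τ y * H.skew E.x (H.dl y') = H.skew y y' * E.w₄) :
    Compat E (H.neg1 y) (H.neg1 y') := by
  rw [compat_iff]
  simp only [neg1, bracket_mk, map, skewAct_zero, vPair_zero_right, vPair_zero_left,
    Prod.fst_zero, Prod.snd_zero, zero_smul, smul_zero, zero_mul, mul_zero, add_zero, zero_add,
    sub_zero, map_zero, LinearMap.zero_apply, skewAct_vPair, skew_zero_right]
  refine Prod.ext ?_ (Prod.ext ?_ (Prod.ext ?_ (Prod.ext ?_ ?_))) <;> dsimp only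
  · have := H.vPair_fst_swap y y' E.x
    simp only [vPair, LinearMap.neg_apply] at this ⊢
    linear_combination (norm := module) this
  · simpa using h0.symm
  · simpa [vPair] using h1.symm
  · simpa using h2.symm

theorem compat_neg2_neg1 (h : E.IsExp) (k : QuadExt α) :
    Compat E (H.neg2 1) (H.neg1 (k, 0)) := by
  rw [compat_iff]
  simp only [neg1, neg2, bracket_mk, map, skew_zero_left, skewAct_zero, vPair_zero_right,
    vPair_zero_left, Prod.fst_zero, Prod.snd_zero, zero_smul, one_smul, one_mul, mul_one,
    smul_zero, zero_mul, mul_zero, add_zero, zero_add, sub_zero, zero_sub, map_zero,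
    LinearMap.zero_apply, skewAct_vPair, skew_zero_right, skewAct_vPair_snd, dl_dl]
  refine Prod.ext ?_ (Prod.ext ?_ (Prod.ext ?_ (Prod.ext ?_ ?_))) <;> dsimp only
  · rw [skew_dl_left, ← dl_apply]; ring
  · simpa using (h.sigma_neg k).symm
  · linear_combination (norm := module) -h.sigma_zero k
  · have := h.sigma_one k
    simp only [vPair]
    linear_combination (norm := module) -this
  · have := h.sigma_two k
    linear_combination -this

theorem lie_neg1_pos1 (x y : QuadExt α × J) :
    ⁅H.pos1 x, H.neg1 y⁆ = zeroPart (H.vPair x y) (H.vPair_mem x y) := by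
  apply Subtype.ext
  rw [coe_lie]
  simp [pos1, neg1, bracket_mk, zeroPart, skew_zero_left, skew_zero_right, vPair_zero_left,
    skewAct_zero]

theorem lie_pos1_pos1 (x y : QuadExt α × J) :
    ⁅H.pos1 x, H.pos1 y⁆ = H.pos2 (H.skew x y) := by
  apply Subtype.ext
  rw [coe_lie]
  simp [pos1, pos2, bracket_mk, vPair_zero_right, skewAct_zero]

theorem lie_neg1_neg1 (x y : QuadExt α × J) :
    ⁅H.neg1 x, H.neg1 y⁆ = H.neg2 (H.skew x y) := by
  apply Subtype.ext
  rw [coe_lie]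
  simp [neg1, neg2, bracket_mk, vPair_zero_left, skewAct_zero]

theorem lie_zeroPart_neg1 (D : Module.End R (QuadExt α × J) × Module.End R (QuadExt α × J))
    (hD : D ∈ H.instr) (y : QuadExt α × J) :
    ⁅zeroPart D hD, H.neg1 y⁆ = H.neg1 (D.2 y) := by
  apply Subtype.ext
  rw [coe_lie]
  simp [neg1, zeroPart, bracket_mk, skew_zero_left, vPair_zero_left, skewAct_zero]

theorem lie_zeroPart_zeroPart
    {D D' : Module.End R (QuadExt α × J) × Module.End R (QuadExt α × J)}
    (hD : D ∈ H.instr) (hD' : D' ∈ H.instr) :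
    ⁅zeroPart D hD, zeroPart D' hD'⁆ = zeroPart (D * D' - D' * D) (commutator_mem hD hD') := by
  apply Subtype.ext
  rw [coe_lie]
  simp [zeroPart, bracket_mk, vPair_zero_left]

theorem skew_tEl_one : H.skew (tEl α, 0) (1, 0) = 1 := by simp [skew_mk]

theorem pos2_mem (h : E.IsExp) (s : R) : H.pos2 s ∈ compatSet E := by
  have := lie_mem_compatSet (pos1_mem h (s • (tEl α, 0))) (pos1_mem h (1, 0))
  rwa [lie_pos1_pos1, skew_smul_left, skew_tEl_one, mul_one] at this

/-- An element of degree `-1` is compatible with all others if it is so with those of degrees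
`0`, `-1` and `-2`. -/
theorem neg1_mem (h : E.IsExp) (y : QuadExt α × J)
    (h0 : ∀ D (hD : D ∈ H.instr), Compat E (zeroPart D hD) (H.neg1 y))
    (h1 : ∀ y', Compat E (H.neg1 y) (H.neg1 y'))
    (h2 : Compat E (H.neg2 1) (H.neg1 y)) : H.neg1 y ∈ compatSet E := by
  intro b
  rw [lie_eq_sum b, show H.neg2 b.1.1 = b.1.1 • H.neg2 1 from Subtype.ext (by simp [neg2])]
  exact ((((h2.symm.smul_right _).add_right (h1 _)).add_right (h0 _ _).symm).add_right
    (pos1_mem h _ _).symm).add_right (pos2_mem h _ _).symm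

theorem neg1_one_mem (h : E.IsExp) : H.neg1 (1, 0) ∈ compatSet E :=
  neg1_mem h _ (fun _ hD => compat_zeroPart_one h hD)
    (fun y => compat_neg1 _ _ (h.one_zero y) (h.one_one y) (h.one_two y)) (compat_neg2_neg1 h 1)

theorem zeroPart_diag_mem (h : E.IsExp) (c : QuadExt α) (hc : H.diagPair c ∈ H.instr) :
    zeroPart (H.diagPair c) hc ∈ compatSet E := by
  have := lie_mem_compatSet (pos1_mem h (c, 0)) (neg1_one_mem h)
  rw [lie_neg1_pos1] at this
  simpa only [vPair_diag] using this

theorem zeroPart_lmul_mem (h : E.IsExp) (j : J) (hj : H.lmulPair j ∈ H.instr) :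
    zeroPart (H.lmulPair j) hj ∈ compatSet E := by
  have := lie_mem_compatSet (pos1_mem h (0, -j)) (neg1_one_mem h)
  rw [lie_neg1_pos1] at this
  have e : H.lmulPair (-j) = -H.lmulPair j := by simp [lmulPair, lmul_neg]
  simpa only [vPair_lmul, e, neg_neg] using this

theorem diagPair_mem (c : QuadExt α) : H.diagPair c ∈ H.instr := H.vPair_diag c ▸ H.vPair_mem _ _

theorem lmulPair_mem (j : J) : H.lmulPair j ∈ H.instr := by
  have := H.instr.neg_mem (H.vPair_mem (0, j) (1, 0))
  rwa [vPair_lmul, neg_neg] at this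

theorem innPair_mem (i j : J) : H.innPair i j ∈ H.instr := by
  rw [innPair_eq]
  exact commutator_mem (lmulPair_mem i) (lmulPair_mem j)

/-- The diagonal elements and the left multiplications are, up to sign, brackets of L_1 with 1_{-1},
and `inn` consists of their commutators. So L_1 and 1_{-1} already produce L_0. -/
theorem zeroPart_mem (h : E.IsExp)
    {D : Module.End R (QuadExt α × J) × Module.End R (QuadExt α × J)} (hD : D ∈ H.instr) :
    zeroPart D hD ∈ compatSet E := by
  suffices ∃ hD : D ∈ H.instr, zeroPart D hD ∈ compatSet E from this.2
  induction hD using Submodule.span_induction with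
  | mem p hp =>
    obtain ⟨⟨k, i⟩, ⟨l, j⟩, rfl⟩ := hp
    refine ⟨H.vPair_mem _ _, ?_⟩
    have h1 := zeroPart_diag_mem h (k * star l + H.T j i) (diagPair_mem _)
    have h2 := zeroPart_lmul_mem h (k • j + l • i + H.cross i j) (lmulPair_mem _)
    have h3 := lie_mem_compatSet (zeroPart_lmul_mem h i (lmulPair_mem _))
      (zeroPart_lmul_mem h j (lmulPair_mem _))
    rw [lie_zeroPart_zeroPart] at h3
    have := (compatSet E).sub_mem ((compatSet E).sub_mem h1 h2) h3
    convert this using 1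
    apply Subtype.ext
    have e := H.vPair_eq k l i j
    rw [vPair, innPair_eq] at e
    simp only [zeroPart, Submodule.coe_sub, Prod.mk_sub_mk, sub_zero, e]
  | zero => exact ⟨H.instr.zero_mem, (compatSet E).zero_mem⟩
  | add p q _ _ hp hq =>
    obtain ⟨hp, hp'⟩ := hp
    obtain ⟨hq, hq'⟩ := hq
    refine ⟨H.instr.add_mem hp hq, ?_⟩
    convert (compatSet E).add_mem hp' hq' using 1
    apply Subtype.ext
    simp only [zeroPart, Submodule.coe_add, Prod.mk_add_mk, add_zero]
  | smul r p _ hp =>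
    obtain ⟨hp, hp'⟩ := hp
    refine ⟨H.instr.smul_mem r hp, ?_⟩
    convert (compatSet E).smul_mem r hp' using 1
    apply Subtype.ext
    simp only [zeroPart, Submodule.coe_smul, Prod.smul_mk, smul_zero]

theorem neg1_snd_mem (h : E.IsExp) (j : J) : H.neg1 (0, j) ∈ compatSet E := by
  have := lie_mem_compatSet (zeroPart_mem h (lmulPair_mem (-j))) (neg1_one_mem h)
  rw [lie_zeroPart_neg1] at this
  simpa [lmulPair, lmul_mk] using this

/-- L_{-1} is spanned by t, 1 and J. The elements 1_{-1} and J_{-1} are already known to be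
compatible with everything, and the bracket of t_{-1} with itself is zero, so only σ_{-2} needs a
separate check. -/
theorem neg1_tEl_mem (h : E.IsExp) : H.neg1 (tEl α, 0) ∈ compatSet E := by
  refine neg1_mem h _ (fun D hD => zeroPart_mem h hD _) (fun y => ?_) (compat_neg2_neg1 h _)
  obtain ⟨k, j⟩ := y
  have e : H.neg1 (k, j) = k.im • H.neg1 (tEl α, 0) + k.re • H.neg1 (1, 0) + H.neg1 (0, j) := by
    apply Subtype.ext
    simp [neg1]
    ext <;> simp [QuadraticAlgebra.re_one, QuadraticAlgebra.im_one]
  rw [e]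
  refine ((Compat.smul_right _ ?_).add_right ((neg1_one_mem h _).symm.smul_right _)).add_right
    (neg1_snd_mem h j _).symm
  rw [Compat, lie_self, map_zero, lie_self]

/-- The last missing piece is L_{-2}, which is spanned by [t_{-1}, 1_{-1}] = σ_{-2}. -/
theorem compatSet_eq_top (h : E.IsExp) (a : H.lie) : a ∈ compatSet E := by
  rw [lie_eq_sum a]
  have h2 : H.neg2 a.1.1 ∈ compatSet E := by
    have := (compatSet E).smul_mem a.1.1 (lie_mem_compatSet (neg1_tEl_mem h) (neg1_one_mem h))
    rwa [lie_neg1_neg1, skew_tEl_one,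
      show a.1.1 • H.neg2 1 = H.neg2 a.1.1 from Subtype.ext (by simp [neg2])] at this
  have h1 : H.neg1 a.1.2.1 ∈ compatSet E := by
    have := (compatSet E).add_mem ((compatSet E).add_mem
      ((compatSet E).smul_mem a.1.2.1.1.im (neg1_tEl_mem h))
      ((compatSet E).smul_mem a.1.2.1.1.re (neg1_one_mem h))) (neg1_snd_mem h a.1.2.1.2)
    convert this using 1
    apply Subtype.ext
    obtain ⟨⟨r, y, D, x, s⟩, _⟩ := a
    simp [neg1]
    refine Prod.ext ?_ ?_
    · ext <;> simp [QuadraticAlgebra.re_one, QuadraticAlgebra.im_one]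
    · simp
  exact (compatSet E).add_mem ((compatSet E).add_mem ((compatSet E).add_mem
    ((compatSet E).add_mem h2 h1) (zeroPart_mem h _)) (pos1_mem h _)) (pos2_mem h _)

theorem IsExp.isLieAut (h : E.IsExp) : H.IsLieAut E.equiv :=
  (isLieAut_iff _).2 fun a b => compatSet_eq_top h a b

theorem IsExp.isExpPos (h : E.IsExp) {g : H.G} (hx : E.x = g.x) (hQ : ∀ c, E.Q c = g.Q c)
    (hτ : ∀ c, E.τ c = g.cubicT c) : H.IsExpPos g E.equiv := by
  refine ⟨h.isLieAut, E.e₁, E.e₂, E.e₃, E.e₄, E.equiv_apply, fun i a ha => ?_, fun a => ?_,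
    fun c => ?_, fun c => ?_⟩
  · obtain ⟨⟨r, y, D, x, s⟩, hD⟩ := a
    obtain ⟨h1, h2, h3, h4, h5⟩ := ha
    dsimp only at h1 h2 h3 h4 h5
    refine ⟨⟨?_, ?_, ?_, ?_, ?_⟩, ⟨?_, ?_, ?_, ?_, ?_⟩, ⟨?_, ?_, ?_, ?_, ?_⟩,
      ⟨?_, ?_, ?_, ?_, ?_⟩⟩ <;> intro hi <;> simp only [e₁, e₂, e₃, e₄, LinearMap.coe_mk,
        AddHom.coe_mk] <;>
      first
      | rfl
      | (rw [h1 (by omega)]; simp)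
      | (rw [h2 (by omega)]; simp [vPair_zero_right])
      | (rw [h3 (by omega)]; simp)
      | (rw [h4 (by omega)]; simp [skew_zero_right])
  · obtain ⟨⟨r, y, D, x, s⟩, hD⟩ := a
    simp [e₁, pos1, bracket_mk, hx, skew_zero_left, skewAct_zero, vPair_zero_right]
  · apply Subtype.ext
    simp [e₂, neg1, pos1, hQ]
  · apply Subtype.ext
    simp [e₃, neg1, pos2, hτ]

end ExpData

end Exponential

/-! ### Operators D and `inn` at v and v^♯ -/

section Polarization

variable {R : Type u} [CommRing R] {α : R} {J : Type v} [AddCommGroup J] [Module R J]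
  [Module (QuadExt α) J] [IsScalarTower R (QuadExt α) J]

variable (H : HermitianCubicNormStructure α J)

/-- The derivative of `(v^♯)^♯ = N(v) v`. -/
theorem sharp_cross_cross' (v w : J) : H.cross (H.sharp.ground v) (H.cross v w) =
    H.N.ground v • w + H.T w (H.sharp.ground v) • v := by
  have h := H.sharp_sharp (Polynomial R) (1 ⊗ₜ v + Polynomial.X ⊗ₜ w)
  have h2 := congrArg (coeffTensor J 1) h
  simp [sharp_tmul, N_tmul, extend₂_tmul, coeffTensor_tmul, Polynomial.coeff_X, sharp_add',
    N_add', smulExt_tmul, Polynomial.coeff_one, Polynomial.coeff_X_pow,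
    ← pow_succ, ← pow_mul] at h2
  exact h2

theorem sharp_cross_cross_linear (x y z : J) : H.cross (H.sharp.ground x) (H.cross y z) +
    H.cross (H.cross x y) (H.cross x z) = H.T x (H.cross y z) • x
      + H.T y (H.sharp.ground x) • z + H.T z (H.sharp.ground x) • y := by
  have h1 := H.sharp_cross x (y + z)
  have h2 := H.sharp_cross x y
  have h3 := H.sharp_cross x z
  simp only [ground_sharp_add, map_add, LinearMap.add_apply, add_smul, smul_add] at h1
  linear_combination (norm := module) h1 - h2 - h3

/-- This operator and the one in `D_sharp_left` are scalar, by the derivative of (v^♯)^♯ = N(v)v and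
by the third axiom respectively. -/
theorem D_sharp_right (v w : J) : H.D v (H.sharp.ground v) w = -(H.N.ground v • w) := by
  rw [D, H.cross_comm _ (H.sharp.ground v), H.cross_comm w, sharp_cross_cross']
  module

theorem D_sharp_left (v w : J) : H.D (H.sharp.ground v) v w = -(star (H.N.ground v) • w) := by
  rw [D, H.cross_comm w, cross_cross_sharp]
  module

theorem D_sharp_right_linear (v w j : J) :
    H.D j (H.sharp.ground v) w + H.D v (H.cross v j) w = -(H.T j (H.sharp.ground v) • w) := by
  have h := H.sharp_cross_cross_linear v w j
  have e := H.T_cross_left_comm v w j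
  rw [D, D, H.cross_comm _ (H.sharp.ground v), H.cross_comm w v]
  rw [e] at h
  linear_combination (norm := module) -h

theorem D_sharp_left_linear (v w j : J) :
    H.D (H.sharp.ground v) j w + H.D (H.cross v j) v w = -(H.T (H.sharp.ground v) j • w) := by
  have h := H.cross_cross_sharp_linear v w j
  rw [D, D, H.cross_comm w, H.cross_comm w]
  linear_combination (norm := module) -h

/-- Both D-terms of the commutator are scalar on J, so it is diagonal. In comparisons of normal
forms such terms have to be moved to the diagonal part. -/
theorem inn_sharp (v : J) (c : QuadExt α) : H.inn v (c • H.sharp.ground v) =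
    H.diag (c * star (H.N.ground v) - star c * H.N.ground v) := by
  have e : H.T (H.sharp.ground v) v = 3 * star (H.N.ground v) := by
    rw [← star_T, T_self_sharp]; simp
  refine LinearMap.ext fun ⟨m, w⟩ => Prod.ext ?_ ?_
  · simp [inn_mk, diag_mk, H.T_smul_left, T_smul_right, T_self_sharp, e]
    ring
  · simp [inn_mk, diag_mk, D_smul_left, D_smul_right, D_sharp_left, D_sharp_right]
    module

theorem inn_sharp_linear (v w : J) : H.inn w (H.sharp.ground v) + H.inn v (H.cross v w) =
    H.diag (H.T (H.sharp.ground v) w - H.T w (H.sharp.ground v)) := by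
  have e : H.T v (H.cross v w) = 2 * H.T w (H.sharp.ground v) := by
    rw [T_cross_rotate, cross_self, T_smul_right]; simp
  have e' : H.T (H.cross v w) v = 2 * H.T (H.sharp.ground v) w := by
    rw [← star_T, e]; simp [star_T]
  refine LinearMap.ext fun ⟨m, z⟩ => Prod.ext ?_ ?_
  · simp [inn_mk, diag_mk, e, e', star_T]
    ring
  · have h1 := H.D_sharp_right_linear v z w
    have h2 := H.D_sharp_left_linear v z w
    simp [inn_mk, diag_mk, star_T]
    linear_combination (norm := module) h1 - h2

theorem D_sharp_apply (i j v : J) : H.D i j (H.sharp.ground v) =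
    -(H.T i j • H.sharp.ground v) - H.cross v (H.D j i v) := by
  have h := H.cross_cross_sharp_linear v i j
  simp only [D, map_sub, H.cross_smul_right, star_T]
  rw [H.cross_comm v (H.cross (H.cross v j) i)]
  rw [← H.star_T v i] at *
  simp only [star_T] at *
  linear_combination (norm := module) -h

theorem cross_sharp_cross_sharp (v : J) :
    H.cross (H.sharp.ground v) (H.cross v (H.sharp.ground v)) =
      H.N.ground v • H.sharp.ground v + H.T (H.sharp.ground v) (H.sharp.ground v) • v :=
  H.sharp_cross_cross' v _

theorem sharp_cross_sharp (v : J) : H.sharp.ground (H.cross v (H.sharp.ground v)) =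
    (star (H.N.ground v) * H.T v v) • v +
      H.T (H.sharp.ground v) (H.sharp.ground v) • H.sharp.ground v -
      star (H.N.ground v) • H.cross v (H.sharp.ground v) := by
  have h := H.sharp_cross v (H.sharp.ground v)
  rw [ground_sharp_sharp, T_smul_right, H.cross_smul_right, H.cross_comm _ v] at h
  linear_combination (norm := module) h

end Polarization

/-! ### Passage between R and the skew elements of K -/

section Scalars

variable {R : Type u} [CommRing R] {α : R}

/-- Multiply once more by δ: δ² = 1 - 4α is a unit of R, and R embeds in K. -/
theorem algebraMap_mul_delta_cancel (hα : IsUnit (1 - 4 * α)) {r s : R}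
    (h : algebraMap R (QuadExt α) r * delta α = algebraMap R (QuadExt α) s * delta α) : r = s := by
  have h2 := congrArg (· * delta α) h
  simp only [mul_assoc, delta_sq, ← map_mul] at h2
  exact hα.mul_right_cancel (QuadraticAlgebra.algebraMap_injective h2)

theorem algebraMap_re_mul_delta {k : QuadExt α} (h : star k = -k) :
    algebraMap R (QuadExt α) k.re * delta α = -k := by
  have h1 := congrArg QuadraticAlgebra.re h
  have h2 := congrArg QuadraticAlgebra.im h
  simp at h1 h2
  ext
  · simp [delta_re, delta_im]
  · simp [delta_re, delta_im]
    linear_combination h1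

end Scalars

/-! ### Explicit formulas for the components of exp_+(g) -/

section Operators

variable {R : Type u} [CommRing R] {α : R} {J : Type v} [AddCommGroup J] [Module R J]
  [Module (QuadExt α) J] [IsScalarTower R (QuadExt α) J]

variable {H : HermitianCubicNormStructure α J} (g : H.G)

/-- Eliminating ū uses up the defining relation of G; afterwards the identities for g are formal in
a, ā, u and the values of T, N, ♯ and ×. -/
theorem G.star_u : star g.u = g.a * star g.a + H.T g.v g.v - g.u := by
  linear_combination g.rel

theorem algebraMap_skew (x y : QuadExt α × J) : algebraMap R (QuadExt α) (H.skew x y) * delta α =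
    x.1 * star y.1 + H.T x.2 y.2 - (star x.1 * y.1 + H.T y.2 x.2) := by
  rw [show H.skew x y = (x.1 * star y.1 + H.T x.2 y.2).im from rfl, algebraMap_im_mul_delta]
  simp [star_T]

theorem algebraMap_skew_dl (x y : QuadExt α × J) :
    algebraMap R (QuadExt α) (H.skew x (H.dl y)) =
      -(x.1 * star y.1 + H.T x.2 y.2 + star x.1 * y.1 + H.T y.2 x.2) := by
  obtain ⟨k, i⟩ := x
  obtain ⟨l, j⟩ := y
  have e : H.skew (k, i) (H.dl (l, j)) = -(delta α * (k * star l + H.T i j)).im := by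
    rw [dl_mk, skew_mk, ← QuadraticAlgebra.im_neg]
    congr 1
    simp [T_smul_right, star_delta]
    ring
  rw [e, map_neg, algebraMap_im_delta_mul]
  simp [star_T]
  ring

theorem T_self_cross (v w : J) : H.T v (H.cross v w) = 2 * H.T w (H.sharp.ground v) := by
  rw [T_cross_rotate, cross_self, T_smul_right]; simp

theorem T_cross_self_left (v w : J) : H.T (H.cross v w) v = 2 * H.T (H.sharp.ground v) w := by
  rw [← star_T, T_self_cross]; simp [star_T]

namespace G

theorem Q_mk (b : QuadExt α) (w : J) : g.Q (b, w) =
    (g.a ^ 2 * star b + (H.T g.v g.v - g.u) * b + g.a * H.T w g.v + H.T (H.sharp.ground g.v) w,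
      (star g.a * b) • g.v + star b • H.sharp.ground g.v + H.T g.v w • g.v +
        H.cross (H.cross g.v w) g.v - H.cross (H.sharp.ground g.v) w + star g.a • H.cross g.v w +
        (g.a * star g.a - g.u) • w) := by
  refine Prod.ext ?_ ?_
  · simp [G.Q, G.x, G.y, mul_mk, conj_mk, H.T_smul_left, T_cross_self_left]
    ring
  · simp [G.Q, G.x, G.y, mul_mk, conj_mk, H.cross_smul_left, cross_self]
    rw [H.cross_comm w]
    module

/-- `Q` as a linear map. -/
def QLin : Module.End R (QuadExt α × J) :=
  (H.mul.flip g.x ∘ₗ H.mul g.x ∘ₗ H.conj) - H.mul g.y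

/-- The element of `K` whose skew part is `T_{(x,y)} c`. -/
def theta (c : QuadExt α × J) : QuadExt α :=
  g.u * star (g.a * star c.1 + H.T g.v c.2) + g.a * star g.a * H.T g.v c.2
    + g.a * star c.1 * H.T g.v g.v + g.a * H.T c.2 (H.sharp.ground g.v)
    + c.1 * H.N.ground g.v + H.T (H.cross g.v (H.sharp.ground g.v)) c.2

theorem algebraMap_cubicT (c : QuadExt α × J) :
    algebraMap R (QuadExt α) (g.cubicT c) * delta α = g.theta c - star (g.theta c) :=
  algebraMap_im_mul_delta _

/-- `T_{(x,y)}` as a linear map. -/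
def cubicTLin : (QuadExt α × J) →ₗ[R] R where
  toFun := g.cubicT
  map_add' c d := by
    simp only [cubicT, Prod.fst_add, Prod.snd_add, star_add, star_mul', map_add,
      LinearMap.add_apply,
      ← QuadraticAlgebra.im_add]
    congr 1
    ring
  map_smul' r c := by
    have e (k : QuadExt α) : r * k.im = (algebraMap R (QuadExt α) r * k).im :=
      (im_algebraMap_mul r k).symm
    simp only [cubicT, Prod.smul_fst, Prod.smul_snd, map_smul, LinearMap.smul_apply,
      Algebra.smul_def, star_mul', star_add, star_algebraMap, RingHom.id_apply]
    simp only [Algebra.algebraMap_self_apply, e]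
    congr 1
    ring

/-- The `K`-component of the image of `t - t̄` in degree `1`, divided by `t - t̄`. -/
def a₃ : QuadExt α := g.a * (H.T g.v g.v - g.u) - star (H.N.ground g.v)

/-- The `J`-component of the image of `t - t̄` in degree `1`, divided by `t - t̄`. -/
def v₃ : J := (g.a * star g.a - g.u) • g.v - star g.a • H.sharp.ground g.v +
  H.cross g.v (H.sharp.ground g.v)

/-- The data of the automorphism `exp_+(g)`. -/
def expData : H.ExpData where
  x := g.x
  Q := g.QLin
  τ := g.cubicTLin
  -- The term inn(tv, v) is half of inn(δv, v), because inn(t̄v, v) = inn(v, tv) = -inn(tv, v).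
  -- Writing it with t avoids a division by 2.
  w₂ := H.diagPair (delta α * (H.T g.v g.v - g.u)) +
    H.lmulPair (delta α • (H.sharp.ground g.v - g.a • g.v)) + H.innPair (tEl α • g.v) g.v
  w₃ := (delta α * g.a₃, delta α • g.v₃)
  -- This is where the quartic norm enters: it is the σ_2-coefficient of the image of σ_{-2}.
  w₄ := g.nu
  w₂_mem := H.instr.add_mem (H.instr.add_mem (ExpData.diagPair_mem _) (ExpData.lmulPair_mem _))
    (ExpData.innPair_mem _ _)

theorem inn_tEl_smul_self (v w : J) (m : QuadExt α) :
    H.inn (tEl α • v) v (m, w) = (delta α * H.T v v * m, delta α • H.D v v w) := by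
  rw [inn_mk, T_smul_right, H.T_smul_left, D_smul_left, D_smul_right, delta, sub_smul,
    sub_mul, sub_mul, sub_mul]

theorem w₂_fst_mk (m : QuadExt α) (w : J) : g.expData.w₂.1 (m, w) =
    (delta α * ((g.a * star g.a + g.u - H.T g.v g.v) * m +
      H.T (H.sharp.ground g.v) w - g.a * H.T g.v w),
    delta α • ((g.u - g.a * star g.a) • w + star m • (H.sharp.ground g.v - g.a • g.v) -
      H.cross (H.sharp.ground g.v) w + star g.a • H.cross g.v w + H.D g.v g.v w)) := by
  refine Prod.ext ?_ ?_
  · simp [expData, diagPair, lmulPair, innPair, diag_mk, lmul_mk, inn_tEl_smul_self,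
      H.T_smul_left, star_u, star_delta, star_T]
    ring
  · simp [expData, diagPair, lmulPair, innPair, diag_mk, lmul_mk, inn_tEl_smul_self,
      H.cross_smul_left, star_u, star_delta, star_T]
    module

theorem w₂_snd_mk (m : QuadExt α) (w : J) : g.expData.w₂.2 (m, w) =
    (delta α * ((2 * (g.a * star g.a) - g.u) * m -
      H.T (H.sharp.ground g.v) w + g.a * H.T g.v w),
    delta α • ((H.T g.v g.v - g.u) • w - star m • (H.sharp.ground g.v - g.a • g.v) +
      H.cross (H.sharp.ground g.v) w - star g.a • H.cross g.v w + H.D g.v g.v w)) := by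
  refine Prod.ext ?_ ?_
  · simp [expData, diagPair, lmulPair, innPair, diag_mk, lmul_mk, inn_tEl_smul_self,
      H.T_smul_left, star_u, star_delta, star_T]
    ring
  · simp [expData, diagPair, lmulPair, innPair, diag_mk, lmul_mk, inn_tEl_smul_self,
      H.cross_smul_left, star_u, star_delta, star_T]
    module

theorem expData_Q_mk (b : QuadExt α) (w : J) : g.expData.Q (b, w) =
    (g.a ^ 2 * star b + (H.T g.v g.v - g.u) * b + g.a * H.T w g.v + H.T (H.sharp.ground g.v) w,
      (star g.a * b) • g.v + star b • H.sharp.ground g.v + H.T g.v w • g.v +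
        H.cross (H.cross g.v w) g.v - H.cross (H.sharp.ground g.v) w + star g.a • H.cross g.v w +
        (g.a * star g.a - g.u) • w) := g.Q_mk b w

theorem expData_x : g.expData.x = (g.a, g.v) := rfl

theorem expData_w₃ : g.expData.w₃ = (delta α * g.a₃, delta α • g.v₃) := rfl

theorem algebraMap_expData_τ (c : QuadExt α × J) :
    algebraMap R (QuadExt α) (g.expData.τ c) * delta α = g.theta c - star (g.theta c) :=
  g.algebraMap_cubicT c

theorem theta_mk (b : QuadExt α) (w : J) : g.theta (b, w) =
    g.u * (star g.a * b + H.T w g.v) + g.a * star g.a * H.T g.v w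
    + g.a * star b * H.T g.v g.v + g.a * H.T w (H.sharp.ground g.v)
    + b * H.N.ground g.v + H.T (H.cross g.v (H.sharp.ground g.v)) w := by
  simp [theta, star_T]

theorem V_mk (k l m : QuadExt α) (i j w : J) : H.V (k, i) (l, j) (m, w) =
    ((-2 * (k * star l + H.T j i) + (star k * l + H.T i j)) * m -
      H.T (k • j + l • i + H.cross i j) w - (H.T i j - H.T j i) * m,
    -((star k * l + H.T i j) • w) - star m • (k • j + l • i + H.cross i j) -
      H.cross (k • j + l • i + H.cross i j) w - (H.D i j w - H.D j i w)) := by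
  rw [V_eq]
  refine Prod.ext ?_ ?_
  · simp [diag_mk, lmul_mk, inn_mk, star_T]
  · simp [diag_mk, lmul_mk, inn_mk, star_T]
    try module

theorem expData_Q_dl (z : QuadExt α × J) : g.expData.Q (H.dl z) =
    -g.expData.w₂.1 z - (H.skew g.expData.x z * (1 - 4 * α)) • g.expData.x := by
  have e : (H.skew g.expData.x z * (1 - 4 * α)) • g.expData.x =
      (algebraMap R (QuadExt α) (H.skew g.expData.x z) * delta α * delta α) • g.expData.x := by
    rw [mul_assoc, delta_sq, ← map_mul, algebraMap_smul]
  rw [e, algebraMap_skew]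
  obtain ⟨m, w⟩ := z
  rw [dl_mk, expData_Q_mk, w₂_fst_mk, expData_x]
  refine Prod.ext ?_ ?_
  · simp [T_smul_right, H.T_smul_left, star_delta]
    ring
  · simp [T_smul_right, star_delta, D, H.cross_smul_left, H.cross_smul_right]
    rw [H.cross_comm w]
    module

theorem algebraMap_skewAct_w₂ : algebraMap R (QuadExt α) (H.skewAct g.expData.w₂.1) =
    delta α * (2 * g.u - g.a * star g.a - H.T g.v g.v) := by
  have e2 : H.skewAct g.expData.w₂.1 = H.skewAct (H.diag (delta α * (H.T g.v g.v - g.u))) := by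
    simp only [expData, Prod.fst_add, skewAct_add, diagPair, lmulPair, innPair, skewAct_lmul,
      skewAct_inn, add_zero]
  rw [e2, skewAct_diag]
  simp [star_u, star_T, star_delta]
  ring

theorem expData_τ_dl (hα : IsUnit (1 - 4 * α)) (z : QuadExt α × J) : g.expData.τ (H.dl z) =
    H.skew z g.expData.w₃ - H.skew g.expData.x z * H.skewAct g.expData.w₂.1 := by
  apply algebraMap_mul_delta_cancel hα
  have h1 := algebraMap_skew (H := H) z g.expData.w₃
  have h2 := algebraMap_skew (H := H) g.expData.x z
  rw [algebraMap_expData_τ, map_sub, map_mul, algebraMap_skewAct_w₂]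
  obtain ⟨m, w⟩ := z
  rw [dl_mk, theta_mk]
  simp only [expData_w₃, expData_x, a₃, v₃] at h1 h2 ⊢
  linear_combination (norm := skip) -h1 + delta α * (2 * g.u - g.a * star g.a - H.T g.v g.v) * h2
  simp [T_smul_right, H.T_smul_left, star_delta, star_u, star_T]
  ring

end G

end Operators

/-! ### Compatibility of exp_+(g) with L_0 -/

section Compatibility

variable {R : Type u} [CommRing R] {α : R} {J : Type v} [AddCommGroup J] [Module R J]
  [Module (QuadExt α) J] [IsScalarTower R (QuadExt α) J]

variable {H : HermitianCubicNormStructure α J}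

@[simp]
theorem D_zero_left (j w : J) : H.D 0 j w = 0 := by simp [D]

@[simp]
theorem D_zero_right (i w : J) : H.D i 0 w = 0 := by simp [D]

@[simp]
theorem D_zero (i j : J) : H.D i j 0 = 0 := by simp [D]

theorem T_sharp_self (v : J) : H.T (H.sharp.ground v) v = 3 * star (H.N.ground v) := by
  rw [← star_T, T_self_sharp]; simp

theorem T_D_sharp (i j v : J) :
    H.T (H.D i j v) (H.sharp.ground v) = -(H.N.ground v * H.T i j) := by
  rw [D, map_sub, LinearMap.sub_apply, H.T_smul_left, T_cross_left_rotate,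
    T_cross_left_rotate, sharp_cross_cross']
  simp [H.T_smul_left]
  ring

theorem T_sharp_D (i j v : J) :
    H.T (H.sharp.ground v) (H.D i j v) = -(star (H.N.ground v) * H.T j i) := by
  rw [← star_T, T_D_sharp]
  simp [star_T]

theorem T_D_sharp_right (i j v : J) :
    H.T v (H.D i j (H.sharp.ground v)) = -(H.N.ground v * H.T j i) := by
  rw [← T_D_left, T_D_sharp]

namespace ExpData

variable (E : H.ExpData)

/-- The difference whose vanishing up to a multiple of `δ` expresses compatibility with `1_{-1}`. -/
def defect (D : Module.End R (QuadExt α × J) × Module.End R (QuadExt α × J)) : QuadExt α × J :=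
  E.Q (D.2 (1, 0)) - D.1 (E.Q (1, 0)) - H.V E.x (1, 0) (D.1 E.x)

/-- A skew element of K is minus its real part times δ. Thus e₂ on L_0 is well chosen as soon as the
defect lies in K and is skew. -/
theorem algebraMap_q {D : Module.End R (QuadExt α × J) × Module.End R (QuadExt α × J)}
    {k : QuadExt α} (h : E.defect D = (k, 0)) (hk : star k = -k) :
    algebraMap R (QuadExt α) (E.q D) * delta α = -k := by
  rw [q_apply, ← defect, h, algebraMap_re_mul_delta hk]

theorem Q_snd_one {D : Module.End R (QuadExt α × J) × Module.End R (QuadExt α × J)}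
    {k : QuadExt α} (h : E.defect D = (k, 0)) (hk : star k = -k) :
    E.Q (D.2 (1, 0)) = D.1 (E.Q (1, 0)) + H.V E.x (1, 0) (D.1 E.x) - E.q D • H.dl (1, 0) := by
  have h1 := E.algebraMap_q h hk
  have h2 : E.q D • H.dl (1, 0) = -E.defect D := by
    rw [h, dl_mk, mul_one, smul_zero, Prod.smul_mk, smul_zero, Algebra.smul_def, h1]
    simp
  rw [h2, defect]
  abel

end ExpData

namespace G

variable (g : H.G)

/-- For each kind of generator of L_0 the J-component of the defect cancels, and the K-component
that is left turns out to be skew (`star_defect_diag`, `star_defect_lmul`, `star_defect_inn`). -/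
theorem defect_diag (c : QuadExt α) : g.expData.defect (H.diagPair c) =
    (star (g.u * c) - g.u * c + 2 * (g.a * star g.a) * (c - star c), 0) := by
  refine Prod.ext ?_ ?_
  · simp [ExpData.defect, diagPair, diag_mk, expData_x, V_mk, expData_Q_mk, star_u, T_smul_right]
    ring
  · simp [ExpData.defect, diagPair, diag_mk, expData_x, V_mk, expData_Q_mk, cross_self,
      H.cross_smul_right]
    module

theorem defect_lmul (j : J) : g.expData.defect (H.lmulPair j) =
    (g.a * H.T g.v j - star g.a * H.T j g.v + H.T j (H.sharp.ground g.v) -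
      H.T (H.sharp.ground g.v) j, 0) := by
  refine Prod.ext ?_ ?_
  · simp [ExpData.defect, lmulPair, lmul_mk, expData_x, V_mk, expData_Q_mk, T_smul_right]
    rw [H.cross_comm j, T_self_cross]
    ring
  · simp [ExpData.defect, lmulPair, lmul_mk, expData_x, V_mk, expData_Q_mk, star_u, star_T,
      H.cross_smul_right]
    rw [H.cross_comm _ g.v, H.cross_comm j, H.cross_comm j]
    module

theorem defect_inn (i j : J) : g.expData.defect (H.innPair i j) =
    (g.a * star g.a * (H.T j i - H.T i j) + H.T g.v (H.D i j g.v) - H.T g.v (H.D j i g.v), 0) := by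
  refine Prod.ext ?_ ?_
  · simp [ExpData.defect, innPair, inn_mk, expData_x, V_mk, expData_Q_mk, star_T]
    ring
  · simp [ExpData.defect, innPair, inn_mk, expData_x, V_mk, expData_Q_mk, star_T, D_add, D_smul,
      D_sharp_apply]
    module

theorem star_defect_diag (c : QuadExt α) :
    star (star (g.u * c) - g.u * c + 2 * (g.a * star g.a) * (c - star c)) =
      -(star (g.u * c) - g.u * c + 2 * (g.a * star g.a) * (c - star c)) := by
  simp
  ring

theorem star_defect_lmul (j : J) :
    star (g.a * H.T g.v j - star g.a * H.T j g.v + H.T j (H.sharp.ground g.v) -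
      H.T (H.sharp.ground g.v) j) = -(g.a * H.T g.v j - star g.a * H.T j g.v +
      H.T j (H.sharp.ground g.v) - H.T (H.sharp.ground g.v) j) := by
  simp [star_T]
  ring

theorem star_defect_inn (i j : J) :
    star (g.a * star g.a * (H.T j i - H.T i j) + H.T g.v (H.D i j g.v) -
      H.T g.v (H.D j i g.v)) = -(g.a * star g.a * (H.T j i - H.T i j) + H.T g.v (H.D i j g.v) -
      H.T g.v (H.D j i g.v)) := by
  simp [star_T, T_D_left]
  ring

theorem compat_diag (hα : IsUnit (1 - 4 * α)) (c : QuadExt α) :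
    g.expData.CompatOne (H.diagPair c) := by
  have hk := g.star_defect_diag c
  refine ⟨ExpData.Q_snd_one _ (g.defect_diag c) hk, algebraMap_mul_delta_cancel hα ?_⟩
  have hq := ExpData.algebraMap_q _ (g.defect_diag c) hk
  have h1 := g.algebraMap_expData_τ (1, 0)
  have h2 := g.algebraMap_expData_τ ((H.diagPair c).2 (1, 0))
  have h3 := algebraMap_skew (H := H) ((H.diagPair c).1 g.expData.x) (g.expData.Q (1, 0))
  have e1 : algebraMap R (QuadExt α) (H.skewAct (H.diagPair c).1) = -(c + star c) := by
    rw [diagPair, skewAct_diag]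
  simp only [map_sub, map_mul, e1, algebraMap_skew_dl]
  generalize g.expData.q (H.diagPair c) = q at *
  linear_combination (norm := skip) h2 + (c + star c) * h1 + h3 - (g.a + star g.a) * hq
  simp [diagPair, diag_mk, expData_x, expData_Q_mk, star_u, T_smul_right, H.T_smul_left, theta_mk,
    T_self_sharp, star_T, T_sharp_self]
  ring

theorem compat_lmul (hα : IsUnit (1 - 4 * α)) (j : J) :
    g.expData.CompatOne (H.lmulPair j) := by
  have hk := g.star_defect_lmul j
  refine ⟨ExpData.Q_snd_one _ (g.defect_lmul j) hk, algebraMap_mul_delta_cancel hα ?_⟩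
  have hq := ExpData.algebraMap_q _ (g.defect_lmul j) hk
  have h1 := g.algebraMap_expData_τ (1, 0)
  have h2 := g.algebraMap_expData_τ ((H.lmulPair j).2 (1, 0))
  have h3 := algebraMap_skew (H := H) ((H.lmulPair j).1 g.expData.x) (g.expData.Q (1, 0))
  have e1 : algebraMap R (QuadExt α) (H.skewAct (H.lmulPair j).1) = 0 := by
    rw [lmulPair, skewAct_lmul, map_zero]
  simp only [map_sub, map_mul, e1, algebraMap_skew_dl]
  linear_combination (norm := skip) h2 + h3 - (g.a + star g.a) * hq
  generalize g.expData.q (H.lmulPair j) = q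
  simp [lmulPair, lmul_mk, expData_x, expData_Q_mk, star_u, T_smul_right, H.T_smul_left, theta_mk,
    star_T]
  rw [H.cross_comm j, T_self_cross, T_cross_self_left, H.T_cross_rotate j,
    H.T_cross_left_rotate g.v (H.sharp.ground g.v) j, H.T_cross_left_rotate g.v j, H.cross_comm j,
    H.cross_comm j]
  ring

theorem compat_inn (hα : IsUnit (1 - 4 * α)) (i j : J) :
    g.expData.CompatOne (H.innPair i j) := by
  have hk := g.star_defect_inn i j
  refine ⟨ExpData.Q_snd_one _ (g.defect_inn i j) hk, algebraMap_mul_delta_cancel hα ?_⟩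
  have hq := ExpData.algebraMap_q _ (g.defect_inn i j) hk
  have h1 := g.algebraMap_expData_τ (1, 0)
  have h2 := g.algebraMap_expData_τ ((H.innPair i j).2 (1, 0))
  have h3 := algebraMap_skew (H := H) ((H.innPair i j).1 g.expData.x) (g.expData.Q (1, 0))
  have e1 : algebraMap R (QuadExt α) (H.skewAct (H.innPair i j).1) = 0 := by
    rw [innPair, skewAct_inn, map_zero]
  simp only [map_sub, map_mul, e1, algebraMap_skew_dl]
  linear_combination (norm := skip) h2 + h3 - (g.a + star g.a) * hq
  generalize g.expData.q (H.innPair i j) = q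
  simp [innPair, inn_mk, expData_x, expData_Q_mk, star_u, T_smul_right, H.T_smul_left, theta_mk,
    star_T, T_D_left, T_D_sharp_right, T_sharp_D, D_add, D_smul]
  ring

theorem q_vPair (hα : IsUnit (1 - 4 * α)) (z p : QuadExt α × J) : g.expData.q (H.vPair z p) =
    H.skew z (g.expData.Q p) - H.skew g.expData.x z * H.skew g.expData.x (H.dl p) := by
  apply algebraMap_mul_delta_cancel hα
  have h1 := algebraMap_skew (H := H) z (g.expData.Q p)
  have h2 := algebraMap_skew (H := H) g.expData.x z
  rw [map_sub, map_mul, algebraMap_skew_dl]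
  obtain ⟨k, i⟩ := z
  obtain ⟨l, j⟩ := p
  have e1 := ExpData.algebraMap_q _ (g.defect_diag (k * star l + H.T j i)) (g.star_defect_diag _)
  have e2 := ExpData.algebraMap_q _ (g.defect_lmul (k • j + l • i + H.cross i j))
    (g.star_defect_lmul _)
  have e3 := ExpData.algebraMap_q _ (g.defect_inn i j) (g.star_defect_inn _ _)
  rw [vPair_eq, map_sub, map_sub, map_sub, map_sub, sub_mul, sub_mul, sub_mul, e1, e2, e3, h1]
  simp only [expData_x] at h2 ⊢
  linear_combination (norm := skip) -(g.a * star l + H.T g.v j + star g.a * l + H.T j g.v) * h2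
  generalize H.skew (g.a, g.v) (k, i) = q
  simp [expData_Q_mk, star_u, T_smul_right, H.T_smul_left, star_T, D]
  have f2 : H.T (H.cross i j) g.v = H.T (H.cross g.v j) i := by
    rw [H.T_cross_left_rotate, H.cross_comm]
  have f4 : H.T (H.cross i j) (H.sharp.ground g.v) = H.T (H.cross (H.sharp.ground g.v) j) i := by
    rw [H.T_cross_left_rotate, H.cross_comm]
  have f5 : H.T g.v (H.cross (H.cross g.v j) i) = H.T i (H.cross (H.cross g.v j) g.v) := by
    rw [H.T_cross_rotate, H.cross_comm g.v]
  have f6 : H.T g.v (H.cross (H.cross g.v i) j) = H.T (H.cross (H.cross g.v j) g.v) i := by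
    rw [H.T_cross_left_comm, H.T_cross_left_rotate, H.T_cross_left_rotate]
  linear_combination g.a * H.T_cross_left_comm g.v i j - star g.a * f2 -
    H.T_cross_left_comm (H.sharp.ground g.v) i j + f4 + f5 - f6

end G

end Compatibility

/-! ### The remaining conditions for exp_+(g) -/

section Automorphism

variable {R : Type u} [CommRing R] {α : R} {J : Type v} [AddCommGroup J] [Module R J]
  [Module (QuadExt α) J] [IsScalarTower R (QuadExt α) J]

variable {H : HermitianCubicNormStructure α J}

theorem cross_self_cross_sharp (v : J) : H.cross v (H.cross v (H.sharp.ground v)) =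
    star (H.N.ground v) • v + H.T v v • H.sharp.ground v := by
  rw [← cross_cross_sharp, H.cross_comm v, H.cross_comm v]

theorem cross_self_sharp_cross (v w : J) : H.cross v (H.cross (H.sharp.ground v) w) =
    star (H.N.ground v) • w + H.T w v • H.sharp.ground v := by
  rw [← cross_cross_sharp, H.cross_comm v]

theorem cross_self_cross_cross (v w : J) : H.cross v (H.cross v (H.cross v w)) =
    H.T (H.sharp.ground v) w • v + H.T v w • H.sharp.ground v + H.T v v • H.cross v w -
      H.cross (H.cross v (H.sharp.ground v)) w := by
  have h := H.cross_cross_sharp_linear v v w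
  rw [H.cross_comm _ v, H.cross_comm _ v, H.cross_comm _ v] at h
  linear_combination (norm := module) h

theorem T_cross_sharp (v w : J) : H.T (H.cross v w) (H.sharp.ground v) =
    H.T (H.cross v (H.sharp.ground v)) w := by
  rw [H.T_cross_left_rotate, H.T_cross_left_rotate, H.cross_comm v]

theorem T_sharp_cross (v w : J) : H.T (H.sharp.ground v) (H.cross v w) =
    H.T w (H.cross v (H.sharp.ground v)) := by
  rw [H.T_cross_rotate, H.cross_comm v]

theorem T_sharp_cross_left (v w : J) : H.T (H.cross (H.sharp.ground v) w) v =
    H.T (H.cross v (H.sharp.ground v)) w := by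
  rw [H.T_cross_left_rotate, H.T_cross_left_rotate]

theorem T_sharp_cross_right (v w : J) : H.T v (H.cross (H.sharp.ground v) w) =
    H.T w (H.cross v (H.sharp.ground v)) := H.T_cross_rotate _ _ _

theorem T_cross_cross_self_sharp (v w : J) :
    H.T (H.cross v w) (H.cross v (H.sharp.ground v)) =
      star (H.N.ground v) * H.T v w + H.T (H.sharp.ground v) w * H.T v v := by
  rw [T_cross_cross, sharp_cross_cross', map_add, T_smul_right, T_smul_right, star_T]

theorem T_cross_self_sharp_cross (v w : J) :
    H.T (H.cross v (H.sharp.ground v)) (H.cross v w) =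
      H.N.ground v * H.T w v + H.T w (H.sharp.ground v) * H.T v v := by
  rw [← star_T, T_cross_cross_self_sharp]
  simp [star_T]

theorem T_sharp_cross_sharp (v w : J) : H.T (H.cross (H.sharp.ground v) w) (H.sharp.ground v) =
    2 * (H.N.ground v * H.T v w) := by
  rw [H.T_cross_self_left, ground_sharp_sharp, H.T_smul_left]

theorem T_cross_sharp_sharp (v : J) : H.T (H.cross v (H.sharp.ground v)) (H.sharp.ground v) =
    2 * (H.N.ground v * H.T v v) := by
  rw [H.cross_comm, T_sharp_cross_sharp]

theorem T_sharp_cross_self (v : J) : H.T (H.sharp.ground v) (H.cross v (H.sharp.ground v)) =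
    2 * (star (H.N.ground v) * H.T v v) := by
  rw [← star_T, T_cross_sharp_sharp]
  simp [star_T]

variable (H) in
theorem diagPair_add (c d : QuadExt α) : H.diagPair (c + d) = H.diagPair c + H.diagPair d := by
  simp [diagPair, diag_add]
  abel

variable (H) in
theorem diagPair_neg (c : QuadExt α) : H.diagPair (-c) = -H.diagPair c := by
  rw [eq_neg_iff_add_eq_zero, ← diagPair_add, neg_add_cancel, diagPair_zero]

theorem diagPair_sub (c d : QuadExt α) : H.diagPair (c - d) = H.diagPair c - H.diagPair d := by
  rw [eq_sub_iff_add_eq, ← diagPair_add, sub_add_cancel]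

variable (H) in
theorem lmulPair_add (i j : J) : H.lmulPair (i + j) = H.lmulPair i + H.lmulPair j := by
  simp [lmulPair, lmul_add]
  abel

variable (H) in
theorem lmulPair_sub (i j : J) : H.lmulPair (i - j) = H.lmulPair i - H.lmulPair j := by
  rw [eq_sub_iff_add_eq, ← lmulPair_add, sub_add_cancel]

variable (H) in
theorem smul_diagPair (r : R) (c : QuadExt α) :
    r • H.diagPair c = H.diagPair (algebraMap R (QuadExt α) r * c) := by
  rw [← vPair_diag, ← vPair_diag, ← vPair_smul_left, Prod.smul_mk, smul_zero, Algebra.smul_def]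

variable (H) in
theorem smul_lmulPair (r : R) (j : J) :
    r • H.lmulPair j = H.lmulPair (algebraMap R (QuadExt α) r • j) := by
  refine Prod.ext (LinearMap.ext fun ⟨m, w⟩ => ?_) (LinearMap.ext fun ⟨m, w⟩ => ?_) <;>
  · simp only [lmulPair, algebraMap_smul, Prod.smul_mk, LinearMap.smul_apply,
      LinearMap.neg_apply, lmul_mk, map_smul, smul_neg, smul_add, smul_comm r]

variable (H) in
theorem innPair_comm (i j : J) : H.innPair i j = -H.innPair j i := by
  rw [innPair, innPair, inn_comm]
  rfl

variable (H) in
theorem innPair_add_left (i i' j : J) : H.innPair (i + i') j = H.innPair i j + H.innPair i' j := by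
  simp [innPair, inn_add_left]

variable (H) in
theorem innPair_add_right (i j j' : J) :
    H.innPair i (j + j') = H.innPair i j + H.innPair i j' := by
  simp [innPair, inn_add_right]

variable (H) in
theorem innPair_neg_left (i j : J) : H.innPair (-i) j = -H.innPair i j := by
  rw [eq_neg_iff_add_eq_zero, ← innPair_add_left, neg_add_cancel, innPair_comm, innPair_zero_right,
    neg_zero]

variable (H) in
theorem innPair_neg_right (i j : J) : H.innPair i (-j) = -H.innPair i j := by
  rw [eq_neg_iff_add_eq_zero, ← innPair_add_right, neg_add_cancel, innPair_zero_right]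

variable (H) in
theorem innPair_sub_left (i i' j : J) : H.innPair (i - i') j = H.innPair i j - H.innPair i' j := by
  rw [eq_sub_iff_add_eq, ← innPair_add_left, sub_add_cancel]

variable (H) in
theorem innPair_sub_right (i j j' : J) :
    H.innPair i (j - j') = H.innPair i j - H.innPair i j' := by
  rw [eq_sub_iff_add_eq, ← innPair_add_right, sub_add_cancel]

variable (H) in
theorem innPair_smul_left (k : QuadExt α) (i j : J) :
    H.innPair (k • i) j = H.innPair i (star k • j) := by
  simp [innPair, inn_smul_left]

variable (H) in
theorem smul_innPair (r : R) (i j : J) :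
    r • H.innPair i j = H.innPair i (algebraMap R (QuadExt α) r • j) := by
  rw [innPair_eq, innPair_eq, ← smul_lmulPair, mul_smul_comm, smul_mul_assoc]
  exact smul_sub r _ _

theorem innPair_self (j : J) : H.innPair j j = 0 := by
  rw [innPair_eq, sub_self]

theorem innPair_sharp (v : J) (c : QuadExt α) : H.innPair v (c • H.sharp.ground v) =
    H.diagPair (c * star (H.N.ground v) - star c * H.N.ground v) := by
  have e : star (c * star (H.N.ground v) - star c * H.N.ground v) =
    -(c * star (H.N.ground v) - star c * H.N.ground v) := by simp
  have e2 (x : QuadExt α) : H.diag (-x) = -H.diag x := by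
    rw [eq_neg_iff_add_eq_zero, ← diag_add, neg_add_cancel, diag_zero]
  rw [innPair, inn_sharp, diagPair, e, e2, neg_neg]

theorem innPair_sharp_linear (v w : J) :
    H.innPair w (H.sharp.ground v) + H.innPair v (H.cross v w) =
      H.diagPair (H.T (H.sharp.ground v) w - H.T w (H.sharp.ground v)) := by
  have e : star (H.T (H.sharp.ground v) w - H.T w (H.sharp.ground v)) =
    -(H.T (H.sharp.ground v) w - H.T w (H.sharp.ground v)) := by simp [star_T]
  have e2 (x : QuadExt α) : H.diag (-x) = -H.diag x := by
    rw [eq_neg_iff_add_eq_zero, ← diag_add, neg_add_cancel, diag_zero]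
  rw [diagPair, e, e2, neg_neg, ← inn_sharp_linear]
  rfl

/-- Comparison of normal forms in L_0 up to a transfer: e is the part of the sum of commutators that
is in fact diagonal. -/
theorem normalForm_ext {c₁ c₂ c₃ c₄ c e : QuadExt α} {m₁ m₂ m₃ m₄ m : J}
    {I₁ I₂ I₃ I₄ I : Module.End R (QuadExt α × J) × Module.End R (QuadExt α × J)}
    (hI : I₁ + I₂ + I₃ - I₄ = H.diagPair e - I) (hc : c₁ + c₂ + c₃ - c₄ = c + e)
    (hm : m₁ + m₂ + m₃ - m₄ = -m) :
    H.diagPair c₁ - H.lmulPair m₁ - I₁ + (H.diagPair c₂ - H.lmulPair m₂ - I₂) +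
      (H.diagPair c₃ - H.lmulPair m₃ - I₃) - (H.diagPair c₄ - H.lmulPair m₄ - I₄) =
      H.diagPair c + H.lmulPair m + I := by
  replace hc := congrArg H.diagPair hc
  have hm : H.lmulPair (m₁ + m₂ + m₃ - m₄ + m) = 0 := by rw [hm, neg_add_cancel, lmulPair_zero]
  simp only [diagPair_add, diagPair_sub, lmulPair_add, lmulPair_sub] at hc hm
  linear_combination (norm := module) hc - hm - hI

/-- Modulo R, b̄ equals b.im · t̄, and R-multiples of v do not contribute because inn(v, v) = 0. -/
theorem innPair_star_smul_self (b : QuadExt α) (v : J) :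
    H.innPair v (star b • v) = b.im • H.innPair (tEl α • v) v := by
  have e : star b = algebraMap R (QuadExt α) b.re + algebraMap R (QuadExt α) b.im *
      star (tEl α) := by
    ext <;> simp
  rw [e, add_smul, mul_smul, innPair_add_right, ← smul_innPair, ← smul_innPair, innPair_self,
    innPair_smul_left]
  simp

namespace G

variable (g : H.G)

theorem smul_mk_eq (r : R) (k : QuadExt α) (i : J) : r • (k, i) =
    (algebraMap R (QuadExt α) r * k, algebraMap R (QuadExt α) r • i) := by
  rw [Prod.smul_mk, algebraMap_smul, Algebra.smul_def]

theorem sigma_neg (k : QuadExt α) : g.expData.w₂.2 (k, 0) -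
    (H.vPair g.expData.x (k, 0)).2 (H.dl g.expData.x) - H.dl (g.expData.Q (k, 0)) = 0 := by
  simp only [vPair, expData_x, dl_mk, w₂_snd_mk, expData_Q_mk, LinearMap.neg_apply, V_mk]
  refine Prod.ext ?_ ?_
  · simp [T_smul_right, H.T_smul_left, star_delta]
    ring
  · simp [H.cross_smul_left, H.cross_smul_right, star_delta, cross_self]
    module

/-- With k = 1 the K-component leaves no choice for the σ_2-coefficient: it has to be ν(g). -/
theorem sigma_one (k : QuadExt α) : g.expData.w₂.1 (g.expData.Q (k, 0)) -
    H.V g.expData.x (k, 0) g.expData.w₃ + (g.expData.τ (k, 0) * (1 - 4 * α)) • g.expData.x -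
    g.expData.w₄ • H.dl (k, 0) = 0 := by
  have e : (g.expData.τ (k, 0) * (1 - 4 * α)) • g.expData.x =
      ((g.theta (k, 0) - star (g.theta (k, 0))) * delta α) • g.expData.x := by
    rw [← algebraMap_expData_τ, mul_assoc, delta_sq, ← map_mul, algebraMap_smul]
  have e2 : g.expData.w₄ • H.dl (k, 0) = (g.nuK * (delta α * k), 0) := by
    rw [dl_mk, smul_mk_eq, show g.expData.w₄ = g.nu from rfl, g.algebraMap_nu]; simp
  rw [e, e2]
  simp only [expData_x, expData_w₃, w₂_fst_mk, expData_Q_mk, V_mk, theta_mk, nuK, a₃, v₃]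
  have hc (w : J) : H.cross (H.cross g.v w) g.v = H.cross g.v (H.cross g.v w) := H.cross_comm _ _
  have hs : H.cross (H.sharp.ground g.v) g.v = H.cross g.v (H.sharp.ground g.v) := H.cross_comm _ _
  refine Prod.ext ?_ ?_
  · simp [T_smul_right, H.T_smul_left, star_T, star_delta, star_u, T_self_sharp, T_sharp_self,
      T_self_cross]
    ring
  · simp [H.cross_smul_left, H.cross_smul_right, star_T, star_delta, star_u, cross_self, D,
      cross_self_cross_sharp, ground_sharp_sharp, T_self_sharp, T_sharp_self, T_smul_right,
      H.T_smul_left, hc, hs]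
    module

theorem sigma_two (hα : IsUnit (1 - 4 * α)) (k : QuadExt α) :
    H.skew g.expData.w₃ (g.expData.Q (k, 0)) +
    g.expData.τ (k, 0) * H.skewAct g.expData.w₂.1 -
    g.expData.w₄ * H.skew g.expData.x (H.dl (k, 0)) = 0 := by
  have e1 := algebraMap_skew (H := H) g.expData.w₃ (g.expData.Q (k, 0))
  have e2 := g.algebraMap_expData_τ (k, 0)
  apply algebraMap_mul_delta_cancel hα
  rw [map_sub, map_add, map_mul, map_mul, algebraMap_skew_dl, algebraMap_skewAct_w₂,
    show g.expData.w₄ = g.nu from rfl, g.algebraMap_nu]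
  have hc (w : J) : H.cross (H.cross g.v w) g.v = H.cross g.v (H.cross g.v w) := H.cross_comm _ _
  have hs : H.cross (H.sharp.ground g.v) g.v = H.cross g.v (H.sharp.ground g.v) := H.cross_comm _ _
  generalize g.expData.τ (k, 0) = τ₁ at *
  rw [show g.expData.w₃ = (delta α * g.a₃, delta α • g.v₃) from rfl, g.expData_Q_mk] at *
  generalize H.skew _ _ = τ₂ at *
  linear_combination (norm := skip) e1 +
    delta α * (2 * g.u - g.a * star g.a - H.T g.v g.v) * e2
  simp only [expData_x, theta_mk, a₃, v₃, nuK]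
  simp [T_smul_right, H.T_smul_left, star_T, star_delta, star_u, T_self_sharp, T_sharp_self,
    T_self_cross, T_cross_self_left, T_cross_sharp_sharp, T_sharp_cross_self]
  ring

theorem one_one (y : QuadExt α × J) : H.V g.expData.x (1, 0) (g.expData.Q y) -
    H.V g.expData.x y (g.expData.Q (1, 0)) + g.expData.τ y • H.dl (1, 0) -
    g.expData.τ (1, 0) • H.dl y = H.skew (1, 0) y • g.expData.w₃ := by
  have e1 : g.expData.τ y • H.dl (1, 0) = (g.theta y - star (g.theta y), 0) := by
    rw [dl_mk, smul_mk_eq, mul_one, algebraMap_expData_τ, smul_zero, smul_zero]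
  have e2 := algebraMap_skew (H := H) (1, 0) y
  obtain ⟨b, w⟩ := y
  have e3 : g.expData.τ (1, 0) • H.dl (b, w) = ((g.theta (1, 0) - star (g.theta (1, 0))) * b,
      (g.theta (1, 0) - star (g.theta (1, 0))) • w) := by
    rw [← algebraMap_expData_τ, dl_mk, smul_mk_eq, mul_assoc, mul_smul]
  have e4 : H.skew (1, 0) (b, w) • g.expData.w₃ = ((star b - b) * g.a₃, (star b - b) • g.v₃) := by
    rw [expData_w₃, smul_mk_eq, ← mul_assoc, ← mul_smul, e2]; simp
  rw [e1, e3, e4]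
  simp only [expData_x, expData_Q_mk, V_mk, theta_mk, a₃, v₃]
  have hc (w : J) : H.cross (H.cross g.v w) g.v = H.cross g.v (H.cross g.v w) := H.cross_comm _ _
  have hs : H.cross (H.sharp.ground g.v) g.v = H.cross g.v (H.sharp.ground g.v) := H.cross_comm _ _
  have he (w : J) : H.cross (H.cross g.v w) (H.sharp.ground g.v) =
      H.N.ground g.v • w + H.T w (H.sharp.ground g.v) • g.v := by
    rw [H.cross_comm, sharp_cross_cross']
  have hd (w : J) : H.cross (H.cross (H.sharp.ground g.v) w) g.v =
      H.cross g.v (H.cross (H.sharp.ground g.v) w) := H.cross_comm _ _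
  refine Prod.ext ?_ ?_
  · simp [T_smul_right, H.T_smul_left, star_T, star_u, T_self_sharp, T_self_cross,
      T_cross_self_left, T_cross_sharp, T_sharp_cross_right, hc]
    ring
  · simp [H.cross_smul_left, H.cross_smul_right, star_T, star_u, cross_self, D,
      cross_self_sharp_cross, cross_self_cross_cross, T_self_sharp, T_sharp_self, T_smul_right,
      H.T_smul_left, hc, hs, hd, he, H.cross_comm w g.v, H.cross_comm w (H.sharp.ground g.v)]
    module

theorem one_two (hα : IsUnit (1 - 4 * α)) (y : QuadExt α × J) :
    H.skew (g.expData.Q (1, 0)) (g.expData.Q y) +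
    g.expData.τ y * H.skew g.expData.x (H.dl (1, 0)) -
    g.expData.τ (1, 0) * H.skew g.expData.x (H.dl y) = H.skew (1, 0) y * g.expData.w₄ := by
  have e1 := algebraMap_skew (H := H) (1, 0) y
  have e2 := g.algebraMap_expData_τ y
  have e3 := g.algebraMap_expData_τ (1, 0)
  have e4 := algebraMap_skew (H := H) (g.expData.Q (1, 0)) (g.expData.Q y)
  apply algebraMap_mul_delta_cancel hα
  rw [map_sub, map_add, map_mul, map_mul, map_mul, algebraMap_skew_dl, algebraMap_skew_dl,
    show g.expData.w₄ = g.nu from rfl, g.algebraMap_nu]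
  obtain ⟨b, w⟩ := y
  linear_combination (norm := skip) e4 - (g.a + star g.a) * e2 +
    (g.a * star b + H.T g.v w + star g.a * b + H.T w g.v) * e3 - g.nuK * e1
  simp only [expData_x, expData_Q_mk, theta_mk, nuK]
  have hc (w : J) : H.cross (H.cross g.v w) g.v = H.cross g.v (H.cross g.v w) := H.cross_comm _ _
  have hs : H.cross (H.sharp.ground g.v) g.v = H.cross g.v (H.sharp.ground g.v) := H.cross_comm _ _
  generalize g.expData.τ (b, w) = τ₁
  generalize g.expData.τ (1, 0) = τ₂
  generalize H.skew (1, 0) (b, w) = τ₃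
  simp [ground_sharp_sharp, T_cross_cross_self_sharp, T_cross_self_sharp_cross, T_smul_right,
    H.T_smul_left, star_T, star_u, T_self_sharp, T_sharp_self, T_self_cross, T_cross_self_left,
    T_cross_sharp, T_sharp_cross, T_sharp_cross_left, T_sharp_cross_right, hc]
  ring

theorem one_zero (y : QuadExt α × J) :
    H.vPair g.expData.x (1, 0) * H.vPair g.expData.x y -
      H.vPair g.expData.x y * H.vPair g.expData.x (1, 0) +
      H.vPair (g.expData.Q (1, 0)) y - H.vPair (g.expData.Q y) (1, 0) =
      H.skew (1, 0) y • g.expData.w₂ := by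
  have e2 := algebraMap_skew (H := H) (1, 0) y
  have e3 : H.skew (1, 0) y = -y.1.im := by
    obtain ⟨b, w⟩ := y
    simp [skew_mk]
  rw [(IsInner.vPair g.expData.x (1, 0)).commutator_vPair]
  obtain ⟨b, w⟩ := y
  have h1 (X Y Z : QuadExt α × J) : (H.vPair X Y).1 Z = H.V X Y Z := rfl
  have h2 (X Y Z : QuadExt α × J) : (H.vPair X Y).2 Z = -H.V Y X Z := rfl
  have h3 (r : R) : r • g.expData.w₂ = H.diagPair (algebraMap R (QuadExt α) r * delta α *
      (H.T g.v g.v - g.u)) + H.lmulPair ((algebraMap R (QuadExt α) r * delta α) •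
      (H.sharp.ground g.v - g.a • g.v)) + r • H.innPair (tEl α • g.v) g.v := by
    rw [mul_assoc, mul_smul, ← smul_diagPair, ← smul_lmulPair, ← smul_add, ← smul_add]
    rfl
  rw [h3, e2, h1, h2, expData_x, expData_Q_mk, expData_Q_mk, V_mk, V_mk, Prod.neg_mk, vPair_eq,
    vPair_eq, vPair_eq, vPair_eq]
  have f1 := innPair_sharp_linear (H := H) g.v w
  have f2 := innPair_star_smul_self (H := H) b g.v
  -- The diagonal operator hidden in inn(w, v^♯) + inn(v, v × w), by `innPair_sharp_linear`.
  refine normalForm_ext (e := H.T (H.sharp.ground g.v) w - H.T w (H.sharp.ground g.v)) ?_ ?_ ?_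
  · rw [e3, ← f1, pair_neg_smul, ← f2]
    have f3 := H.innPair_comm w (H.sharp.ground g.v)
    have f4 := H.innPair_smul_left (star g.a) g.v w
    have f5 := H.innPair_smul_left g.a g.v w
    rw [star_star] at f4
    simp [innPair_add_left, innPair_sub_left, innPair_sub_right, innPair_neg_left,
      innPair_neg_right, cross_self, two_smul, f4]
    linear_combination (norm := module) -f3
  · simp [T_smul_right, H.T_smul_left, star_T, T_cross_self_left]
    ring
  · have hc : H.cross (H.cross g.v w) g.v = H.cross g.v (H.cross g.v w) := H.cross_comm _ _
    simp [H.cross_smul_left, H.cross_smul_right, star_T, star_u, cross_self, hc]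
    module

theorem sigma_zero (k : QuadExt α) : g.expData.w₂ * H.vPair g.expData.x (k, 0) -
    H.vPair g.expData.x (k, 0) * g.expData.w₂ +
    H.vPair g.expData.w₃ (k, 0) - H.vPair (g.expData.Q (k, 0)) (H.dl g.expData.x) -
      (g.expData.τ (k, 0) * (1 - 4 * α)) • H.gradPair = 0 := by
  have e : (g.expData.τ (k, 0) * (1 - 4 * α)) • H.gradPair =
      -H.diagPair ((g.theta (k, 0) - star (g.theta (k, 0))) * delta α) := by
    rw [← algebraMap_expData_τ, mul_assoc, delta_sq, ← map_mul, diagPair_algebraMap, neg_neg]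
  rw [e, (IsInner.of_mem g.expData.w₂_mem).commutator_vPair]
  rw [expData_x, expData_Q_mk, w₂_fst_mk, w₂_snd_mk, dl_mk, expData_w₃, vPair_eq, vPair_eq,
    vPair_eq, vPair_eq, sub_neg_eq_add]
  have f1 := innPair_sharp (H := H) g.v (delta α * star k)
  have hs : H.cross (H.sharp.ground g.v) g.v = H.cross g.v (H.sharp.ground g.v) := H.cross_comm _ _
  set ε := (g.theta (k, 0) - star (g.theta (k, 0))) * delta α with he
  suffices h : ∀ X : Module.End R (QuadExt α × J) × Module.End R (QuadExt α × J),
      X = H.diagPair (-ε) + H.lmulPair 0 + 0 → X + H.diagPair ε = 0 by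
    -- The commutators add up to -2 inn(v, δk̄ v^♯), which is diagonal by `innPair_sharp`.
    refine h _ (normalForm_ext (e := -2 * (delta α * star k * star (H.N.ground g.v) -
      star (delta α * star k) * H.N.ground g.v)) ?_ ?_ ?_)
    · simp [innPair_add_left, innPair_sub_right, smul_sub]
      have f4 := H.innPair_comm (star k • H.sharp.ground g.v) (delta α • g.v)
      rw [f4]
      simp only [innPair_smul_left, star_mul', star_delta, star_star, smul_smul, neg_mul, neg_smul,
        innPair_neg_right] at f1 ⊢
      rw [show delta α * (star k * g.a) = g.a * star k * delta α by ring, f1]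
      have f5 : -(2 * (delta α * star k * star (H.N.ground g.v) + delta α * k * H.N.ground g.v)) =
          -((delta α * star k * star (H.N.ground g.v) - -(delta α * k * H.N.ground g.v)) +
          (delta α * star k * star (H.N.ground g.v) - -(delta α * k * H.N.ground g.v))) := by ring
      rw [f5, diagPair_neg, diagPair_add]
      abel
    · rw [he]
      simp [T_smul_right, H.T_smul_left, star_T, star_u, T_self_sharp, T_sharp_self, star_delta,
        theta_mk, a₃, v₃]
      ring
    · simp [H.cross_smul_left, H.cross_smul_right, star_T, star_u, cross_self, star_delta, a₃,
        v₃, D, hs]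
      module
  rintro X rfl
  rw [lmulPair_zero, add_zero, add_zero, ← diagPair_add, neg_add_cancel, diagPair_zero]

theorem isExp (hα : IsUnit (1 - 4 * α)) : g.expData.IsExp where
  q_vPair := g.q_vPair hα
  Q_dl := g.expData_Q_dl
  τ_dl := g.expData_τ_dl hα
  compat_diag := g.compat_diag hα
  compat_lmul := g.compat_lmul hα
  compat_inn := g.compat_inn hα
  one_zero := g.one_zero
  one_one := g.one_one
  one_two := g.one_two hα
  sigma_neg := g.sigma_neg
  sigma_zero := g.sigma_zero
  sigma_one := g.sigma_one
  sigma_two := g.sigma_two hα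

theorem isExpPos_expData (hα : IsUnit (1 - 4 * α)) : H.IsExpPos g g.expData.equiv :=
  (g.isExp hα).isExpPos rfl (fun _ => rfl) (fun _ => rfl)

end G

end Automorphism

/-! ### Automorphisms that exchange L_{-2} and L_2 -/

section GradingReversal

variable {R : Type u} [CommRing R] {α : R} {J : Type v} [AddCommGroup J] [Module R J]
  [Module (QuadExt α) J] [IsScalarTower R (QuadExt α) J]
  {H : HermitianCubicNormStructure α J}

theorem IsLieAut.map_lie {φ : H.lie ≃ₗ[R] H.lie} (h : H.IsLieAut φ) (a b : H.lie) :
    φ ⁅a, b⁆ = ⁅φ a, φ b⁆ :=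
  (isLieAut_iff φ).1 h a b

theorem IsLieAut.trans {φ ψ : H.lie ≃ₗ[R] H.lie} (h : H.IsLieAut φ) (h' : H.IsLieAut ψ) :
    H.IsLieAut (φ.trans ψ) :=
  (isLieAut_iff _).2 fun a b => by simp [h.map_lie, h'.map_lie]

theorem IsLieAut.symm {φ : H.lie ≃ₗ[R] H.lie} (h : H.IsLieAut φ) : H.IsLieAut φ.symm :=
  (isLieAut_iff _).2 fun a b => by
    rw [LinearEquiv.symm_apply_eq, h.map_lie, φ.apply_symm_apply, φ.apply_symm_apply]

theorem coe_reversal (a : H.lie) : (H.reversal a : H.Ambient) = rev a := rfl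

theorem isLieAut_reversal : H.IsLieAut H.reversal :=
  (isLieAut_iff _).2 fun a b => Subtype.ext (by
    rw [coe_lie, coe_reversal, coe_reversal, coe_reversal, coe_lie, bracket_rev])

theorem reversal_neg2 (r : R) : H.reversal (H.neg2 r) = H.pos2 r := rfl

theorem reversal_pos2 (r : R) : H.reversal (H.pos2 r) = H.neg2 r := rfl

theorem smul_neg2 (r s : R) : r • H.neg2 s = H.neg2 (r * s) :=
  Subtype.ext (by simp [neg2])

theorem smul_pos2 (r s : R) : r • H.pos2 s = H.pos2 (r * s) :=
  Subtype.ext (by simp [pos2])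

theorem neg2_eq_smul_lie (r : R) :
    H.neg2 r = r • ⁅H.neg1 (tEl α, 0), H.neg1 (1, 0)⁆ := by
  rw [ExpData.lie_neg1_neg1, ExpData.skew_tEl_one, smul_neg2, mul_one]

theorem pos2_eq_smul_lie (r : R) :
    H.pos2 r = r • ⁅H.pos1 (tEl α, 0), H.pos1 (1, 0)⁆ := by
  rw [ExpData.lie_pos1_pos1, ExpData.skew_tEl_one, smul_pos2, mul_one]

/-- `L_0` is spanned by the brackets `[x_1, y_{-1}]`. -/
theorem zeroPart_induction {p : H.lie → Prop}
    (lie : ∀ x y, p ⁅H.pos1 x, H.neg1 y⁆) (zero : p 0) (add : ∀ a b, p a → p b → p (a + b))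
    (smul : ∀ (r : R) a, p a → p (r • a))
    (D : Module.End R (QuadExt α × J) × Module.End R (QuadExt α × J)) (hD : D ∈ H.instr) :
    p (zeroPart D hD) := by
  induction hD using Submodule.span_induction with
  | mem D h =>
    obtain ⟨x, y, rfl⟩ := h
    exact ExpData.lie_neg1_pos1 (H := H) x y ▸ lie x y
  | zero => exact zero
  | add D D' hD hD' h h' =>
    have := add _ _ h h'
    rwa [show zeroPart D hD + zeroPart D' hD' = zeroPart (D + D') (H.instr.add_mem hD hD') from
      Subtype.ext (by simp [zeroPart])] at this
  | smul r D hD h =>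
    have := smul r _ h
    rwa [show r • zeroPart D hD = zeroPart (r • D) (H.instr.smul_mem r hD) from
      Subtype.ext (by simp [zeroPart])] at this

/-- An automorphism of `L` is determined by its restriction to `L_{-1} ⊕ L_1`. -/
theorem IsLieAut.ext {φ ψ : H.lie ≃ₗ[R] H.lie} (h : H.IsLieAut φ) (h' : H.IsLieAut ψ)
    (hn : ∀ y, φ (H.neg1 y) = ψ (H.neg1 y)) (hp : ∀ y, φ (H.pos1 y) = ψ (H.pos1 y)) : φ = ψ := by
  refine LinearEquiv.ext fun a => ?_
  rw [lie_eq_sum a]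
  simp only [map_add, neg2_eq_smul_lie, pos2_eq_smul_lie, map_smul, h.map_lie, h'.map_lie, hn, hp]
  congr 3
  refine zeroPart_induction (p := fun a => φ a = ψ a) (fun x y => ?_) ?_ (fun a b ha hb => ?_)
    (fun r a ha => ?_) _ a.2
  · rw [h.map_lie, h'.map_lie, hn, hp]
  · rw [map_zero, map_zero]
  · rw [map_add, map_add, ha, hb]
  · rw [map_smul, map_smul, ha]

/-! ### Reversing the grading -/

theorem mem_grade_neg_two {a : H.lie} : a ∈ H.grade (-2) ↔ ∃ r, a = H.neg2 r := by
  refine ⟨fun ⟨_, h1, h2, h3, h4⟩ => ⟨a.1.1, ?_⟩, ?_⟩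
  · refine Subtype.ext (Prod.ext rfl (Prod.ext (h1 ?_) (Prod.ext (h2 ?_)
      (Prod.ext (h3 ?_) (h4 ?_))))) <;> decide
  · rintro ⟨r, rfl⟩
    exact ⟨fun h => (h rfl).elim, fun _ => rfl, fun _ => rfl, fun _ => rfl, fun _ => rfl⟩

theorem mem_grade_neg_one {a : H.lie} : a ∈ H.grade (-1) ↔ ∃ y, a = H.neg1 y := by
  refine ⟨fun ⟨h0, _, h2, h3, h4⟩ => ⟨a.1.2.1, ?_⟩, ?_⟩
  · refine Subtype.ext (Prod.ext (h0 ?_) (Prod.ext rfl (Prod.ext (h2 ?_)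
      (Prod.ext (h3 ?_) (h4 ?_))))) <;> decide
  · rintro ⟨r, rfl⟩
    exact ⟨fun _ => rfl, fun h => (h rfl).elim, fun _ => rfl, fun _ => rfl, fun _ => rfl⟩

theorem mem_grade_zero {a : H.lie} : a ∈ H.grade 0 ↔ ∃ D hD, a = zeroPart D hD := by
  refine ⟨fun ⟨h0, h1, _, h3, h4⟩ => ⟨a.1.2.2.1, a.2, ?_⟩, ?_⟩
  · refine Subtype.ext (Prod.ext (h0 ?_) (Prod.ext (h1 ?_) (Prod.ext rfl
      (Prod.ext (h3 ?_) (h4 ?_))))) <;> decide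
  · rintro ⟨D, hD, rfl⟩
    exact ⟨fun _ => rfl, fun _ => rfl, fun h => (h rfl).elim, fun _ => rfl, fun _ => rfl⟩

theorem mem_grade_one {a : H.lie} : a ∈ H.grade 1 ↔ ∃ y, a = H.pos1 y := by
  refine ⟨fun ⟨h0, h1, h2, _, h4⟩ => ⟨a.1.2.2.2.1, ?_⟩, ?_⟩
  · refine Subtype.ext (Prod.ext (h0 ?_) (Prod.ext (h1 ?_) (Prod.ext (h2 ?_)
      (Prod.ext rfl (h4 ?_))))) <;> decide
  · rintro ⟨r, rfl⟩
    exact ⟨fun _ => rfl, fun _ => rfl, fun _ => rfl, fun h => (h rfl).elim, fun _ => rfl⟩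

theorem mem_grade_two {a : H.lie} : a ∈ H.grade 2 ↔ ∃ r, a = H.pos2 r := by
  refine ⟨fun ⟨h0, h1, h2, h3, _⟩ => ⟨a.1.2.2.2.2, ?_⟩, ?_⟩
  · refine Subtype.ext (Prod.ext (h0 ?_) (Prod.ext (h1 ?_) (Prod.ext (h2 ?_)
      (Prod.ext (h3 ?_) rfl)))) <;> decide
  · rintro ⟨r, rfl⟩
    exact ⟨fun _ => rfl, fun _ => rfl, fun _ => rfl, fun _ => rfl, fun h => (h rfl).elim⟩

theorem eq_zero_of_mem_grade {i : ℤ} (hi : i < -2 ∨ 2 < i) {a : H.lie} (ha : a ∈ H.grade i) :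
    a = 0 := by
  obtain ⟨h0, h1, h2, h3, h4⟩ := ha
  refine Subtype.ext (Prod.ext (h0 ?_) (Prod.ext (h1 ?_) (Prod.ext (h2 ?_)
    (Prod.ext (h3 ?_) (h4 ?_))))) <;> omega

theorem grade_cases {i : ℤ} {a : H.lie} (ha : a ∈ H.grade i) :
    i = -2 ∨ i = -1 ∨ i = 0 ∨ i = 1 ∨ i = 2 ∨ a = 0 := by
  by_cases hi : i < -2 ∨ 2 < i
  · simp [eq_zero_of_mem_grade hi ha]
  · omega

theorem lie_neg2_neg1 (r : R) (y : QuadExt α × J) : ⁅H.neg2 r, H.neg1 y⁆ = 0 := by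
  refine Subtype.ext ?_
  rw [coe_lie]
  simp [neg1, neg2, bracket_mk, skew_zero_left, vPair_zero_left, skewAct_zero]

theorem coe_lie_pos2_one (a : H.lie) : ((⁅H.pos2 1, a⁆ : H.lie) : H.Ambient) =
    (0, 0, (a.1.1 * (1 - 4 * α)) • H.gradPair, -H.dl a.1.2.1, -H.skewAct a.1.2.2.1.1) := by
  obtain ⟨⟨r, y, D, x, s⟩, h⟩ := a
  rw [coe_lie]
  simp [pos2, bracket_mk, skew_zero_left, vPair_zero_left, vPair_zero_right, skewAct_zero]

theorem lie_neg2_pos2_neg1 (y : QuadExt α × J) :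
    ⁅⁅H.neg2 1, H.pos2 1⁆, H.neg1 y⁆ = (1 - 4 * α) • H.neg1 y := by
  refine Subtype.ext ?_
  rw [coe_lie, coe_lie]
  simp [neg1, neg2, pos2, bracket_mk, skew_zero_left, vPair_zero_left, skewAct_zero, gradPair]
  module

theorem coe_lie_pos2_neg2 (a : H.lie) :
    ((⁅⁅H.pos2 1, H.neg2 1⁆, a⁆ : H.lie) : H.Ambient) =
      (-(2 * (1 - 4 * α) * a.1.1), -((1 - 4 * α) • a.1.2.1), 0, (1 - 4 * α) • a.1.2.2.2.1,
        2 * (1 - 4 * α) * a.1.2.2.2.2) := by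
  obtain ⟨⟨r, y, D, x, s⟩, h⟩ := a
  have e : H.bracket (H.pos2 1) (H.neg2 1) = (0, 0, (1 - 4 * α) • H.gradPair, 0, 0) := by
    simp [neg2, pos2, bracket_mk, vPair_zero_left, skewAct_zero]
  have e1 : H.skewAct H.gradPair.1 = 2 := H.skewAct_one
  have e2 : H.skewAct H.gradPair.2 = -2 := by
    rw [show H.gradPair.2 = -1 from rfl, skewAct_neg, skewAct_one]
  rw [coe_lie, coe_lie, e, bracket_mk, Prod.smul_fst, Prod.smul_snd, skewAct_smul, skewAct_smul, e1,
    e2, smul_mul_assoc, mul_smul_comm, gradPair_mul_comm, sub_self]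
  refine Prod.ext ?_ (Prod.ext ?_ (Prod.ext ?_ (Prod.ext ?_ ?_)))
  · simp [skew_zero_left]
    ring
  · simp [gradPair]
  · simp [vPair_zero_left, vPair_zero_right]
  · simp [gradPair]
  · simp [skew_zero_left]
    ring

theorem smul_lie_left (r : R) (a b : H.lie) : ⁅r • a, b⁆ = r • ⁅a, b⁆ := by
  rw [← lie_skew, lie_smul_right, ← smul_neg, lie_skew]

theorem eq_zero_of_isUnit_smul {κ : R} (hκ : IsUnit κ) {M : Type*} [AddCommGroup M] [Module R M]
    {x : M} (h : κ • x = 0) : x = 0 :=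
  hκ.smul_eq_zero.1 h

-- Two relations locate φ(y_{-1}). From [σ_{-2}, y_{-1}] = 0 it is killed by ad σ_2, which excludes
-- components in L_{-2} and L_{-1}. From [[σ_{-2}, σ_2], y_{-1}] = (1 - 4α) y_{-1} its image is an
-- eigenvector of μρ ad [σ_2, σ_{-2}], which acts as 0, 1 and 2 times μρ(1 - 4α) in degrees 0, 1 and
-- 2; so the L_0-component vanishes.
set_option maxHeartbeats 400000 in
theorem IsLieAut.exists_map_neg1_eq_add (hα : IsUnit (1 - 4 * α)) {φ : H.lie ≃ₗ[R] H.lie}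
    (h : H.IsLieAut φ) {μ ρ : R} (hμ : IsUnit μ)
    (h₁ : φ (H.neg2 1) = H.pos2 μ) (h₂ : φ (H.pos2 1) = H.neg2 ρ) (y : QuadExt α × J) :
    ∃ x s, φ (H.neg1 y) = H.pos1 x + H.pos2 s ∧ (μ * ρ) • x = x ∧ 2 * (μ * ρ) * s = s := by
  have hμ' : H.pos2 μ = μ • H.pos2 1 := by rw [smul_pos2, mul_one]
  have hρ : H.neg2 ρ = ρ • H.neg2 1 := by rw [smul_neg2, mul_one]
  have e1 := h.map_lie (H.neg2 1) (H.neg1 y)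
  rw [lie_neg2_neg1, map_zero, h₁, hμ', smul_lie_left, eq_comm, hμ.smul_eq_zero] at e1
  have e2 := h.map_lie ⁅H.neg2 1, H.pos2 1⁆ (H.neg1 y)
  rw [lie_neg2_pos2_neg1, map_smul, h.map_lie, h₁, h₂, hμ', hρ, smul_lie_left, lie_smul_right,
    smul_lie_left, smul_lie_left, smul_smul] at e2
  replace e1 := (coe_lie_pos2_one _).symm.trans (congrArg Subtype.val e1)
  replace e2 := congrArg Subtype.val e2
  rw [Submodule.coe_smul, Submodule.coe_smul, coe_lie_pos2_neg2] at e2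
  generalize φ (H.neg1 y) = a at *
  obtain ⟨⟨r, y, D, x, s⟩, ha⟩ := a
  simp only [Prod.smul_mk, Prod.mk.injEq, ZeroMemClass.coe_zero, Prod.mk_eq_zero] at e1 e2
  obtain ⟨-, -, e3, e4, -⟩ := e1
  obtain ⟨-, -, e5, e6, e7⟩ := e2
  have hr : r = 0 := by
    have := congrArg (fun D => (D.1 (1, 0)).1.re) e3
    simpa [gradPair, hα.mul_left_eq_zero, QuadraticAlgebra.re_one] using this
  have hy : y = 0 := by
    have := congrArg H.dl e4
    rwa [map_neg, dl_dl, map_zero, neg_eq_zero, hα.smul_eq_zero] at this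
  have hD : D = 0 := eq_zero_of_isUnit_smul hα (e5.trans (smul_zero (μ * ρ)))
  subst hr hy hD
  refine ⟨x, s, Subtype.ext (by simp [pos1, pos2]), ?_, ?_⟩
  · rw [smul_comm] at e6
    exact (hα.smul_left_cancel.1 e6).symm
  · refine hα.mul_left_cancel ?_
    simp only [smul_eq_mul] at e7
    linear_combination -e7

/-- It remains to exclude L_2. Applying φ to [t_{-1}, 1_{-1}] = σ_{-2} writes μ as a bracket of two
elements that are fixed by the scalar μρ, so μρ = 1; the equation 2μρ s = s then reads s = 0. -/
theorem IsLieAut.exists_map_neg1 (hα : IsUnit (1 - 4 * α)) {φ : H.lie ≃ₗ[R] H.lie}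
    (h : H.IsLieAut φ) {μ ρ : R} (hμ : IsUnit μ)
    (h₁ : φ (H.neg2 1) = H.pos2 μ) (h₂ : φ (H.pos2 1) = H.neg2 ρ) (y : QuadExt α × J) :
    ∃ x, φ (H.neg1 y) = H.pos1 x := by
  have key := h.exists_map_neg1_eq_add hα hμ h₁ h₂
  obtain ⟨x, s, e1, -, e2⟩ := key y
  obtain ⟨x₁, s₁, f1, f2, -⟩ := key (tEl α, 0)
  obtain ⟨x₂, s₂, g1, -, -⟩ := key (1, 0)
  have e3 := h.map_lie (H.neg1 (tEl α, 0)) (H.neg1 (1, 0))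
  rw [ExpData.lie_neg1_neg1, ExpData.skew_tEl_one, h₁, f1, g1] at e3
  have e4 : μ = H.skew x₁ x₂ := by
    have := congrArg (fun z : H.lie => z.1.2.2.2.2) e3
    simpa [coe_lie, pos1, pos2, bracket_mk, skewAct_zero] using this
  have e5 : μ * ρ = 1 := by
    refine hμ.mul_left_cancel ?_
    rw [mul_one]
    nth_rw 3 [e4]
    rw [← f2, skew_smul_left, ← e4, mul_comm]
  refine ⟨x, ?_⟩
  rw [e1, show s = 0 by linear_combination e2 - 2 * s * e5]
  exact Subtype.ext (by simp [pos1, pos2])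

/-- Degree 1 is degree -1 for the automorphism conjugated by the reversal, and L_0 is spanned by the
brackets [x_1, y_{-1}]. -/
theorem IsLieAut.map_mem_grade (hα : IsUnit (1 - 4 * α)) {φ : H.lie ≃ₗ[R] H.lie}
    (h : H.IsLieAut φ) {μ ρ : R} (hμ : IsUnit μ) (hρ : IsUnit ρ)
    (h₁ : φ (H.neg2 1) = H.pos2 μ) (h₂ : φ (H.pos2 1) = H.neg2 ρ) {i : ℤ} {a : H.lie}
    (ha : a ∈ H.grade i) : φ a ∈ H.grade (-i) := by
  have hn := h.exists_map_neg1 hα hμ h₁ h₂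
  have hp (y : QuadExt α × J) : ∃ x, φ (H.pos1 y) = H.neg1 x := by
    obtain ⟨x, hx⟩ := ((isLieAut_reversal.trans h).trans isLieAut_reversal).exists_map_neg1 hα hρ
      (μ := ρ) (ρ := μ) (congrArg H.reversal h₂) (congrArg H.reversal h₁) y
    exact ⟨x, congrArg H.reversal hx⟩
  rcases grade_cases ha with rfl | rfl | rfl | rfl | rfl | rfl
  · obtain ⟨r, rfl⟩ := mem_grade_neg_two.1 ha
    rw [← mul_one r, ← smul_neg2, map_smul, h₁]
    exact Submodule.smul_mem _ _ (mem_grade_two.2 ⟨_, rfl⟩)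
  · obtain ⟨y, rfl⟩ := mem_grade_neg_one.1 ha
    exact mem_grade_one.2 (hn y)
  · obtain ⟨D, hD, rfl⟩ := mem_grade_zero.1 ha
    refine zeroPart_induction (p := fun a => φ a ∈ H.grade (-0)) (fun x y => ?_) ?_
      (fun a b ha hb => ?_) (fun r a ha => ?_) D hD
    · obtain ⟨z, hz⟩ := hp x
      obtain ⟨w, hw⟩ := hn y
      rw [h.map_lie, hz, hw, ← lie_skew, ExpData.lie_neg1_pos1, neg_zero]
      exact neg_mem (mem_grade_zero.2 ⟨_, _, rfl⟩)
    · rw [map_zero]; exact zero_mem _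
    · rw [map_add]; exact add_mem ha hb
    · rw [map_smul]; exact Submodule.smul_mem _ _ ha
  · obtain ⟨y, rfl⟩ := mem_grade_one.1 ha
    exact mem_grade_neg_one.2 (hp y)
  · obtain ⟨r, rfl⟩ := mem_grade_two.1 ha
    rw [← mul_one r, ← smul_pos2, map_smul, h₂]
    exact Submodule.smul_mem _ _ (mem_grade_neg_two.2 ⟨_, rfl⟩)
  · rw [map_zero]; exact zero_mem _

/-- An automorphism of `L` that exchanges `L_{-2}` and `L_2` reverses the grading. -/
theorem IsLieAut.map_grade (hα : IsUnit (1 - 4 * α)) {φ : H.lie ≃ₗ[R] H.lie}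
    (h : H.IsLieAut φ) (μ ρ : Rˣ)
    (h₁ : φ (H.neg2 1) = H.pos2 μ) (h₂ : φ (H.pos2 1) = H.neg2 ρ) (i : ℤ) :
    (H.grade i).map φ.toLinearMap = H.grade (-i) := by
  refine le_antisymm ?_ fun a ha => ⟨φ.symm a, ?_, φ.apply_symm_apply a⟩
  · rintro _ ⟨a, ha, rfl⟩
    exact h.map_mem_grade hα μ.isUnit ρ.isUnit h₁ h₂ ha
  · have := h.symm.map_mem_grade hα (μ := ↑ρ⁻¹) (ρ := ↑μ⁻¹) ρ⁻¹.isUnit μ⁻¹.isUnit ?_ ?_ ha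
    · rwa [neg_neg] at this
    · rw [LinearEquiv.symm_apply_eq, ← mul_one (↑ρ⁻¹ : R), ← smul_pos2, map_smul, h₂, smul_neg2,
        Units.inv_mul]
    · rw [LinearEquiv.symm_apply_eq, ← mul_one (↑μ⁻¹ : R), ← smul_neg2, map_smul, h₁, smul_pos2,
        Units.inv_mul]

end GradingReversal

/-! ### Uniqueness and inverses of exponentials; one-invertible elements -/

section Exponentials

variable {R : Type u} [CommRing R] {α : R} {J : Type v} [AddCommGroup J] [Module R J]
  [Module (QuadExt α) J] [IsScalarTower R (QuadExt α) J]
  {H : HermitianCubicNormStructure α J}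

theorem IsExpPos.map_neg1 {g : H.G} {φ : H.lie ≃ₗ[R] H.lie} (h : H.IsExpPos g φ)
    (y : QuadExt α × J) : φ (H.neg1 y) =
      H.neg1 y + ⁅H.pos1 g.x, H.neg1 y⁆ + H.pos1 (g.Q y) + H.pos2 (g.cubicT y) := by
  obtain ⟨-, e₁, e₂, e₃, e₄, h, hg, h1, h2, h3⟩ := h
  have h4 : e₄ (H.neg1 y) = 0 :=
    eq_zero_of_mem_grade (by omega) (hg (-1) _ (mem_grade_neg_one.2 ⟨y, rfl⟩)).2.2.2
  have h1' : e₁ (H.neg1 y) = ⁅H.pos1 g.x, H.neg1 y⁆ := Subtype.ext (h1 _)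
  rw [h, h1', h2, h3, h4, add_zero]

theorem IsExpPos.map_pos1 {g : H.G} {φ : H.lie ≃ₗ[R] H.lie} (h : H.IsExpPos g φ)
    (y : QuadExt α × J) : φ (H.pos1 y) = H.pos1 y + H.pos2 (H.skew g.x y) := by
  obtain ⟨-, e₁, e₂, e₃, e₄, h, hg, h1, -, -⟩ := h
  have hg' := hg 1 _ (mem_grade_one.2 ⟨y, rfl⟩)
  have h2 : e₂ (H.pos1 y) = 0 := eq_zero_of_mem_grade (by omega) hg'.2.1
  have h3 : e₃ (H.pos1 y) = 0 := eq_zero_of_mem_grade (by omega) hg'.2.2.1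
  have h4 : e₄ (H.pos1 y) = 0 := eq_zero_of_mem_grade (by omega) hg'.2.2.2
  have h1' : e₁ (H.pos1 y) = ⁅H.pos1 g.x, H.pos1 y⁆ := Subtype.ext (h1 _)
  rw [h, h1', h2, h3, h4, ExpData.lie_pos1_pos1, add_zero, add_zero, add_zero]

/-- The definition of exp_+(g) prescribes its values on L_{-1}, where e₄ vanishes for degree
reasons, and on L_1; these two generate L. -/
theorem IsExpPos.eq {g : H.G} {φ ψ : H.lie ≃ₗ[R] H.lie} (h : H.IsExpPos g φ)
    (h' : H.IsExpPos g ψ) : φ = ψ :=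
  IsLieAut.ext h.1 h'.1 (fun y => by rw [h.map_neg1, h'.map_neg1])
    fun y => by rw [h.map_pos1, h'.map_pos1]

theorem ground_sharp_neg (v : J) : H.sharp.ground (-v) = H.sharp.ground v := by
  simpa using H.ground_sharp_smul (-1) v

theorem ground_N_neg (v : J) : H.N.ground (-v) = -H.N.ground v := by
  simpa [pow_succ] using H.ground_N_smul (-1) v

namespace G

variable (g : H.G)

theorem isLieAut_equiv (hα : IsUnit (1 - 4 * α)) : H.IsLieAut g.expData.equiv :=
  (g.isExp hα).isLieAut

theorem equiv_neg2 (r : R) : (g.expData.equiv (H.neg2 r) : H.Ambient) =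
    (r, r • H.dl g.x, r • g.expData.w₂, r • g.expData.w₃, r * g.nu) := by
  rw [ExpData.coe_equiv_apply]
  simp [ExpData.map, neg2, vPair_zero_right, skew_zero_right, expData_x]
  exact ⟨rfl, rfl⟩

theorem equiv_pos2 (r : R) : g.expData.equiv (H.pos2 r) = H.pos2 r := by
  refine Subtype.ext ?_
  rw [ExpData.coe_equiv_apply]
  simp [ExpData.map, pos2, vPair_zero_right, skew_zero_right]

/-- The automorphism `exp_-(g)`. -/
def expNeg : H.lie ≃ₗ[R] H.lie := (H.reversal.trans g.expData.equiv).trans H.reversal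

theorem expNeg_apply (a : H.lie) :
    g.expNeg a = H.reversal (g.expData.equiv (H.reversal a)) := rfl

theorem isExpNeg_expNeg (hα : IsUnit (1 - 4 * α)) : H.IsExpNeg g g.expNeg :=
  g.isExpPos_expData hα

theorem isLieAut_expNeg (hα : IsUnit (1 - 4 * α)) : H.IsLieAut g.expNeg :=
  (isLieAut_reversal.trans (g.isLieAut_equiv hα)).trans isLieAut_reversal

theorem eq_expNeg (hα : IsUnit (1 - 4 * α)) {φ : H.lie ≃ₗ[R] H.lie} (h : H.IsExpNeg g φ) :
    φ = g.expNeg := by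
  have e := IsExpPos.eq h (g.isExpPos_expData hα)
  refine LinearEquiv.ext fun a => ?_
  rw [expNeg_apply, ← e]
  rfl

theorem expNeg_neg2 (r : R) : g.expNeg (H.neg2 r) = H.neg2 r := by
  rw [expNeg_apply, reversal_neg2, equiv_pos2, reversal_pos2]

theorem expNeg_pos2 (r : R) : (g.expNeg (H.pos2 r) : H.Ambient) =
    (r * g.nu, r • g.expData.w₃, r • g.expData.w₂.swap, r • H.dl g.x, r) := by
  rw [expNeg_apply, reversal_pos2, coe_reversal, equiv_neg2]
  rfl

theorem expNeg_pos2_component (a : H.lie) : (g.expNeg a).1.2.2.2.2 = a.1.2.2.2.2 := by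
  rw [expNeg_apply, coe_reversal, ExpData.coe_equiv_apply]
  rfl

end G

/-- If `g` is one-invertible, then `ν(g)` is invertible. -/
theorem OneInvertible.isUnit_nu (hα : IsUnit (1 - 4 * α)) {g : H.G} (h : H.OneInvertible g) :
    IsUnit g.nu := by
  obtain ⟨gl, gr, El, E, Er, hl, hE, hr, h⟩ := h
  obtain rfl := gl.eq_expNeg hα hl
  obtain rfl := gr.eq_expNeg hα hr
  obtain rfl := hE.eq (g.isExpPos_expData hα)
  -- Some r σ_{-2} is mapped to σ_2. The right factor fixes it, exp_+(g) gives it the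
  -- σ_2-coefficient r ν(g), and the left factor does not change this coefficient.
  obtain ⟨a, ha, e⟩ : H.pos2 1 ∈ (H.grade (-2)).map _ :=
    (h (-2)).symm ▸ mem_grade_two.2 ⟨1, rfl⟩
  obtain ⟨r, rfl⟩ := mem_grade_neg_two.1 ha
  have e' := congrArg (fun a : H.lie => a.1.2.2.2.2) e
  simp only [LinearMap.comp_apply, LinearEquiv.coe_coe, G.expNeg_neg2, G.expNeg_pos2_component,
    G.equiv_neg2] at e'
  exact IsUnit.of_mul_eq_one_right r e'

namespace G

variable (g : H.G)

/-- The inverse of `g` in the group `G`. -/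
def inv : H.G := ⟨-g.a, -g.v, star g.u, by
  rw [star_star, add_comm, g.rel]; simp⟩

theorem inv_inv : g.inv.inv = g := by
  ext1 <;> simp [inv]

theorem inv_ne_one {g : H.G} (h : g ≠ 1) : g.inv ≠ 1 := fun e => h (by
  rw [← g.inv_inv, e]
  ext1 <;> simp [inv, show (1 : H.G).a = 0 from rfl, show (1 : H.G).v = 0 from rfl,
    show (1 : H.G).u = 0 from rfl])

/-- The part of degree 2 of exp_+(g⁻¹) exp_+(g) = 1 on L_{-1}; the part of degree 3 is
`cubicT_inv_add`. -/
theorem Q_inv_add (y : QuadExt α × J) : g.inv.Q y + g.Q y = -H.V g.x y g.x := by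
  have h1 := g.inv.expData_Q_mk
  have h2 := g.expData_Q_mk
  obtain ⟨b, w⟩ := y
  rw [show g.Q (b, w) = g.expData.Q (b, w) from rfl,
    show g.inv.Q (b, w) = g.inv.expData.Q (b, w) from rfl, h1, h2, show g.x = (g.a, g.v) from rfl,
    V_mk]
  simp only [inv]
  have hc : H.cross (H.cross g.v w) g.v = H.cross g.v (H.cross g.v w) := H.cross_comm _ _
  refine Prod.ext ?_ ?_
  · simp [ground_sharp_neg, H.T_smul_left, T_cross_self_left, star_u]
    ring
  · simp [ground_sharp_neg, star_u, cross_self, H.cross_smul_left, D, hc, H.cross_comm w g.v]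
    module

theorem cubicT_inv_add (hα : IsUnit (1 - 4 * α)) (y : QuadExt α × J) :
    g.inv.cubicT y + g.cubicT y + H.skew g.x (g.inv.Q y - g.Q y) = 0 := by
  have h1 := g.inv.algebraMap_cubicT y
  have h2 := g.algebraMap_cubicT y
  have h3 := algebraMap_skew (H := H) g.x (g.inv.Q y - g.Q y)
  have h4 := g.inv.expData_Q_mk
  have h5 := g.expData_Q_mk
  apply algebraMap_mul_delta_cancel hα
  rw [map_add, map_add]
  obtain ⟨b, w⟩ := y
  linear_combination (norm := skip) h1 + h2 + h3
  rw [show g.Q (b, w) = g.expData.Q (b, w) from rfl,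
    show g.inv.Q (b, w) = g.inv.expData.Q (b, w) from rfl, h4, h5, show g.x = (g.a, g.v) from rfl]
  generalize H.skew _ _ = τ₁
  generalize g.cubicT _ = τ₂
  generalize g.inv.cubicT _ = τ₃
  simp only [theta_mk, inv]
  have hc (w : J) : H.cross (H.cross g.v w) g.v = H.cross g.v (H.cross g.v w) := H.cross_comm _ _
  have hs : H.cross (H.sharp.ground g.v) g.v = H.cross g.v (H.sharp.ground g.v) := H.cross_comm _ _
  simp [ground_sharp_neg, ground_N_neg, T_smul_right, H.T_smul_left, star_T, star_u, hc]
  ring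

theorem equiv_trans_inv (hα : IsUnit (1 - 4 * α)) :
    g.expData.equiv.trans g.inv.expData.equiv = LinearEquiv.refl R H.lie := by
  refine IsLieAut.ext ((g.isLieAut_equiv hα).trans (g.inv.isLieAut_equiv hα))
    ((isLieAut_iff _).2 fun a b => rfl) (fun y => ?_) (fun y => ?_)
  · have hq : g.inv.expData.q (H.vPair g.x y) = H.skew g.x (g.inv.Q y) -
        H.skew g.inv.expData.x g.x * H.skew g.inv.expData.x (H.dl y) :=
      (g.inv.isExp hα).q_vPair g.x y
    have hx : g.inv.expData.x = -g.x := rfl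
    rw [hx, skew_neg_left, skew_self, neg_zero, zero_mul, sub_zero] at hq
    have hQ := g.Q_inv_add y
    have hτ := g.cubicT_inv_add hα y
    rw [skew_sub_right] at hτ
    refine Subtype.ext ?_
    rw [LinearEquiv.trans_apply, ExpData.coe_equiv_apply, ExpData.coe_equiv_apply]
    simp only [ExpData.map, neg1, hx, skew_zero_right, zero_smul, zero_mul, add_zero, zero_add,
      vPair_neg_left, map_neg, map_zero, skew_neg_left, LinearMap.zero_apply, Prod.fst_zero,
      sub_zero, LinearEquiv.refl_apply, show g.expData.x = g.x from rfl,
      show g.expData.Q y = g.Q y from rfl, show g.inv.expData.Q y = g.inv.Q y from rfl,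
      show g.expData.τ y = g.cubicT y from rfl, show g.inv.expData.τ y = g.inv.cubicT y from rfl,
      hq, add_neg_cancel]
    refine Prod.ext rfl (Prod.ext rfl (Prod.ext rfl (Prod.ext ?_ ?_)))
    · rw [show (H.vPair g.x y).1 g.x = H.V g.x y g.x from rfl]
      dsimp only
      linear_combination (norm := module) hQ
    · dsimp only
      linear_combination hτ
  · rw [LinearEquiv.trans_apply, (g.isExpPos_expData hα).map_pos1, map_add,
      (g.inv.isExpPos_expData hα).map_pos1, equiv_pos2]
    refine Subtype.ext ?_
    simp [pos1, pos2, show g.inv.x = -g.x from rfl, skew_neg_left]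

theorem equiv_symm (hα : IsUnit (1 - 4 * α)) : g.expData.equiv.symm = g.inv.expData.equiv :=
  LinearEquiv.ext fun a => by
    have := LinearEquiv.congr_fun (g.equiv_trans_inv hα) (g.expData.equiv.symm a)
    rw [LinearEquiv.trans_apply, LinearEquiv.apply_symm_apply] at this
    exact this.symm

theorem expNeg_symm (hα : IsUnit (1 - 4 * α)) : g.expNeg.symm = g.inv.expNeg :=
  LinearEquiv.ext fun a => by
    rw [expNeg_apply, ← equiv_symm g hα]
    rfl

end G

/-- If `exp_+(g) σ_{-2}` and `exp_+(g⁻¹) σ_{-2}` are multiples of elements `exp_-(h) σ_2`, then `g`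
is one-invertible. -/
theorem oneInvertible_of_equiv_neg2 (hα : IsUnit (1 - 4 * α)) (g h h' : H.G) (μ μ' : Rˣ)
    (e : g.expData.equiv (H.neg2 1) = h.expNeg (H.pos2 μ))
    (e' : g.inv.expData.equiv (H.neg2 1) = h'.expNeg (H.pos2 μ')) : H.OneInvertible g := by
  -- As exp_+(g⁻¹) is the inverse of exp_+(g), this says that exp_+(g) exp_-(h') maps σ_2 to a
  -- multiple of σ_{-2}.
  have e2 : h'.expNeg (H.pos2 1) = (↑μ'⁻¹ : R) • g.inv.expData.equiv (H.neg2 1) := by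
    rw [e', ← map_smul, smul_pos2, Units.inv_mul]
  have key := IsLieAut.map_grade hα (φ := (h'.expNeg.trans g.expData.equiv).trans h.inv.expNeg)
    (((h'.isLieAut_expNeg hα).trans (g.isLieAut_equiv hα)).trans (h.inv.isLieAut_expNeg hα))
    μ μ'⁻¹ (by
      rw [LinearEquiv.trans_apply, LinearEquiv.trans_apply, G.expNeg_neg2, e,
        ← G.expNeg_symm h hα, LinearEquiv.symm_apply_apply]) (by
      rw [LinearEquiv.trans_apply, LinearEquiv.trans_apply, e2, map_smul, map_smul,
        ← G.equiv_symm g hα, LinearEquiv.apply_symm_apply, G.expNeg_neg2, smul_neg2, mul_one])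
  rw [LinearEquiv.coe_trans, LinearEquiv.coe_trans] at key
  exact ⟨h.inv, h', _, _, _, h.inv.isExpNeg_expNeg hα, g.isExpPos_expData hα,
    h'.isExpNeg_expNeg hα, key⟩

end Exponentials

/-! ### The pair (a₃, v₃) and its invariants -/

section Swap

variable {R : Type u} [CommRing R] {α : R} {J : Type v} [AddCommGroup J] [Module R J]
  [Module (QuadExt α) J] [IsScalarTower R (QuadExt α) J]
  {H : HermitianCubicNormStructure α J}

theorem T_cross_self_sharp_cross_self_sharp (v : J) :
    H.T (H.cross v (H.sharp.ground v)) (H.cross v (H.sharp.ground v)) =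
      H.T v v * H.T (H.sharp.ground v) (H.sharp.ground v) +
        3 * (H.N.ground v * star (H.N.ground v)) := by
  rw [T_cross_rotate, H.cross_comm _ v, cross_self_cross_sharp]
  simp [T_smul_right, star_T, T_sharp_self]
  ring

/-- Apply the fourth axiom with b = a = v and expand N(T(v, v)v - v^♯ × v); the norm wanted is one
of the terms. -/
theorem N_cross_self_sharp (v : J) : H.N.ground (H.cross v (H.sharp.ground v)) =
    H.T v v * H.T (H.sharp.ground v) (H.sharp.ground v) * H.N.ground v -
      H.N.ground v ^ 2 * star (H.N.ground v) := by
  have h := H.ground_N_U v v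
  rw [sub_eq_add_neg, ground_N_add, ground_N_neg, ground_sharp_neg, ground_sharp_smul,
    ground_N_smul, H.cross_comm _ v, sharp_cross_sharp] at h
  simp [T_smul_right, H.T_smul_left, star_T, T_self_sharp, T_self_cross,
    T_cross_sharp_sharp] at h
  linear_combination -h

theorem D_add_left (i i' j w : J) : H.D (i + i') j w = H.D i j w + H.D i' j w := by
  simp [D]
  abel

theorem D_add_right (i j j' w : J) : H.D i (j + j') w = H.D i j w + H.D i j' w := by
  simp [D, add_smul]
  abel

theorem D_cross_right (i j k w : J) : H.D i (H.cross j k) w + H.D j (H.cross k i) w +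
    H.D k (H.cross j i) w = -(H.T i (H.cross j k) • w) := by
  have h1 := H.D_sharp_right_linear (j + k) w i
  have h2 := H.D_sharp_right_linear j w i
  have h3 := H.D_sharp_right_linear k w i
  simp only [ground_sharp_add, D_add_left, D_add_right, map_add, LinearMap.add_apply, add_smul]
    at h1
  linear_combination (norm := module) h1 - h2 - h3

theorem D_self_cross_sharp (v w : J) : H.D v (H.cross v (H.sharp.ground v)) w =
    -(H.T (H.sharp.ground v) (H.sharp.ground v) • w) -
      H.D (H.sharp.ground v) (H.sharp.ground v) w := by
  linear_combination (norm := module) H.D_sharp_right_linear v w (H.sharp.ground v)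

theorem D_cross_sharp_self (v w : J) : H.D (H.cross v (H.sharp.ground v)) v w =
    -(H.T (H.sharp.ground v) (H.sharp.ground v) • w) -
      H.D (H.sharp.ground v) (H.sharp.ground v) w := by
  linear_combination (norm := module) H.D_sharp_left_linear v w (H.sharp.ground v)

theorem D_sharp_cross_sharp (v w : J) : H.D (H.sharp.ground v) (H.cross v (H.sharp.ground v)) w =
    -(star (H.N.ground v) • (H.T v v • w + H.D v v w)) := by
  have h := H.D_sharp_right_linear (H.sharp.ground v) w v
  rw [ground_sharp_sharp, D_smul_right, H.cross_comm _ v, T_smul_right] at h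
  linear_combination (norm := module) h

theorem D_cross_sharp_sharp (v w : J) : H.D (H.cross v (H.sharp.ground v)) (H.sharp.ground v) w =
    -(H.N.ground v • (H.T v v • w + H.D v v w)) := by
  have h := H.D_sharp_left_linear (H.sharp.ground v) w v
  rw [ground_sharp_sharp, D_smul_left, H.cross_comm _ v, H.T_smul_left] at h
  linear_combination (norm := module) h

/-- Polarised relation `D_cross_right` for v × v^♯, v and v^♯: the two further cross products reduce
to v and v^♯, for which D is known. -/
theorem D_cross_sharp_cross_sharp (v w : J) :
    H.D (H.cross v (H.sharp.ground v)) (H.cross v (H.sharp.ground v)) w =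
      -((H.T v v * H.T (H.sharp.ground v) (H.sharp.ground v) +
        H.N.ground v * star (H.N.ground v)) • w) -
      H.T (H.sharp.ground v) (H.sharp.ground v) • H.D v v w -
      H.T v v • H.D (H.sharp.ground v) (H.sharp.ground v) w := by
  have h := H.D_cross_right (H.cross v (H.sharp.ground v)) v (H.sharp.ground v) w
  rw [cross_sharp_cross_sharp, cross_self_cross_sharp, T_cross_self_sharp_cross_self_sharp] at h
  simp only [D_add_right, D_smul_right, D_sharp_left, D_sharp_right, star_star, star_T] at h
  linear_combination (norm := module) h

namespace G

variable (g : H.G)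

/-- The element `Λ` with `a₃ ā₃ = ν a ā + Λ`. -/
def lam : QuadExt α := H.N.ground g.v * star (H.N.ground g.v) +
  g.a * star g.a * H.T (H.sharp.ground g.v) (H.sharp.ground g.v) -
  (g.a * H.N.ground g.v * star g.u + star g.a * star (H.N.ground g.v) * g.u)

theorem star_lam : star g.lam = g.lam := by
  simp [lam, star_T]
  ring

theorem star_nuK : star g.nuK = g.nuK := by
  rw [← g.algebraMap_nu]; simp

theorem a₃_mul_star : g.a₃ * star g.a₃ = g.nuK * (g.a * star g.a) + g.lam := by
  simp only [a₃, nuK, lam]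
  simp [star_u, star_T]
  ring

/-- The same Λ as in `a₃_mul_star` occurs, three times. The total correction 4Λ is what makes the
defining relation of G solvable for `opp`. -/
theorem T_v₃ : H.T g.v₃ g.v₃ = g.nuK * H.T g.v g.v + 3 * g.lam := by
  have hs : H.cross (H.sharp.ground g.v) g.v = H.cross g.v (H.sharp.ground g.v) := H.cross_comm _ _
  simp only [v₃, nuK, lam]
  simp [T_smul_right, H.T_smul_left, star_u, T_self_sharp, T_sharp_self, T_self_cross,
    T_cross_self_left, T_cross_sharp_sharp, T_sharp_cross_self,
    T_cross_self_sharp_cross_self_sharp]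
  ring

/-- After division by ν(g) this compares v^♯ - av for the elements h and g: they are negative
multiples of each other, as the left multiplication part of degree 0 requires. -/
theorem sharp_v₃ : H.sharp.ground g.v₃ =
    g.a₃ • g.v₃ - g.nuK • (H.sharp.ground g.v - g.a • g.v) := by
  have hs : H.cross (H.sharp.ground g.v) g.v = H.cross g.v (H.sharp.ground g.v) := H.cross_comm _ _
  simp only [v₃, a₃, nuK]
  simp [sub_eq_add_neg, ground_sharp_add, ground_sharp_neg, ground_sharp_smul,
    ground_sharp_sharp, sharp_cross_sharp, H.cross_smul_left, H.cross_smul_right, star_u,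
    cross_self_cross_sharp, cross_sharp_cross_sharp]
  module

theorem D_v₃ (w : J) : H.D g.v₃ g.v₃ w = g.nuK • H.D g.v g.v w - g.lam • w := by
  simp only [v₃, lam, nuK, sub_eq_add_neg, ← neg_smul]
  simp only [D_add_left, D_add_right, D_smul_left, D_smul_right, D_sharp_left, D_sharp_right,
    D_self_cross_sharp, D_cross_sharp_self, D_sharp_cross_sharp, D_cross_sharp_sharp,
    D_cross_sharp_cross_sharp]
  simp [star_u]
  module

theorem v₃_dual : (g.a * star g.a - H.T g.v g.v + g.u) • g.v₃ -
    star g.a₃ • (H.sharp.ground g.v - g.a • g.v) -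
    H.cross g.v₃ (H.sharp.ground g.v - g.a • g.v) = g.nuK • g.v := by
  have hs : H.cross (H.sharp.ground g.v) g.v = H.cross g.v (H.sharp.ground g.v) := H.cross_comm _ _
  have hp : H.cross (H.cross g.v (H.sharp.ground g.v)) g.v = _ :=
    (H.cross_comm _ _).trans (H.cross_self_cross_sharp g.v)
  have hq : H.cross (H.cross g.v (H.sharp.ground g.v)) (H.sharp.ground g.v) = _ :=
    (H.cross_comm _ _).trans (H.cross_sharp_cross_sharp g.v)
  simp only [v₃, a₃, nuK]
  simp [H.cross_smul_left, H.cross_smul_right, star_u, star_T, cross_self, ground_sharp_sharp,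
    hs, hp, hq]
  module

theorem T_v₃_dual : g.a₃ * H.T g.v₃ (H.sharp.ground g.v - g.a • g.v) +
    star (g.a₃ * H.T g.v₃ (H.sharp.ground g.v - g.a • g.v)) =
    g.lam * (3 * (g.a * star g.a) - H.T g.v g.v) + g.nuK * (2 * (g.a * star g.a) * H.T g.v g.v -
      3 * (g.a * H.N.ground g.v + star g.a * star (H.N.ground g.v))) := by
  have hs : H.cross (H.sharp.ground g.v) g.v = H.cross g.v (H.sharp.ground g.v) := H.cross_comm _ _
  simp only [v₃, a₃, nuK, lam]
  simp [T_smul_right, H.T_smul_left, star_T, star_u, T_self_sharp, T_sharp_self,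
    T_cross_self_left, T_cross_sharp_sharp]
  ring

/-- The expansion of N(v₃) contains N(v^♯), whose value is supplied by `hN`. -/
theorem N_v₃ (hN : H.N.ground (H.sharp.ground g.v) = star (H.N.ground g.v) ^ 2) :
    H.N.ground g.v₃ = star (g.a₃ * ((H.T g.v g.v - star g.u) * g.nuK + g.lam) -
      g.a * g.nuK ^ 2) := by
  have hs : H.cross (H.sharp.ground g.v) g.v = H.cross g.v (H.sharp.ground g.v) := H.cross_comm _ _
  simp only [v₃, a₃, nuK, lam]
  simp [sub_eq_add_neg, ground_N_add, ground_N_neg, ground_N_smul, hN, N_cross_self_sharp,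
    ground_sharp_add, ground_sharp_neg, ground_sharp_smul, ground_sharp_sharp, sharp_cross_sharp,
    T_smul_right, H.T_smul_left, star_T, star_u, T_self_sharp, T_sharp_self, T_self_cross,
    T_cross_self_left, T_cross_sharp_sharp, T_sharp_cross_self,
    T_cross_self_sharp_cross_self_sharp, H.cross_smul_left, H.cross_smul_right]
  ring

end G

end Swap

/-! ### The opposite element, fields, and the equivalence -/

section Division

variable {R : Type u} [CommRing R] {α : R} {J : Type v} [AddCommGroup J] [Module R J]
  [Module (QuadExt α) J] [IsScalarTower R (QuadExt α) J]
  {H : HermitianCubicNormStructure α J}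

theorem diagPair_swap (c : QuadExt α) : (H.diagPair c).swap = -H.diagPair (star c) := by
  refine Prod.ext ?_ ?_ <;> simp [diagPair]

theorem lmulPair_swap (j : J) : (H.lmulPair j).swap = -H.lmulPair j := by
  refine Prod.ext ?_ ?_ <;> simp [lmulPair]

theorem innPair_swap (i j : J) : (H.innPair i j).swap = H.innPair i j := rfl

namespace G

variable (g : H.G)

/-- For `η = ν(g)⁻¹`, the element `h` of `G` with `exp_+(g) σ_{-2} = exp_-(h) (ν(g) σ_2)`. -/
def opp (η : R) (hη : g.nu * η = 1) : H.G where
  a := algebraMap R (QuadExt α) η * g.a₃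
  v := algebraMap R (QuadExt α) η • g.v₃
  -- Degree 0 asks for T(v, v) - u = η(T(v_g, v_g) - ū_g) + η²Λ, and T(v, v) contains 3η²Λ, which
  -- leaves 2η²Λ here.
  u := algebraMap R (QuadExt α) η * star g.u + 2 * algebraMap R (QuadExt α) η ^ 2 * g.lam
  rel := by
    have h := congrArg (algebraMap R (QuadExt α)) hη
    rw [map_mul, map_one, algebraMap_nu] at h
    have h1 := g.a₃_mul_star
    have h2 := g.T_v₃
    have h3 := g.star_lam
    have hs : star (algebraMap R (QuadExt α) η) = algebraMap R (QuadExt α) η := by simp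
    generalize algebraMap R (QuadExt α) η = e at *
    rw [T_smul_right, H.T_smul_left, h2]
    simp only [star_add, star_mul', star_pow, star_star, hs, h3, star_ofNat]
    linear_combination (-e ^ 2) * h1 + e * g.rel - e * (g.a * star g.a + H.T g.v g.v) * h

variable {g} {η : R} {hη : g.nu * η = 1}

theorem opp_a : (g.opp η hη).a = algebraMap R (QuadExt α) η * g.a₃ := rfl

theorem opp_v : (g.opp η hη).v = algebraMap R (QuadExt α) η • g.v₃ := rfl

theorem opp_u : (g.opp η hη).u =
    algebraMap R (QuadExt α) η * star g.u + 2 * algebraMap R (QuadExt α) η ^ 2 * g.lam := rfl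

variable (g) in
theorem nuK_mul_algebraMap (hη : g.nu * η = 1) : g.nuK * algebraMap R (QuadExt α) η = 1 := by
  rw [← g.algebraMap_nu, ← map_mul, hη, map_one]

theorem star_algebraMap (r : R) :
    star (algebraMap R (QuadExt α) r) = algebraMap R (QuadExt α) r := by
  simp

theorem sharp_opp_v : H.sharp.ground (g.opp η hη).v = (g.opp η hη).a • (g.opp η hη).v -
    algebraMap R (QuadExt α) η • (H.sharp.ground g.v - g.a • g.v) := by
  have h := nuK_mul_algebraMap g hη
  have hs := star_algebraMap (α := α) η
  rw [opp_a, opp_v, ground_sharp_smul, sharp_v₃, hs]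
  generalize algebraMap R (QuadExt α) η = e at *
  linear_combination (norm := module) (-e * h) • (H.sharp.ground g.v - g.a • g.v)

/-- Passing from g to its opposite is symmetric: the degree 1 data of h return the first entry of g.
Together with `v₃_opp` this is the equation in degree -1. -/
theorem a₃_opp (hN : H.N.ground (H.sharp.ground g.v) = star (H.N.ground g.v) ^ 2) :
    g.nuK * (g.opp η hη).a₃ = g.a := by
  have h := nuK_mul_algebraMap g hη
  have hs := star_algebraMap (α := α) η
  have h1 := g.a₃_mul_star
  rw [a₃, opp_a, opp_v, opp_u, T_smul_right, H.T_smul_left, T_v₃, ground_N_smul, g.N_v₃ hN, hs]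
  generalize algebraMap R (QuadExt α) η = e at *
  simp only [star_mul', star_pow, star_star, hs]
  generalize g.a₃ = x at *
  linear_combination (x * star g.u * g.nuK * e ^ 2 +
    g.a * (g.nuK ^ 2 * e ^ 2 + g.nuK * e + 1)) * h

theorem v₃_opp : g.nuK • (g.opp η hη).v₃ = g.v := by
  have h := nuK_mul_algebraMap g hη
  have hs := star_algebraMap (α := α) η
  have h1 := g.a₃_mul_star
  have h2 := g.v₃_dual
  have h3 := g.rel
  rw [v₃, sharp_opp_v, map_sub, H.cross_smul_right, cross_self, sharp_opp_v, opp_a, opp_v, opp_u,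
    H.cross_smul_right, H.cross_smul_left]
  generalize algebraMap R (QuadExt α) η = e at *
  simp only [star_mul', hs]
  generalize g.a₃ = x at *
  generalize H.sharp.ground g.v - g.a • g.v = y at *
  linear_combination (norm := module) (g.nuK * e ^ 2) • h2 +
    (2 * g.nuK * e ^ 2 * g.a * star g.a * h) • g.v₃ + ((g.nuK * e + 1) * h) • g.v +
    (2 * g.nuK * e ^ 3 * h1) • g.v₃ - (g.nuK * e ^ 2 * h3) • g.v₃

variable (g) in
theorem T_dual : H.T (H.sharp.ground g.v - g.a • g.v) (H.sharp.ground g.v - g.a • g.v) =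
    H.T (H.sharp.ground g.v) (H.sharp.ground g.v) + g.a * star g.a * H.T g.v g.v -
      3 * (g.a * H.N.ground g.v + star g.a * star (H.N.ground g.v)) := by
  simp [T_smul_right, H.T_smul_left, T_self_sharp, T_sharp_self]
  ring

/-- The equation in degree -2: the σ_{-2}-coefficient of exp_-(h)(ν(g) σ_2) is ν(g) ν(h), and it has
to be 1. -/
theorem nuK_opp (hN : H.N.ground (H.sharp.ground g.v) = star (H.N.ground g.v) ^ 2) :
    (g.opp η hη).nuK = algebraMap R (QuadExt α) η := by
  have h := nuK_mul_algebraMap g hη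
  have hs := star_algebraMap (α := α) η
  have h1 := g.a₃_mul_star
  have h3 := g.rel
  have h4 := g.star_lam
  have h5 := g.star_nuK
  have h7 := g.T_v₃_dual
  have h8 : g.a₃ * star g.a + star g.a₃ * g.a = 2 * (g.a * star g.a) * H.T g.v g.v -
      g.a * star g.a * (g.u + star g.u) -
      (g.a * H.N.ground g.v + star g.a * star (H.N.ground g.v)) := by
    simp [a₃, star_T]
    ring
  have h9 : g.nuK = g.u * star g.u - g.a * star g.a * H.T g.v g.v + g.a * H.N.ground g.v
    + star g.a * star (H.N.ground g.v) - H.T (H.sharp.ground g.v) (H.sharp.ground g.v) := rfl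
  have h6 := g.T_dual
  rw [nuK, sharp_opp_v]
  generalize H.sharp.ground g.v - g.a • g.v = y at *
  simp only [map_sub, LinearMap.sub_apply, T_smul_right, H.T_smul_left]
  rw [opp_a, opp_v, opp_u, T_smul_right, T_smul_right, H.T_smul_left, H.T_smul_left, T_v₃, h6,
    ground_N_smul, g.N_v₃ hN, hs]
  generalize algebraMap R (QuadExt α) η = e at *
  simp only [star_mul', star_pow, star_star, hs, h4, h5, star_add, star_sub, star_T, star_ofNat]
    at h7 ⊢
  generalize H.T (H.sharp.ground g.v) (H.sharp.ground g.v) = T2 at *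
  generalize H.T g.v g.v = T1 at *
  generalize H.N.ground g.v = n at *
  generalize g.a₃ = x at *
  generalize g.nuK = ν at *
  generalize g.lam = Λ at *
  linear_combination (-2 * e ^ 4 * (ν * T1 + 3 * Λ) + e ^ 4 * ((2 * T1 - g.u - star g.u) * ν +
    2 * Λ)) * h1 - e ^ 4 * ν ^ 2 * h8 + e ^ 3 * h7 + ((-2 * g.a * star g.a * T1 + g.a * n +
    star g.a * star n) * e ^ 2 * (ν * e + 1) + (-4 * g.a * star g.a - g.u - star g.u) * e ^ 3 * Λ +
    (2 * g.a * star g.a * T1 - 3 * (g.a * n + star g.a * star n)) * e ^ 2 + e) * h -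
    e ^ 2 * h9 + e ^ 3 * Λ * h3

variable (g) in
-- By `T_v₃` and `D_v₃`, going from v to v₃ multiplies the commutator part by ν(g) up to a diagonal
-- term in Λ, which the term 2η²Λ in `opp_u` compensates.
theorem innPair_tEl_v₃ : H.innPair (tEl α • g.v₃) g.v₃ =
    g.nu • H.innPair (tEl α • g.v) g.v - H.diagPair (delta α * g.lam) := by
  have h (m : QuadExt α) (w : J) : H.inn (tEl α • g.v₃) g.v₃ (m, w) =
      (g.nu • H.inn (tEl α • g.v) g.v - H.diag (delta α * g.lam)) (m, w) := by
    rw [LinearMap.sub_apply, LinearMap.smul_apply, inn_tEl_smul_self, inn_tEl_smul_self, T_v₃,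
      D_v₃, smul_mk_eq, algebraMap_nu, diag_mk, star_mul', star_delta, star_lam]
    refine Prod.ext ?_ ?_
    · dsimp only [Prod.fst_sub]
      ring
    · dsimp only [Prod.snd_sub]
      module
  have h' : H.inn (tEl α • g.v₃) g.v₃ =
      g.nu • H.inn (tEl α • g.v) g.v - H.diag (delta α * g.lam) :=
    LinearMap.ext fun ⟨m, w⟩ => h m w
  refine Prod.ext h' (h'.trans ?_)
  have e : H.diag (-(delta α * g.lam)) = -H.diag (delta α * g.lam) := by
    rw [eq_neg_iff_add_eq_zero, ← diag_add, neg_add_cancel, diag_zero]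
  rw [show (g.nu • H.innPair (tEl α • g.v) g.v - H.diagPair (delta α * g.lam)).2 =
    g.nu • H.inn (tEl α • g.v) g.v - -H.diag (star (delta α * g.lam)) from rfl, star_mul',
    star_delta, star_lam, neg_mul, e, neg_neg]

/-- The equation in degree 0. The swap appears because exp_- is exp_+ conjugated by the reversal; it
changes the sign of left multiplications but not of their commutators. -/
theorem w₂_opp : g.nu • (g.opp η hη).expData.w₂.swap = g.expData.w₂ := by
  have h := nuK_mul_algebraMap g hη
  have hs := star_algebraMap (α := α) η
  have e0 : H.innPair (tEl α • (g.opp η hη).v) (g.opp η hη).v =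
      (η * η) • H.innPair (tEl α • g.v₃) g.v₃ := by
    rw [opp_v, smul_comm (tEl α), innPair_smul_left, hs, smul_smul, ← map_mul, ← smul_innPair]
  have e1 : H.sharp.ground (g.opp η hη).v - (g.opp η hη).a • (g.opp η hη).v =
      -(algebraMap R (QuadExt α) η • (H.sharp.ground g.v - g.a • g.v)) := by
    rw [sharp_opp_v]; abel
  have e2 : H.T (g.opp η hη).v (g.opp η hη).v - (g.opp η hη).u = algebraMap R (QuadExt α) η *
      (H.T g.v g.v - star g.u) + algebraMap R (QuadExt α) η ^ 2 * g.lam := by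
    rw [opp_v, opp_u, T_smul_right, H.T_smul_left, T_v₃, hs]
    linear_combination algebraMap R (QuadExt α) η * H.T g.v g.v * h
  show g.nu • ((H.diagPair (delta α * (H.T (g.opp η hη).v (g.opp η hη).v - (g.opp η hη).u))).swap +
    (H.lmulPair (delta α • (H.sharp.ground (g.opp η hη).v -
      (g.opp η hη).a • (g.opp η hη).v))).swap +
    (H.innPair (tEl α • (g.opp η hη).v) (g.opp η hη).v).swap) =
    H.diagPair (delta α * (H.T g.v g.v - g.u)) +
      H.lmulPair (delta α • (H.sharp.ground g.v - g.a • g.v)) + H.innPair (tEl α • g.v) g.v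
  rw [diagPair_swap, lmulPair_swap, innPair_swap, e0, e1, e2, innPair_tEl_v₃]
  have e3 : H.diagPair (delta α * (H.T g.v g.v - g.u)) =
      -(g.nu • H.diagPair (star (delta α * (algebraMap R (QuadExt α) η * (H.T g.v g.v - star g.u) +
        algebraMap R (QuadExt α) η ^ 2 * g.lam)))) -
      (g.nu * (η * η)) • H.diagPair (delta α * g.lam) := by
    rw [smul_diagPair, smul_diagPair, ← diagPair_neg, ← diagPair_sub, map_mul, map_mul,
      algebraMap_nu]
    congr 1
    simp only [star_mul', star_add, star_sub, star_star, star_pow, hs, star_lam, star_delta, star_T]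
    linear_combination (-delta α * (H.T g.v g.v - g.u)) * h
  have e4 : H.lmulPair (delta α • (H.sharp.ground g.v - g.a • g.v)) = -(g.nu • H.lmulPair
      (delta α • -(algebraMap R (QuadExt α) η • (H.sharp.ground g.v - g.a • g.v)))) := by
    rw [smul_lmulPair, algebraMap_nu, eq_neg_iff_add_eq_zero, ← lmulPair_add]
    refine (congrArg H.lmulPair ?_).trans H.lmulPair_zero
    linear_combination (norm := module) (-delta α * h) • (H.sharp.ground g.v - g.a • g.v)
  rw [e3, e4]
  linear_combination (norm := module) ((g.nu * η + 1) * hη) • H.innPair (tEl α • g.v) g.v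

theorem equiv_neg2_eq_expNeg (hN : H.N.ground (H.sharp.ground g.v) = star (H.N.ground g.v) ^ 2) :
    g.expData.equiv (H.neg2 1) = (g.opp η hη).expNeg (H.pos2 g.nu) := by
  have h := nuK_mul_algebraMap g hη
  refine Subtype.ext ?_
  rw [equiv_neg2, expNeg_pos2, w₂_opp]
  have e : (g.opp η hη).nu = η := by
    rw [nu, nuK_opp hN, QuadraticAlgebra.algebraMap_re]
  rw [e, hη, one_smul, one_smul, one_smul, one_mul]
  refine Prod.ext rfl (Prod.ext ?_ (Prod.ext rfl (Prod.ext ?_ rfl)))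
  · show H.dl (g.a, g.v) = g.nu • (delta α * (g.opp η hη).a₃, delta α • (g.opp η hη).v₃)
    rw [smul_mk_eq, algebraMap_nu, dl_mk, mul_left_comm, a₃_opp hN, smul_comm, v₃_opp]
  · show (delta α * g.a₃, delta α • g.v₃) = g.nu • H.dl ((g.opp η hη).a, (g.opp η hη).v)
    rw [dl_mk, smul_mk_eq, algebraMap_nu, opp_a, opp_v]
    refine Prod.ext ?_ ?_
    · dsimp only
      linear_combination (-delta α * g.a₃) * h
    · dsimp only
      linear_combination (norm := module) (-delta α * h) • g.v₃

end G

/-- For b = v^♯ the element T(v, b)v - v^♯ × b is (3 - 2)N(v)v, so the fourth axiom reads N(v)⁴ =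
N(v)² conj(N(v^♯)) and N(v) cancels when nonzero. If N(v) = 0, then (v^♯)^♯ = 0, hence N(v^♯)v^♯ =
0; in a field N(v^♯) ≠ 0 would give v^♯ = 0, which contradicts N(0) = 0. -/
theorem ground_N_sharp (hK : IsField (QuadExt α)) (v : J) :
    H.N.ground (H.sharp.ground v) = star (H.N.ground v) ^ 2 := by
  by_cases hn : H.N.ground v = 0
  · have h := H.ground_sharp_sharp (H.sharp.ground v)
    rw [H.ground_sharp_sharp v, hn, zero_smul, ground_sharp_zero] at h
    rw [hn, star_zero, zero_pow two_ne_zero]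
    by_contra h0
    obtain ⟨b, hb⟩ := hK.mul_inv_cancel h0
    have hs : H.sharp.ground v = 0 := by
      rw [← one_smul (QuadExt α) (H.sharp.ground v), ← hb, mul_comm, mul_smul, ← h, smul_zero]
    exact h0 (by rw [hs, ground_N_zero])
  · obtain ⟨b, hb⟩ := hK.mul_inv_cancel hn
    have h := H.ground_N_U v (H.sharp.ground v)
    rw [cross_self, ground_sharp_sharp, T_self_sharp, smul_smul, ← sub_smul,
      show 3 * H.N.ground v - 2 * H.N.ground v = H.N.ground v by ring, ground_N_smul] at h
    have h2 : star (H.N.ground (H.sharp.ground v)) = H.N.ground v ^ 2 := by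
      linear_combination (-b ^ 2) * h + (H.N.ground v ^ 2 - star (H.N.ground (H.sharp.ground v))) *
        (1 + H.N.ground v * b) * hb
    rw [← star_star (H.N.ground (H.sharp.ground v)), h2, star_pow]

theorem IsDivision.isField [Nontrivial R] (hα : IsUnit (1 - 4 * α)) (h : H.IsDivision) :
    IsField R := by
  refine ⟨exists_pair_ne R, mul_comm, fun {r} hr => ?_⟩
  -- A skew u has trace zero, so it defines an element of G; its quartic norm u ū is -(1 - 4α)r²,
  -- and r divides it.
  let g : H.G := ⟨0, 0, algebraMap R (QuadExt α) r * delta α, by simp [star_delta]⟩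
  have hg : g.nuK = algebraMap R (QuadExt α) (r * (-r * (1 - 4 * α))) := by
    have : g.nuK = algebraMap R (QuadExt α) r * delta α *
      star (algebraMap R (QuadExt α) r * delta α) := by
        simp [G.nuK, g, ground_sharp_zero]
    rw [this, map_mul, map_mul, ← delta_sq, star_mul', star_delta]
    simp
    ring
  have hnu : g.nu = r * (-r * (1 - 4 * α)) := by
    rw [G.nu, hg, QuadraticAlgebra.algebraMap_re]
  have hne : g ≠ 1 := fun e => hr <| algebraMap_mul_delta_cancel hα <| by
    rw [map_zero, zero_mul]
    exact congrArg G.u e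
  obtain ⟨s, hs⟩ := (isUnit_of_mul_isUnit_left (hnu ▸ h g hne)).exists_right_inv
  exact ⟨s, hs⟩

theorem IsDivision.isField_quadExt [Nontrivial R] (hα : IsUnit (1 - 4 * α)) (h : H.IsDivision) :
    IsField (QuadExt α) := by
  refine ⟨⟨0, 1, fun e => ?_⟩, mul_comm, fun {a} ha => ?_⟩
  · exact zero_ne_one (congrArg QuadraticAlgebra.re e)
  · by_cases hn : QuadraticAlgebra.norm a = 0
    · have ha' : a * star a = 0 := by
        rw [← QuadraticAlgebra.algebraMap_norm_eq_mul_star, hn, map_zero]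
      -- An isotropic a gives an element of G with u = 0 and v = 0, so ν vanishes; hence nonzero
      -- elements of K have nonzero norm in the field R.
      let g : H.G := ⟨a, 0, 0, by simp [ha']⟩
      have hg : g.nuK = 0 := by simp [G.nuK, g, ground_sharp_zero, ground_N_zero]
      have hu := h g fun e => ha (congrArg G.a e)
      rw [G.nu, hg] at hu
      exact (not_isUnit_zero hu).elim
    · obtain ⟨s, hs⟩ := (h.isField hα).mul_inv_cancel hn
      refine ⟨star a * algebraMap R (QuadExt α) s, ?_⟩
      rw [← mul_assoc, ← QuadraticAlgebra.algebraMap_norm_eq_mul_star, ← map_mul, hs, map_one]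

theorem IsDivision.oneInvertible (hα : IsUnit (1 - 4 * α)) (h : H.IsDivision) {g : H.G}
    (hg : g ≠ 1) : H.OneInvertible g := by
  cases subsingleton_or_nontrivial R with
  | inl _ =>
    -- Over the zero ring G consists of its unit only, so nothing has to be shown.
    have := Module.subsingleton R (QuadExt α)
    have := Module.subsingleton R J
    exact (hg (G.ext (Subsingleton.elim _ _) (Subsingleton.elim _ _) (Subsingleton.elim _ _))).elim
  | inr _ =>
    have hN := ground_N_sharp (H := H) (h.isField_quadExt hα)
    obtain ⟨μ, hμ⟩ := h g hg
    obtain ⟨μ', hμ'⟩ := h g.inv (G.inv_ne_one hg)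
    have e : g.nu * ↑μ⁻¹ = 1 := by rw [← hμ, Units.mul_inv]
    have e' : g.inv.nu * ↑μ'⁻¹ = 1 := by rw [← hμ', Units.mul_inv]
    refine oneInvertible_of_equiv_neg2 hα g (g.opp _ e) (g.inv.opp _ e') μ μ' ?_ ?_
    · rw [hμ, G.equiv_neg2_eq_expNeg (hN _)]
    · rw [hμ', G.equiv_neg2_eq_expNeg (hN _)]

end Division

end HermitianCubicNormStructure

end HermitianCubic

end

theorem mainTheorem4 {R : Type u} [CommRing R] (α : R) (hα : IsUnit (1 - 4 * α))
    {J : Type v} [AddCommGroup J] [Module R J] [Module (HermitianCubic.QuadExt α) J]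
    [IsScalarTower R (HermitianCubic.QuadExt α) J]
    (H : HermitianCubic.HermitianCubicNormStructure α J) :
    (H.IsDivision ↔ ∀ g : H.G, g ≠ 1 → H.OneInvertible g) ∧
    (Nontrivial R → H.IsDivision →
      IsField R ∧ IsField (HermitianCubic.QuadExt α) ∧
        Module.finrank R (HermitianCubic.QuadExt α) = 2) := by
  refine ⟨⟨fun h g hg => h.oneInvertible hα hg, fun h g hg => (h g hg).isUnit_nu hα⟩,
    fun _ h => ⟨h.isField hα, h.isField_quadExt hα, QuadraticAlgebra.finrank_eq_two _ _⟩⟩
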